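/- **Notions.** A *Seely category* is a symmetric monoidal closed category $(\mathcal L,\otimes,1,\multimap)$ which is $*$-autonomous with dualizing object $\bot$ (write $X^\perp\cong X\multimap\bot$), has finite products $(\top,\&)$, and carries a comonad $(!,\mathrm{der},\mathrm{dig})$ together with natural isomorphisms $m^0:1\to{!\top}$ and $m^2_{X,Y}:{!X}\otimes{!Y}\to{!(X\mathbin{\&}Y)}$ making $!$ a strong symmetric monoidal functor from $(\mathcal L,\&,\top)$ to $(\mathcal L,\otimes,1)$, with $!\langle !\pi_1,!\pi_2\rangle\circ\mathrm{dig}_{X\& Y}\circ m^2_{X,Y}=m^2_{!X,!Y}\circ(\mathrm{dig}_X\otimes\mathrm{dig}_Y)$. An *$n$-ary strong functor* on $\mathcal L$ is a functor $F:\mathcal L^n\to\mathcal L$ with a natural transformation (strength) $\varphi^F_{X,\vec Y}:{!X}\otimes F(\vec Y)\to F({!X}\otimes\vec Y)$, where ${!X}\otimes\vec Y=({!X}\otimes Y_1,\dots,{!X}\otimes Y_n)$, which is monoidal with respect to $m^0,m^2$ and compatible with $\mathrm{dig}$. Projections, constants, $\otimes$, $\&$, $!$ carry canonical strengths, strong functors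 compose, and every strong functor $F$ has a De Morgan dual $F^\perp(\vec Y)=(F(\vec Y^\perp))^\perp$, whose strength is the transpose of that of $F$. If $F$ is a $(k+1)$-ary strong functor, a *greatest fixed point* $\nu F$ is a $k$-ary strong functor such that, for all $\vec Y$, $F(\nu F(\vec Y),\vec Y)=\nu F(\vec Y)$ and $(\nu F(\vec Y),\mathrm{Id})$ is a final coalgebra of $F(-,\vec Y)$; for all $\vec f$, $F(\nu F(\vec f),\vec f)=\nu F(\vec f)$; and $F(\varphi^{\nu F}_{X,\vec Y},{!X}\otimes\vec Y)\circ\varphi^F_{X,(\nu F(\vec Y),\vec Y)}=\varphi^{\nu F}_{X,\vec Y}$. A *least fixed point* $\mu F$ is defined in the same way with "$(\mu F(\vec Y),\mathrm{Id})$ is an initial algebra of $F(-,\vec Y)$" instead. A *Seely model of $\mu\mathsf{LL}$* is a Seely category $\mathcal L$ with classes $\mathcal L_n$ ($n\in\mathbb N$) of $n$-ary strong functors such that: $\mathcal L_0$ is the class of objects of $\mathcal L$ (seen as $0$-ary constant strong functors); if $F\in\mathcal L_n$ and $G_1,\dots,G_n\in\mathcal L_k$ then $F\circ(G_1,\dots,G_n)\in\mathcal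 L_k$; all $k$ projections belong to $\mathcal L_k$; $\otimes,\&\in\mathcal L_2$ and $!\in\mathcal L_1$; if $F\in\mathcal L_n$ then $F^\perp\in\mathcal L_n$; for every $F\in\mathcal L_1$ the functor $F$ has a final coalgebra of the form $(A,\mathrm{Id})$; and every $F\in\mathcal L_{k+1}$ has a greatest fixed point $\nu F\in\mathcal L_k$. $\mathbf{REL}$ is the category of sets and relations, with its usual structure: $1=\bot$ is the one-point set $\{*\}$, $E\otimes F=(E\multimap F)=E\times F$, $E^\perp=E$, $\top=\emptyset$, $E\mathbin{\&}F=\{1\}\times E\cup\{2\}\times F$, $!E=\mathcal M_{\mathrm{fin}}(E)$ (finite multisets, a multiset being identified with its multiplicity function restricted to its support), $!s=\{([a_1,\dots,a_n],[b_1,\dots,b_n])\mid \forall i\ (a_i,b_i)\in s\}$, $\mathrm{der}_E=\{([a],a)\mid a\in E\}$, $\mathrm{dig}_E=\{(m_1+\dots+m_n,[m_1,\dots,m_n])\}$, $m^0=\{(*,[\,])\}$, $m^2_{E,F}=\{(([a_1,\dots,a_k],[b_1,\dots,b_l]),[(1,a_1),\dots,(1,a_k),(2,b_1),\dots,(2,b_l)])\}$.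 A functor $F:\mathbf{REL}^n\to\mathbf{REL}$ is *locally continuous* if $F(\bigcup D)=\bigcup_{\vec s\in D}F(\vec s)$ for every (nonempty) directed set $D\subseteq\mathbf{REL}^n(\vec E,\vec E')$ (componentwise unions); it is *strict* if, whenever $E_i\subseteq E'_i$ for all $i$, one has $F(\vec E)\subseteq F(\vec E')$ and $F$ maps the tuple of the inclusions $\{(a,a)\mid a\in E_i\}\in\mathbf{REL}(E_i,E_i')$ to the inclusion of $F(\vec E)$ in $F(\vec E')$. An *$n$-ary variable set* is an $n$-ary strong functor on $\mathbf{REL}$ whose underlying functor is locally continuous and strict; $\mathrm{VREL}_n$ is the class of all of them. **Theorem.** $(\mathbf{REL},(\mathrm{VREL}_n)_{n\in\mathbb N})$ is a Seely model of $\mu\mathsf{LL}$. Moreover, least and greatest fixed points are interpreted identically in this model: every $V\in\mathrm{VREL}_{k+1}$ has exactly one greatest fixed point $\nu V$ and exactly one least fixed point $\mu V$; they are the same strong functor, it belongs to $\mathrm{VREL}_k$, and on objects it is given by $$\nu V(\vec E)=\mu V(\vec E)=\bigcup_{n\in\mathbb N}V_{\vec E}^{\,n}(\emptyset),\qquad V_{\vec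 E}=V(-,\vec E).$$ -/

import Mathlib

open CategoryTheory MonoidalCategory

universe v u

namespace MuLL

/-! ### Seely categories -/

/-- The data of a Seely category: tensor product, internal hom, dualizing object, finite products,
exponential and Seely morphisms. The laws are collected in `IsSeely`. Composition `≫` is written in
diagrammatic order. -/
class SeelyStruct (C : Type u) [Category.{v} C] extends MonoidalCategoryStruct C where
  /-- symmetry of the tensor product -/
  braid : ∀ X Y : C, X ⊗ Y ≅ Y ⊗ X
  /-- the object `X ⊸ Y` of linear morphisms -/
  limpl : C → C → C
  /-- evaluation -/
  ev : ∀ X Y : C, limpl X Y ⊗ X ⟶ Y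
  /-- linear curryfication -/
  curry : ∀ {Z X Y : C}, (Z ⊗ X ⟶ Y) → (Z ⟶ limpl X Y)
  /-- the dualizing object -/
  bot : C
  /-- the dual of `X`, identified with `X ⊸ bot` through `orthIso` -/
  orth : C → C
  orthIso : ∀ X : C, orth X ≅ limpl X bot
  /-- the final object -/
  top : C
  toTop : ∀ X : C, X ⟶ top
  /-- the binary product `X & Y` -/
  wth : C → C → C
  pr₁ : ∀ X Y : C, wth X Y ⟶ X
  pr₂ : ∀ X Y : C, wth X Y ⟶ Y
  pairing : ∀ {Z X Y : C}, (Z ⟶ X) → (Z ⟶ Y) → (Z ⟶ wth X Y)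
  /-- the exponential `!`, on objects and on morphisms -/
  excl : C → C
  exclMap : ∀ {X Y : C}, (X ⟶ Y) → (excl X ⟶ excl Y)
  /-- dereliction -/
  der : ∀ X : C, excl X ⟶ X
  /-- digging -/
  dig : ∀ X : C, excl X ⟶ excl (excl X)
  /-- the Seely isomorphisms -/
  seely0 : 𝟙_ C ≅ excl top
  seely2 : ∀ X Y : C, excl X ⊗ excl Y ≅ excl (wth X Y)

section Generic

open SeelyStruct

variable {C : Type u} [Category.{v} C] [SeelyStruct C]

/-- Action of `&` on morphisms. -/
def wthMap {X X' Y Y' : C} (f : X ⟶ X') (g : Y ⟶ Y') : wth X Y ⟶ wth X' Y' :=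
  pairing (pr₁ X Y ≫ f) (pr₂ X Y ≫ g)

/-- The evaluation pairing `Xᗮ ⊗ X ⟶ bot`. -/
def orthEv (X : C) : orth X ⊗ X ⟶ (bot : C) :=
  (orthIso X).hom ▷ X ≫ ev X bot

/-- Curryfication towards a dual. -/
def orthCurry {Z X : C} (f : Z ⊗ X ⟶ bot) : Z ⟶ orth X :=
  curry f ≫ (orthIso X).inv

/-- The contravariant action of the dual on morphisms. -/
def orthMap {X Y : C} (f : X ⟶ Y) : orth Y ⟶ orth X :=
  orthCurry (orth Y ◁ f ≫ orthEv Y)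

/-- The canonical morphism from an object to its bidual. -/
def toBiorth (X : C) : X ⟶ orth (orth X) :=
  orthCurry ((braid X (orth X)).hom ≫ orthEv X)

variable (C) in
/-- The laws of a Seely category: a symmetric monoidal closed, `*`-autonomous, cartesian category
with a comonad `!` and a strong symmetric monoidal structure on `!` from `&` to `⊗`, compatible
with digging. -/
structure IsSeely : Prop where
  -- symmetric monoidal structure
  monoidal : ∃ M : MonoidalCategory C,
    M.toMonoidalCategoryStruct = SeelyStruct.toMonoidalCategoryStruct
  braid_natural : ∀ {X X' Y Y' : C} (f : X ⟶ X') (g : Y ⟶ Y'),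
    (f ⊗ₘ g) ≫ (braid X' Y').hom = (braid X Y).hom ≫ (g ⊗ₘ f)
  braid_braid : ∀ X Y : C, (braid X Y).hom ≫ (braid Y X).hom = 𝟙 (X ⊗ Y)
  hexagon : ∀ X Y Z : C,
    (α_ X Y Z).hom ≫ (braid X (Y ⊗ Z)).hom ≫ (α_ Y Z X).hom =
      (braid X Y).hom ▷ Z ≫ (α_ Y X Z).hom ≫ Y ◁ (braid X Z).hom
  -- closedness and `*`-autonomy
  curry_ev : ∀ {Z X Y : C} (f : Z ⊗ X ⟶ Y), curry f ▷ X ≫ ev X Y = f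
  curry_unique : ∀ {Z X Y : C} (g : Z ⟶ limpl X Y), curry (g ▷ X ≫ ev X Y) = g
  star_autonomous : ∀ X : C, IsIso (toBiorth X)
  -- finite products
  toTop_unique : ∀ {X : C} (f : X ⟶ top), f = toTop X
  pairing_pr₁ : ∀ {Z X Y : C} (f : Z ⟶ X) (g : Z ⟶ Y), pairing f g ≫ pr₁ X Y = f
  pairing_pr₂ : ∀ {Z X Y : C} (f : Z ⟶ X) (g : Z ⟶ Y), pairing f g ≫ pr₂ X Y = g
  pairing_unique : ∀ {Z X Y : C} (h : Z ⟶ wth X Y), pairing (h ≫ pr₁ X Y) (h ≫ pr₂ X Y) = h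
  -- the comonad
  excl_id : ∀ X : C, exclMap (𝟙 X) = 𝟙 (excl X)
  excl_comp : ∀ {X Y Z : C} (f : X ⟶ Y) (g : Y ⟶ Z), exclMap (f ≫ g) = exclMap f ≫ exclMap g
  der_natural : ∀ {X Y : C} (f : X ⟶ Y), exclMap f ≫ der Y = der X ≫ f
  dig_natural : ∀ {X Y : C} (f : X ⟶ Y), exclMap f ≫ dig Y = dig X ≫ exclMap (exclMap f)
  dig_der : ∀ X : C, dig X ≫ der (excl X) = 𝟙 (excl X)
  dig_exclMap_der : ∀ X : C, dig X ≫ exclMap (der X) = 𝟙 (excl X)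
  dig_dig : ∀ X : C, dig X ≫ dig (excl X) = dig X ≫ exclMap (dig X)
  -- `!` is strong symmetric monoidal from `(&, top)` to `(⊗, 𝟙_)`
  seely2_natural : ∀ {X X' Y Y' : C} (f : X ⟶ X') (g : Y ⟶ Y'),
    (exclMap f ⊗ₘ exclMap g) ≫ (seely2 X' Y').hom = (seely2 X Y).hom ≫ exclMap (wthMap f g)
  seely_assoc : ∀ X Y Z : C,
    (seely2 X Y).hom ▷ excl Z ≫ (seely2 (wth X Y) Z).hom ≫
        exclMap (pairing (pr₁ (wth X Y) Z ≫ pr₁ X Y)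
          (pairing (pr₁ (wth X Y) Z ≫ pr₂ X Y) (pr₂ (wth X Y) Z))) =
      (α_ (excl X) (excl Y) (excl Z)).hom ≫ excl X ◁ (seely2 Y Z).hom ≫ (seely2 X (wth Y Z)).hom
  seely_left_unit : ∀ X : C,
    seely0.hom ▷ excl X ≫ (seely2 top X).hom ≫ exclMap (pr₂ top X) = (λ_ (excl X)).hom
  seely_right_unit : ∀ X : C,
    excl X ◁ seely0.hom ≫ (seely2 X top).hom ≫ exclMap (pr₁ X top) = (ρ_ (excl X)).hom
  seely_symm : ∀ X Y : C,
    (seely2 X Y).hom ≫ exclMap (pairing (pr₂ X Y) (pr₁ X Y)) =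
      (braid (excl X) (excl Y)).hom ≫ (seely2 Y X).hom
  -- compatibility of the Seely isomorphisms with digging
  seely_dig : ∀ X Y : C,
    (seely2 X Y).hom ≫ dig (wth X Y) ≫ exclMap (pairing (exclMap (pr₁ X Y)) (exclMap (pr₂ X Y))) =
      (dig X ⊗ₘ dig Y) ≫ (seely2 (excl X) (excl Y)).hom

/-- Weakening `!X ⟶ 𝟙_`. -/
def weak (X : C) : excl X ⟶ 𝟙_ C := exclMap (toTop X) ≫ seely0.inv

/-- Contraction `!X ⟶ !X ⊗ !X`. -/
def contr (X : C) : excl X ⟶ excl X ⊗ excl X :=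
  exclMap (pairing (𝟙 X) (𝟙 X)) ≫ (seely2 X X).inv

/-- The lax monoidality `!X ⊗ !Y ⟶ !(X ⊗ Y)` of `!` from `⊗` to `⊗`. -/
def lax2 (X Y : C) : excl X ⊗ excl Y ⟶ excl (X ⊗ Y) :=
  (seely2 X Y).hom ≫ dig (wth X Y) ≫ exclMap (seely2 X Y).inv ≫ exclMap (der X ⊗ₘ der Y)

/-- The exchange `(W ⊗ X) ⊗ (Y ⊗ Z) ⟶ (W ⊗ Y) ⊗ (X ⊗ Z)`. -/
def exch (W X Y Z : C) : (W ⊗ X) ⊗ (Y ⊗ Z) ⟶ (W ⊗ Y) ⊗ (X ⊗ Z) :=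
  (α_ W X (Y ⊗ Z)).hom ≫ W ◁ (α_ X Y Z).inv ≫ W ◁ ((braid X Y).hom ▷ Z) ≫
    W ◁ (α_ Y X Z).hom ≫ (α_ W Y (X ⊗ Z)).inv

/-- Applying a linear functional on `P ⊗ Y` to its first argument:
`P ⊗ (P ⊗ Y)ᗮ ⟶ Yᗮ`. -/
def orthApply (P Y : C) : P ⊗ orth (P ⊗ Y) ⟶ orth Y :=
  orthCurry ((braid P (orth (P ⊗ Y))).hom ▷ Y ≫ (α_ (orth (P ⊗ Y)) P Y).hom ≫ orthEv (P ⊗ Y))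

/-! ### Strong functors -/

variable (C) in
/-- The data of an `n`-ary strong functor: an action on objects, an action on morphisms and a
strength. The laws are collected in `IsStrong`. -/
structure FunctorWithStrength (n : ℕ) where
  obj : (Fin n → C) → C
  map : ∀ {Y Z : Fin n → C}, (∀ i, Y i ⟶ Z i) → (obj Y ⟶ obj Z)
  strength : ∀ (X : C) (Y : Fin n → C), excl X ⊗ obj Y ⟶ obj (fun i => excl X ⊗ Y i)

namespace FunctorWithStrength

/-- Strong functors: functoriality, naturality of the strength, its monoidality and its
compatibility with digging. -/
structure IsStrong {n : ℕ} (F : FunctorWithStrength C n) : Prop where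
  map_id : ∀ Y : Fin n → C, F.map (fun i => 𝟙 (Y i)) = 𝟙 (F.obj Y)
  map_comp : ∀ {Y Z W : Fin n → C} (f : ∀ i, Y i ⟶ Z i) (g : ∀ i, Z i ⟶ W i),
    F.map (fun i => f i ≫ g i) = F.map f ≫ F.map g
  strength_natural : ∀ {X X' : C} {Y Y' : Fin n → C} (f : X ⟶ X') (g : ∀ i, Y i ⟶ Y' i),
    (exclMap f ⊗ₘ F.map g) ≫ F.strength X' Y' =
      F.strength X Y ≫ F.map (fun i => exclMap f ⊗ₘ g i)
  strength_seely2 : ∀ (X₁ X₂ : C) (Y : Fin n → C),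
    (seely2 X₁ X₂).hom ▷ F.obj Y ≫ F.strength (wth X₁ X₂) Y =
      (α_ (excl X₁) (excl X₂) (F.obj Y)).hom ≫ excl X₁ ◁ F.strength X₂ Y ≫
        F.strength X₁ (fun i => excl X₂ ⊗ Y i) ≫
          F.map (fun i => (α_ (excl X₁) (excl X₂) (Y i)).inv ≫ (seely2 X₁ X₂).hom ▷ Y i)
  strength_seely0 : ∀ Y : Fin n → C,
    seely0.hom ▷ F.obj Y ≫ F.strength top Y =
      (λ_ (F.obj Y)).hom ≫ F.map (fun i => (λ_ (Y i)).inv ≫ seely0.hom ▷ Y i)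
  strength_dig : ∀ (X : C) (Y : Fin n → C),
    dig X ▷ F.obj Y ≫ F.strength (excl X) Y =
      F.strength X Y ≫ F.map (fun i => dig X ▷ Y i)

/-- The `n`-ary constant strong functor. -/
def const (n : ℕ) (E : C) : FunctorWithStrength C n where
  obj _ := E
  map _ := 𝟙 E
  strength X _ := weak X ▷ E ≫ (λ_ E).hom

/-- The projection strong functors. -/
def proj (n : ℕ) (i : Fin n) : FunctorWithStrength C n where
  obj Y := Y i
  map f := f i
  strength X Y := 𝟙 (excl X ⊗ Y i)

/-- Composition of strong functors. -/
def comp {n k : ℕ} (F : FunctorWithStrength C n) (G : Fin n → FunctorWithStrength C k) :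
    FunctorWithStrength C k where
  obj Y := F.obj (fun i => (G i).obj Y)
  map f := F.map (fun i => (G i).map f)
  strength X Y := F.strength X (fun i => (G i).obj Y) ≫ F.map (fun i => (G i).strength X Y)

variable (C) in
/-- The binary strong functor `⊗`. -/
def tensor : FunctorWithStrength C 2 where
  obj Y := Y 0 ⊗ Y 1
  map f := f 0 ⊗ₘ f 1
  strength X Y := contr X ▷ (Y 0 ⊗ Y 1) ≫ exch (excl X) (excl X) (Y 0) (Y 1)

variable (C) in
/-- The binary strong functor `&`. -/
def wth : FunctorWithStrength C 2 where
  obj Y := SeelyStruct.wth (Y 0) (Y 1)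
  map f := wthMap (f 0) (f 1)
  strength X Y := pairing (excl X ◁ pr₁ (Y 0) (Y 1)) (excl X ◁ pr₂ (Y 0) (Y 1))

variable (C) in
/-- The unary strong functor `!`. -/
def excl : FunctorWithStrength C 1 where
  obj Y := SeelyStruct.excl (Y 0)
  map f := exclMap (f 0)
  strength X Y := dig X ▷ SeelyStruct.excl (Y 0) ≫ lax2 (SeelyStruct.excl X) (Y 0)

/-- The De Morgan dual `Y ↦ (F (Yᗮ))ᗮ`. Its strength is the transpose of
`(!X ⊗ (F (Yᗮ))ᗮ) ⊗ F ((!X ⊗ Y)ᗮ) ⟶ (!X ⊗ F ((!X ⊗ Y)ᗮ)) ⊗ (F (Yᗮ))ᗮ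
⟶ F (!X ⊗ (!X ⊗ Y)ᗮ) ⊗ (F (Yᗮ))ᗮ ⟶ F (Yᗮ) ⊗ (F (Yᗮ))ᗮ ⟶ bot`. -/
def dual {n : ℕ} (F : FunctorWithStrength C n) : FunctorWithStrength C n where
  obj Y := orth (F.obj (fun i => orth (Y i)))
  map f := orthMap (F.map (fun i => orthMap (f i)))
  strength X Y :=
    let P : C := SeelyStruct.excl X
    let A : C := F.obj (fun i => orth (Y i))
    let B : C := F.obj (fun i => orth (P ⊗ Y i))
    orthCurry ((α_ P (orth A) B).hom ≫ P ◁ (braid (orth A) B).hom ≫ (α_ P B (orth A)).inv ≫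
      (F.strength X (fun i => orth (P ⊗ Y i)) ≫ F.map (fun i => orthApply P (Y i))) ▷ orth A ≫
        (braid A (orth A)).hom ≫ orthEv A)

/-! ### Fixed points of strong functors

Fixed points of a `(k + 1)`-ary functor are taken with respect to its first argument. -/

/-- The tuple of morphisms `(e, g)`. -/
def consHom {k : ℕ} {A B : C} {Y Z : Fin k → C} (e : A ⟶ B) (g : ∀ i, Y i ⟶ Z i) :
    ∀ i : Fin (k + 1), (Fin.cons A Y : Fin (k + 1) → C) i ⟶ (Fin.cons B Z : Fin (k + 1) → C) i :=
  Fin.cases e g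

/-- `N` is a fixed point of the endofunctor `F (-, Y)`, and `(N, id)` is a final object in the
category of coalgebras of this endofunctor. -/
def IsFinalCoalgebra {k : ℕ} (F : FunctorWithStrength C (k + 1)) (Y : Fin k → C) (N : C) : Prop :=
  ∃ h : N = F.obj (Fin.cons N Y), ∀ (A : C) (t : A ⟶ F.obj (Fin.cons A Y)),
    ∃! e : A ⟶ N, e ≫ eqToHom h = t ≫ F.map (consHom e (fun i => 𝟙 (Y i)))

/-- `N` is a fixed point of the endofunctor `F (-, Y)`, and `(N, id)` is an initial object in the
category of algebras of this endofunctor. -/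
def IsInitialAlgebra {k : ℕ} (F : FunctorWithStrength C (k + 1)) (Y : Fin k → C) (N : C) : Prop :=
  ∃ h : F.obj (Fin.cons N Y) = N, ∀ (A : C) (t : F.obj (Fin.cons A Y) ⟶ A),
    ∃! e : N ⟶ A, eqToHom h ≫ e = F.map (consHom e (fun i => 𝟙 (Y i))) ≫ t

/-- `N` is a strong functor with `F (N Y, Y) = N Y` on objects, `F (N f, f) = N f` on morphisms,
and whose strength at `(X, Y)` is equal to the composite
`!X ⊗ N Y = !X ⊗ F (N Y, Y) ⟶ F (!X ⊗ N Y, !X ⊗ Y) ⟶ F (N (!X ⊗ Y), !X ⊗ Y) = N (!X ⊗ Y)`. -/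
def IsFixpoint {k : ℕ} (F : FunctorWithStrength C (k + 1)) (N : FunctorWithStrength C k) : Prop :=
  N.IsStrong ∧ ∃ h : ∀ Y, F.obj (Fin.cons (N.obj Y) Y) = N.obj Y,
    (∀ (Y Z : Fin k → C) (f : ∀ i, Y i ⟶ Z i),
      F.map (consHom (N.map f) f) ≫ eqToHom (h Z) = eqToHom (h Y) ≫ N.map f) ∧
    ∀ (X : C) (Y : Fin k → C),
      SeelyStruct.excl X ◁ eqToHom (h Y) ≫ N.strength X Y =
        F.strength X (Fin.cons (N.obj Y) Y) ≫
          F.map (Z := Fin.cons (N.obj fun i => SeelyStruct.excl X ⊗ Y i) fun i => SeelyStruct.excl X ⊗ Y i)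
            (Fin.cases (N.strength X Y) fun i => 𝟙 (SeelyStruct.excl X ⊗ Y i)) ≫ eqToHom (h _)

/-- `N` is the greatest fixed point `ν F`. -/
def IsGfp {k : ℕ} (F : FunctorWithStrength C (k + 1)) (N : FunctorWithStrength C k) : Prop :=
  F.IsFixpoint N ∧ ∀ Y, F.IsFinalCoalgebra Y (N.obj Y)

/-- `N` is the least fixed point `μ F`. -/
def IsLfp {k : ℕ} (F : FunctorWithStrength C (k + 1)) (N : FunctorWithStrength C k) : Prop :=
  F.IsFixpoint N ∧ ∀ Y, F.IsInitialAlgebra Y (N.obj Y)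

end FunctorWithStrength

/-! ### Seely models of linear logic with fixed points -/

variable (C) in
/-- `C`, with the classes `L n` of `n`-ary strong functors, is a Seely model of `μLL`. -/
structure IsMuLLModel (L : ∀ n : ℕ, Set (FunctorWithStrength C n)) : Prop where
  seely : IsSeely C
  strong : ∀ (n : ℕ), ∀ F ∈ L n, F.IsStrong
  /-- the elements of `L 0` are the objects of `C` -/
  zero : L 0 = Set.range (FunctorWithStrength.const 0)
  comp_mem : ∀ (n k : ℕ), ∀ F ∈ L n, ∀ G : Fin n → FunctorWithStrength C k,
    (∀ i, G i ∈ L k) → F.comp G ∈ L k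
  proj_mem : ∀ (k : ℕ) (i : Fin k), FunctorWithStrength.proj k i ∈ L k
  tensor_mem : FunctorWithStrength.tensor C ∈ L 2
  wth_mem : FunctorWithStrength.wth C ∈ L 2
  excl_mem : FunctorWithStrength.excl C ∈ L 1
  dual_mem : ∀ (n : ℕ), ∀ F ∈ L n, F.dual ∈ L n
  final : ∀ F ∈ L 1, ∃ N : C, F.IsFinalCoalgebra Fin.elim0 N
  gfp_mem : ∀ (k : ℕ), ∀ F ∈ L (k + 1), ∃ N ∈ L k, F.IsGfp N

end Generic

/-! ### Encoding of finite multisets as sets -/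

/-- The von Neumann natural numbers. -/
def numeral : ℕ → ZFSet.{u}
  | 0 => ∅
  | n + 1 => insert (numeral n) (numeral n)

theorem numeral_mem {m n : ℕ} (h : m < n) : numeral.{u} m ∈ numeral.{u} n := by
  induction n with
  | zero => omega
  | succ n ih =>
    rw [numeral, ZFSet.mem_insert_iff]
    rcases Nat.lt_succ_iff_lt_or_eq.mp h with h | h
    · exact Or.inr (ih h)
    · exact Or.inl (by rw [h])

theorem numeral_injective : Function.Injective numeral.{u} := by
  intro m n h
  rcases lt_trichotomy m n with hl | he | hl
  · have := numeral_mem.{u} hl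
    rw [h] at this
    exact absurd this (ZFSet.mem_irrefl _)
  · exact he
  · have := numeral_mem.{u} hl
    rw [h] at this
    exact absurd this (ZFSet.mem_irrefl _)

instance finite_support (m : Multiset ZFSet.{u}) : Finite {a : ZFSet.{u} // a ∈ m} := by
  classical
  exact Finite.of_injective (fun a : {a // a ∈ m} => (⟨a.1, by simpa using a.2⟩ : m.toFinset))
    (fun a b h => Subtype.ext (by simpa using h))

instance small_support (m : Multiset ZFSet.{u}) : Small.{u} {a : ZFSet.{u} // a ∈ m} :=
  Countable.toSmall _

instance small_multiset (α : Type v) [Small.{u} α] : Small.{u} (Multiset α) :=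
  inferInstanceAs (Small.{u} (Quotient (List.isSetoid α)))

open Classical in
/-- A finite multiset, as a set: the graph of its multiplicity function restricted to its
support. -/
noncomputable def multisetCode (m : Multiset ZFSet.{u}) : ZFSet.{u} :=
  ZFSet.range fun a : {a // a ∈ m} => ZFSet.pair a (numeral (m.count a.1))

theorem multisetCode_injective : Function.Injective multisetCode.{u} := by
  classical
  have key : ∀ m m' : Multiset ZFSet.{u}, multisetCode m = multisetCode m' → ∀ a ∈ m,
      m.count a = m'.count a := by
    intro m m' h a ha
    have h1 : ZFSet.pair a (numeral (m.count a)) ∈ multisetCode m := by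
      unfold multisetCode
      exact ZFSet.mem_range.mpr ⟨⟨a, ha⟩, by congr!⟩
    rw [h, multisetCode, ZFSet.mem_range] at h1
    obtain ⟨⟨b, hb⟩, h1⟩ := h1
    obtain ⟨h2, h3⟩ := ZFSet.pair_inj.mp h1
    have h4 : b = a := h2
    subst h4
    have h5 := numeral_injective h3
    rw [← h5]
  intro m m' h
  ext a
  by_cases ha : a ∈ m
  · exact key m m' h a ha
  · by_cases ha' : a ∈ m'
    · exact (key m' m h.symm a ha').symm
    · rw [Multiset.count_eq_zero_of_notMem ha, Multiset.count_eq_zero_of_notMem ha']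

/-! ### The category of sets and relations -/

/-- An object of `REL`: a set. -/
@[ext] structure REL : Type (u + 1) where
  set : ZFSet.{u}

namespace REL

instance : CoeSort REL.{u} (Type (u + 1)) := ⟨fun E => {a : ZFSet.{u} // a ∈ E.set}⟩

/-- A morphism of `REL` from `E` to `F`: a subset of `E × F`. -/
@[ext] structure Hom (E F : REL.{u}) : Type (u + 1) where
  rel : Set (E × F)

instance : Category REL.{u} where
  Hom := Hom
  id E := ⟨{p | p.1 = p.2}⟩
  comp s t := ⟨{p | ∃ b, (p.1, b) ∈ s.rel ∧ (b, p.2) ∈ t.rel}⟩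
  id_comp s := by
    apply Hom.ext
    ext ⟨a, b⟩
    simp
  comp_id s := by
    apply Hom.ext
    ext ⟨a, b⟩
    simp
  assoc s t r := by
    apply Hom.ext
    ext ⟨a, d⟩
    constructor
    · rintro ⟨c, ⟨b, h1, h2⟩, h3⟩
      exact ⟨b, h1, c, h2, h3⟩
    · rintro ⟨b, h1, c, h2, h3⟩
      exact ⟨c, ⟨b, h1, h2⟩, h3⟩

/-- The morphism given by a set of pairs. -/
def ofSet {E F : REL.{u}} (s : Set (E × F)) : E ⟶ F := Hom.mk s

/-- The set of pairs underlying a morphism. -/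
def rel {E F : REL.{u}} (s : E ⟶ F) : Set (E × F) := Hom.rel s

/-- The isomorphism given by the graph of a bijection. -/
def graphIso {E F : REL.{u}} (e : E ≃ F) : E ≅ F where
  hom := ofSet {p | e p.1 = p.2}
  inv := ofSet {p | e p.2 = p.1}
  hom_inv_id := by
    apply Hom.ext
    ext ⟨a, b⟩
    constructor
    · rintro ⟨c, h1, h2⟩
      exact e.injective (Eq.trans h1 (Eq.symm h2))
    · intro h
      exact ⟨e a, rfl, congrArg e (Eq.symm h)⟩
  inv_hom_id := by
    apply Hom.ext
    ext ⟨a, b⟩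
    constructor
    · rintro ⟨c, h1, h2⟩
      exact Eq.trans (Eq.symm h1) h2
    · intro h
      exact ⟨e.symm a, e.apply_symm_apply a, Eq.trans (e.apply_symm_apply a) h⟩

/-- The one-point set. -/
def one : REL.{u} := ⟨{∅}⟩

/-- The unique element of the one-point set. -/
def star : one.{u} := ⟨∅, ZFSet.mem_singleton.mpr rfl⟩

/-- The empty set. -/
def empty : REL.{u} := ⟨∅⟩

/-- The cartesian product of sets. -/
def times (E F : REL.{u}) : REL.{u} := ⟨ZFSet.prod E.set F.set⟩

/-- The elements of `times E F` are the pairs. -/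
noncomputable def pairs (E F : REL.{u}) : E × F ≃ times E F :=
  Equiv.ofBijective
    (fun p => ⟨ZFSet.pair p.1 p.2, ZFSet.mem_prod.mpr ⟨p.1, p.1.2, p.2, p.2.2, rfl⟩⟩) (by
      constructor
      · rintro ⟨a, b⟩ ⟨c, d⟩ h
        obtain ⟨h1, h2⟩ := ZFSet.pair_inj.mp (congrArg Subtype.val h)
        exact Prod.ext (Subtype.ext h1) (Subtype.ext h2)
      · rintro ⟨x, hx⟩
        obtain ⟨a, ha, b, hb, rfl⟩ := ZFSet.mem_prod.mp hx
        exact ⟨(⟨a, ha⟩, ⟨b, hb⟩), rfl⟩)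

/-- The disjoint union `{1} × E ∪ {2} × F`. -/
def plus (E F : REL.{u}) : REL.{u} :=
  ⟨ZFSet.prod {numeral 1} E.set ∪ ZFSet.prod {numeral 2} F.set⟩

/-- The elements of `plus E F` are the `(1, a)` with `a ∈ E` and the `(2, b)` with `b ∈ F`. -/
noncomputable def tagged (E F : REL.{u}) : E ⊕ F ≃ plus E F :=
  Equiv.ofBijective
    (Sum.elim
      (fun a => ⟨ZFSet.pair (numeral 1) a, ZFSet.mem_union.mpr (Or.inl
        (ZFSet.mem_prod.mpr ⟨_, ZFSet.mem_singleton.mpr rfl, a, a.2, rfl⟩))⟩)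
      (fun b => ⟨ZFSet.pair (numeral 2) b, ZFSet.mem_union.mpr (Or.inr
        (ZFSet.mem_prod.mpr ⟨_, ZFSet.mem_singleton.mpr rfl, b, b.2, rfl⟩))⟩)) (by
      constructor
      · rintro (a | a) (b | b) h
        · obtain ⟨h1, h2⟩ := ZFSet.pair_inj.mp (congrArg Subtype.val h)
          rw [Subtype.ext h2]
        · obtain ⟨h1, h2⟩ := ZFSet.pair_inj.mp (congrArg Subtype.val h)
          exact absurd (numeral_injective h1) (by decide)
        · obtain ⟨h1, h2⟩ := ZFSet.pair_inj.mp (congrArg Subtype.val h)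
          exact absurd (numeral_injective h1) (by decide)
        · obtain ⟨h1, h2⟩ := ZFSet.pair_inj.mp (congrArg Subtype.val h)
          rw [Subtype.ext h2]
      · rintro ⟨x, hx⟩
        rcases ZFSet.mem_union.mp hx with h | h
        · obtain ⟨i, hi, a, ha, rfl⟩ := ZFSet.mem_prod.mp h
          obtain rfl := ZFSet.mem_singleton.mp hi
          exact ⟨Sum.inl ⟨a, ha⟩, rfl⟩
        · obtain ⟨i, hi, a, ha, rfl⟩ := ZFSet.mem_prod.mp h
          obtain rfl := ZFSet.mem_singleton.mp hi
          exact ⟨Sum.inr ⟨a, ha⟩, rfl⟩)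

/-- The set of finite multisets of elements of a set. -/
noncomputable def mfin (E : REL.{u}) : REL.{u} :=
  ⟨ZFSet.range fun m : Multiset E => multisetCode (m.map Subtype.val)⟩

/-- The elements of `mfin E` are the finite multisets of elements of `E`. -/
noncomputable def multisets (E : REL.{u}) : Multiset E ≃ mfin E :=
  Equiv.ofBijective
    (fun m => ⟨multisetCode (m.map Subtype.val), ZFSet.mem_range.mpr ⟨m, rfl⟩⟩) (by
      constructor
      · intro m m' h
        exact Multiset.map_injective Subtype.val_injective
          (multisetCode_injective (congrArg Subtype.val h))
      · rintro ⟨x, hx⟩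
        obtain ⟨m, rfl⟩ := ZFSet.mem_range.mp hx
        exact ⟨m, rfl⟩)

/-- Multisets on types in bijection are in bijection. -/
def multisetCongr {α β : Type v} (e : α ≃ β) : Multiset α ≃ Multiset β where
  toFun := Multiset.map e
  invFun := Multiset.map e.symm
  left_inv m := by simp
  right_inv m := by simp

/-- A pair of multisets is the same thing as a multiset on the disjoint union. -/
def multisetSum (α β : Type v) : Multiset α × Multiset β ≃ Multiset (α ⊕ β) where
  toFun p := p.1.map Sum.inl + p.2.map Sum.inr
  invFun m := (m.filterMap Sum.getLeft?, m.filterMap Sum.getRight?)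
  left_inv := by
    rintro ⟨m, m'⟩
    have e5 : ∀ (γ δ : Type v) (s : Multiset γ), s.filterMap (fun _ => (none : Option δ)) = 0 := by
      intro γ δ s
      induction s using Multiset.induction_on with
      | empty => rfl
      | cons a s ih => rwa [Multiset.filterMap_cons_none _ _ rfl]
    simp [Multiset.filterMap_add, Multiset.filterMap_map, Function.comp_def, e5]
  right_inv := by
    intro m
    induction m using Multiset.induction_on with
    | empty => rfl
    | cons a s ih =>
      dsimp only at ih ⊢
      rcases a with a | b
      · rw [Multiset.filterMap_cons_some Sum.getLeft? (Sum.inl a) s rfl,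
          Multiset.filterMap_cons_none (f := Sum.getRight?) (Sum.inl a) s rfl, Multiset.map_cons, Multiset.cons_add, ih]
      · rw [Multiset.filterMap_cons_some Sum.getRight? (Sum.inr b) s rfl,
          Multiset.filterMap_cons_none (f := Sum.getLeft?) (Sum.inr b) s rfl, Multiset.map_cons, Multiset.add_cons, ih]

/-- The standard structure of Seely category on `REL`. -/
noncomputable instance : SeelyStruct REL.{u} where
  tensorObj := times
  tensorUnit := one
  tensorHom {E E' F F'} s t := ofSet {p | ∃ a a' b b', (a, a') ∈ rel s ∧ (b, b') ∈ rel t ∧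
    p = (pairs E F (a, b), pairs E' F' (a', b'))}
  whiskerLeft E {F F'} t := ofSet {p | ∃ a b b', (b, b') ∈ rel t ∧
    p = (pairs E F (a, b), pairs E F' (a, b'))}
  whiskerRight {E E'} s F := ofSet {p | ∃ a a' b, (a, a') ∈ rel s ∧
    p = (pairs E F (a, b), pairs E' F (a', b))}
  associator E F G := graphIso <|
    (pairs (times E F) G).symm.trans <| ((pairs E F).symm.prodCongr (Equiv.refl G)).trans <|
      (Equiv.prodAssoc E F G).trans <| ((Equiv.refl E).prodCongr (pairs F G)).trans <|
        pairs E (times F G)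
  leftUnitor E := graphIso <| (pairs one E).symm.trans
    ⟨Prod.snd, fun a => (star, a), fun p => Prod.ext (Subtype.ext
      (ZFSet.mem_singleton.mp p.1.2).symm) rfl, fun _ => rfl⟩
  rightUnitor E := graphIso <| (pairs E one).symm.trans
    ⟨Prod.fst, fun a => (a, star), fun p => Prod.ext rfl (Subtype.ext
      (ZFSet.mem_singleton.mp p.2.2).symm), fun _ => rfl⟩
  braid E F := graphIso <| (pairs E F).symm.trans <| (Equiv.prodComm E F).trans (pairs F E)
  limpl := times
  ev E F := ofSet {p | ∃ a b, p = (pairs (times E F) E (pairs E F (a, b), a), b)}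
  curry {G E F} s := ofSet {p | ∃ c a b, (pairs G E (c, a), b) ∈ rel s ∧ p = (c, pairs E F (a, b))}
  bot := one
  orth E := E
  orthIso E := graphIso <| (Equiv.trans
    ⟨fun a => (a, star), Prod.fst, fun _ => rfl, fun p => Prod.ext rfl (Subtype.ext
      (ZFSet.mem_singleton.mp p.2.2).symm)⟩ (pairs E one))
  top := empty
  toTop E := ofSet ∅
  wth := plus
  pr₁ E F := ofSet {p | ∃ a, p = (tagged E F (Sum.inl a), a)}
  pr₂ E F := ofSet {p | ∃ b, p = (tagged E F (Sum.inr b), b)}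
  pairing {G E F} s t := ofSet ({p | ∃ c a, (c, a) ∈ rel s ∧ p = (c, tagged E F (Sum.inl a))} ∪
    {p | ∃ c b, (c, b) ∈ rel t ∧ p = (c, tagged E F (Sum.inr b))})
  excl := mfin
  exclMap {E F} s := ofSet {p | ∃ l : Multiset (E × F), (∀ q ∈ l, q ∈ rel s) ∧
    p = (multisets E (l.map Prod.fst), multisets F (l.map Prod.snd))}
  der E := ofSet {p | ∃ a, p = (multisets E {a}, a)}
  dig E := ofSet {p | ∃ M : Multiset (Multiset E),
    p = (multisets E M.sum, multisets (mfin E) (M.map (multisets E)))}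
  seely0 := graphIso
    ⟨fun _ => multisets empty 0, fun _ => star,
      fun a => Subtype.ext (ZFSet.mem_singleton.mp a.2).symm, fun m => by
        rw [← (multisets empty).apply_symm_apply m]
        exact congrArg _ (Multiset.eq_zero_of_forall_notMem
          (fun a _ => ZFSet.notMem_empty a.1 a.2)).symm⟩
  seely2 E F := graphIso <|
    (pairs (mfin E) (mfin F)).symm.trans <|
      ((multisets E).symm.prodCongr (multisets F).symm).trans <|
        (multisetSum E F).trans <| (multisetCongr (tagged E F)).trans (multisets (plus E F))

/-- The union of a set of morphisms. -/
def sUnion {E F : REL.{u}} (D : Set (E ⟶ F)) : E ⟶ F := ofSet {p | ∃ s ∈ D, p ∈ rel s}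

/-- The relation `{(a, a) | a ∈ E}` from `E` to `F`, for `E ⊆ F`. -/
def incl (E F : REL.{u}) : E ⟶ F := ofSet {p | p.1.1 = p.2.1}

/-- `F` commutes with (componentwise) unions of directed sets of morphisms. -/
def LocallyContinuous {n : ℕ} (F : FunctorWithStrength REL.{u} n) : Prop :=
  ∀ (Y Z : Fin n → REL.{u}) (D : Set (∀ i, Y i ⟶ Z i)), D.Nonempty →
    DirectedOn (fun s t => ∀ i, rel (s i) ⊆ rel (t i)) D →
      F.map (fun i => sUnion {r | ∃ s ∈ D, s i = r}) = sUnion {r | ∃ s ∈ D, F.map s = r}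

/-- `F` maps inclusions to inclusions. -/
def Strict {n : ℕ} (F : FunctorWithStrength REL.{u} n) : Prop :=
  ∀ Y Z : Fin n → REL.{u}, (∀ i, (Y i).set ⊆ (Z i).set) →
    (F.obj Y).set ⊆ (F.obj Z).set ∧ F.map (fun i => incl (Y i) (Z i)) = incl (F.obj Y) (F.obj Z)

end REL

/-- The class of `n`-ary variable sets. -/
def VREL (n : ℕ) : Set (FunctorWithStrength REL.{u} n) :=
  {F | F.IsStrong ∧ REL.LocallyContinuous F ∧ REL.Strict F}

/-- The iterates `V_E ^ n (∅)` of the endofunctor `V_E = V (-, E)` at the empty set. -/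
def iterate {k : ℕ} (V : FunctorWithStrength REL.{u} (k + 1)) (E : Fin k → REL.{u}) : ℕ → REL.{u}
  | 0 => REL.empty
  | n + 1 => V.obj (Fin.cons (iterate V E n) E)

end MuLL

/-! The structural morphisms of `REL` other than evaluation (associator, symmetry, projections,
dereliction, digging, Seely isomorphisms, and hence weakening and contraction) are transposes `co f`
of graphs of functions from target to source. Since `co f ≫ co g = co (f ∘ g)`, the coherence
diagrams become identities between functions on pairs and finite multisets. Genuine relations enter
only in naturality and closedness. There `!s` is read as `Multiset.Rel`, the existence of a matching
of two multisets by related pairs, and the proof cuts matchings along sums.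

In `REL` an object is its own dual, and dualizing a morphism transposes it. So `V.dual` has the same
objects as `V`, conjugates morphisms by transposition, and its strength is that of `V` with input
and output exchanged (`twist`). Strictness survives dualization because the transpose of an
inclusion is its right adjoint for the order on relations, and monotone functors preserve
adjunctions (`map_tr_incl`).

For the fixed point, the identity of the union `fixObj V Y` of the iterates is the increasing union
of its restrictions to the iterates. Strictness and continuity then give `V (fixObj V Y, Y) = fixObj
V Y` as sets (`obj_fixObj`). An equation `e = c ≫ V (e, h)` with values in this union has a
solution, `corec c h`, the union of its Kleene approximations. The solution is unique because its
truncation to each iterate is determined by induction (`fixObj_hom_ext`). Finality is the case `h =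
id`. The functorial action and the strength of the fixed point are defined by `corec`, and each law
holds because its two sides solve the same equation.

A final coalgebra with identity structure contains all iterates, and finality makes it no larger
than their union (`eq_fixObj_of_isFinalCoalgebra`). The equations required of a fixed point then
determine its maps and strength. Transposition exchanges initial algebras of `V` with final
coalgebras of the dual of `V`, which has the same iterates, so least and greatest fixed points
coincide. -/

namespace MuLL

namespace REL

section

open SeelyStruct

variable {E E' F F' G H : REL.{u}}

/-! ### Morphisms of `REL` as binary relations -/

/-- The elements of a set. -/
abbrev El (E : REL.{u}) : Type (u + 1) := E

/-- The binary relation underlying a morphism. -/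
def R (s : E ⟶ F) (a : E) (b : F) : Prop := (a, b) ∈ rel s

theorem hom_ext {s t : E ⟶ F} (h : ∀ a b, R s a b ↔ R t a b) : s = t :=
  Hom.ext (Set.ext fun p => h p.1 p.2)

theorem R_id (a b : E) : R (𝟙 E) a b ↔ a = b := Iff.rfl

theorem R_comp (s : E ⟶ F) (t : F ⟶ G) (a : E) (c : G) :
    R (s ≫ t) a c ↔ ∃ b, R s a b ∧ R t b c := Iff.rfl

/-- The transpose of a relation. -/
def tr (s : E ⟶ F) : F ⟶ E := ofSet {p | R s p.2 p.1}

theorem R_tr (s : E ⟶ F) (a : F) (b : E) : R (tr s) a b ↔ R s b a := Iff.rfl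

theorem tr_tr (s : E ⟶ F) : tr (tr s) = s := rfl

theorem tr_id : tr (𝟙 E) = 𝟙 E := hom_ext fun _ _ => eq_comm

theorem tr_comp (s : E ⟶ F) (t : F ⟶ G) : tr (s ≫ t) = tr t ≫ tr s :=
  hom_ext fun _ _ => exists_congr fun _ => and_comm

/-- The transpose of the graph of a function. -/
def co (f : F → E) : E ⟶ F := ofSet {p | p.1 = f p.2}

theorem R_co (f : F → E) (a : E) (b : F) : R (co f) a b ↔ a = f b := Iff.rfl

theorem co_id : co (fun a : E => a) = 𝟙 E := rfl

/-- This reduces diagrams of structural morphisms to identities of functions, composed in the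
reverse direction. -/
theorem co_comp_co (f : F → E) (g : G → F) : co f ≫ co g = co fun c => f (g c) :=
  hom_ext fun a c => by simp only [R_comp, R_co, exists_eq_right]

theorem R_comp_co (s : E ⟶ F) (f : G → F) (a : E) (c : G) :
    R (s ≫ co f) a c ↔ R s a (f c) := by
  simp only [R_comp, R_co, exists_eq_right]

theorem R_co_comp (f : F → E) (s : F ⟶ G) (a : E) (c : G) :
    R (co f ≫ s) a c ↔ ∃ b, a = f b ∧ R s b c := Iff.rfl

theorem graphIso_hom (e : E ≃ F) : (graphIso e).hom = co e.symm :=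
  hom_ext fun _ _ => (Equiv.eq_symm_apply e).symm

theorem graphIso_inv (e : E ≃ F) : (graphIso e).inv = co e :=
  hom_ext fun _ _ => eq_comm

/-- `incl` does not depend on a proof of equality and is controlled by strictness, so all transports
in the fixed point conditions are replaced by it. -/
theorem eqToHom_eq_incl (h : E = F) : eqToHom h = incl E F := by
  subst h
  exact hom_ext fun _ _ => Subtype.ext_iff

theorem R_incl (a : E) (b : F) : R (incl E F) a b ↔ a.1 = b.1 := Iff.rfl

/-! ### Tensor product -/

/-- The pair of two elements. -/
noncomputable def tmk (a : E) (b : F) : (E ⊗ F : REL.{u}) := pairs E F (a, b)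

/-- The first component of a pair. -/
noncomputable def tfst (x : (E ⊗ F : REL.{u})) : E := ((pairs E F).symm x).1

/-- The second component of a pair. -/
noncomputable def tsnd (x : (E ⊗ F : REL.{u})) : F := ((pairs E F).symm x).2

@[simp] theorem tfst_tmk (a : E) (b : F) : tfst (tmk a b) = a := by
  unfold tfst tmk
  exact congrArg Prod.fst ((pairs E F).symm_apply_apply (a, b))

@[simp] theorem tsnd_tmk (a : E) (b : F) : tsnd (tmk a b) = b := by
  unfold tsnd tmk
  exact congrArg Prod.snd ((pairs E F).symm_apply_apply (a, b))

@[simp] theorem tmk_tfst_tsnd (x : (E ⊗ F : REL.{u})) : tmk (tfst x) (tsnd x) = x :=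
  (pairs E F).apply_symm_apply x

theorem tensor_ext {x y : (E ⊗ F : REL.{u})} (h : tfst x = tfst y) (h' : tsnd x = tsnd y) :
    x = y := by
  rw [← tmk_tfst_tsnd x, ← tmk_tfst_tsnd y, h, h']

theorem eq_tmk {x : (E ⊗ F : REL.{u})} {a : E} {b : F} :
    x = tmk a b ↔ tfst x = a ∧ tsnd x = b := by
  constructor
  · rintro rfl
    simp
  · rintro ⟨rfl, rfl⟩
    simp

theorem exists_tensor {p : El (E ⊗ F) → Prop} : (∃ x, p x) ↔ ∃ a b, p (tmk a b) :=
  ⟨fun ⟨x, h⟩ => ⟨tfst x, tsnd x, by simpa using h⟩, fun ⟨_, _, h⟩ => ⟨_, h⟩⟩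

theorem R_tensorHom (s : E ⟶ E') (t : F ⟶ F') (x : (E ⊗ F : REL.{u})) (y : (E' ⊗ F' : REL.{u})) :
    R (s ⊗ₘ t) x y ↔ R s (tfst x) (tfst y) ∧ R t (tsnd x) (tsnd y) := by
  constructor
  · rintro ⟨a, a', b, b', h1, h2, h⟩
    obtain rfl : x = tmk a b := congrArg Prod.fst h
    obtain rfl : y = tmk a' b' := congrArg Prod.snd h
    rw [tfst_tmk, tfst_tmk, tsnd_tmk, tsnd_tmk]
    exact ⟨h1, h2⟩
  · rintro ⟨h1, h2⟩
    refine ⟨_, _, _, _, h1, h2, ?_⟩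
    exact Prod.ext (tmk_tfst_tsnd x).symm (tmk_tfst_tsnd y).symm

theorem R_whiskerLeft (t : F ⟶ F') (x : (E ⊗ F : REL.{u})) (y : (E ⊗ F' : REL.{u})) :
    R (E ◁ t) x y ↔ tfst x = tfst y ∧ R t (tsnd x) (tsnd y) := by
  constructor
  · rintro ⟨a, b, b', h2, h⟩
    obtain rfl : x = tmk a b := congrArg Prod.fst h
    obtain rfl : y = tmk a b' := congrArg Prod.snd h
    rw [tfst_tmk, tfst_tmk, tsnd_tmk, tsnd_tmk]
    exact ⟨rfl, h2⟩
  · rintro ⟨h1, h2⟩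
    refine ⟨tfst x, tsnd x, tsnd y, h2, ?_⟩
    exact Prod.ext (tmk_tfst_tsnd x).symm (by rw [h1]; exact (tmk_tfst_tsnd y).symm)

theorem R_whiskerRight (s : E ⟶ E') (x : (E ⊗ F : REL.{u})) (y : (E' ⊗ F : REL.{u})) :
    R (s ▷ F) x y ↔ R s (tfst x) (tfst y) ∧ tsnd x = tsnd y := by
  constructor
  · rintro ⟨a, a', b, h1, h⟩
    obtain rfl : x = tmk a b := congrArg Prod.fst h
    obtain rfl : y = tmk a' b := congrArg Prod.snd h
    rw [tfst_tmk, tfst_tmk, tsnd_tmk, tsnd_tmk]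
    exact ⟨h1, rfl⟩
  · rintro ⟨h1, h2⟩
    refine ⟨tfst x, tfst y, tsnd x, h1, ?_⟩
    exact Prod.ext (tmk_tfst_tsnd x).symm (by rw [h2]; exact (tmk_tfst_tsnd y).symm)

theorem co_tensor_co (f : E' → E) (g : F' → F) :
    co f ⊗ₘ co g = co fun x => tmk (f (tfst x)) (g (tsnd x)) :=
  hom_ext fun x y => by simp only [R_tensorHom, R_co, eq_tmk]

theorem whiskerLeft_co (g : F' → F) : E ◁ co g = co fun x => tmk (tfst x) (g (tsnd x)) :=
  hom_ext fun x y => by simp only [R_whiskerLeft, R_co, eq_tmk]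

theorem co_whiskerRight (f : E' → E) : co f ▷ F = co fun x => tmk (f (tfst x)) (tsnd x) :=
  hom_ext fun x y => by simp only [R_whiskerRight, R_co, eq_tmk]

theorem associator_hom : (α_ E F G).hom =
    co fun x => tmk (tmk (tfst x) (tfst (tsnd x))) (tsnd (tsnd x)) :=
  graphIso_hom _

theorem associator_inv : (α_ E F G).inv =
    co fun x => tmk (tfst (tfst x)) (tmk (tsnd (tfst x)) (tsnd x)) :=
  graphIso_inv _

/-- The unique element of the unit object. -/
def pt : (𝟙_ REL.{u} : REL.{u}) := star

theorem eq_pt (x : (𝟙_ REL.{u} : REL.{u})) : x = pt := Subtype.ext (ZFSet.mem_singleton.mp x.2)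

theorem leftUnitor_hom : (λ_ E).hom = co fun a => tmk pt a := graphIso_hom _

theorem leftUnitor_inv : (λ_ E).inv = co fun x => tsnd x := graphIso_inv _

theorem rightUnitor_hom : (ρ_ E).hom = co fun a => tmk a pt := graphIso_hom _

theorem braid_hom : (braid E F).hom = co fun x => tmk (tsnd x) (tfst x) := graphIso_hom _

/-! ### Closed structure -/

theorem R_ev (x : (limpl E F ⊗ E : REL.{u})) (b : F) :
    R (ev E F) x b ↔ tfst x = pairs E F (tsnd x, b) := by
  constructor
  · rintro ⟨a, b', h⟩
    obtain rfl : x = tmk (E := limpl E F) (pairs E F (a, b')) a := congrArg Prod.fst h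
    obtain rfl : b = b' := congrArg Prod.snd h
    simp
  · intro h
    refine ⟨tsnd x, b, Prod.ext (Eq.trans (tmk_tfst_tsnd x).symm ?_) rfl⟩
    rw [h]
    rfl

theorem R_curry (s : G ⊗ E ⟶ F) (c : G) (a : E) (b : F) :
    R (curry s) c (pairs E F (a, b)) ↔ R s (tmk c a) b := by
  constructor
  · rintro ⟨c', a', b', h1, h⟩
    obtain rfl : c = c' := congrArg Prod.fst h
    have h2 := (pairs E F).injective (congrArg Prod.snd h)
    obtain rfl : a = a' := congrArg Prod.fst h2
    obtain rfl : b = b' := congrArg Prod.snd h2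
    exact h1
  · intro h
    exact ⟨c, a, b, h, rfl⟩

theorem orthIso_inv : (orthIso E).inv = co fun a => pairs E bot (a, pt) := graphIso_inv _

theorem R_orthIso_hom (a : E) (x : El (limpl E bot)) :
    R (orthIso E).hom a x ↔ x = pairs E bot (a, pt) := eq_comm

theorem R_orthEv (x : (orth E ⊗ E : REL.{u})) (b : (bot : REL.{u})) :
    R (orthEv E) x b ↔ (tfst x : E) = tsnd x := by
  obtain rfl : b = pt := eq_pt b
  simp only [orthEv, R_comp, exists_tensor, R_whiskerRight, R_orthIso_hom, R_ev, tfst_tmk, tsnd_tmk]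
  constructor
  · rintro ⟨_, _, ⟨h1, rfl⟩, h2⟩
    exact congrArg Prod.fst ((pairs E bot).injective (h1.symm.trans h2))
  · intro h
    exact ⟨_, _, ⟨rfl, rfl⟩, by rw [← h]⟩

theorem R_orthCurry (s : G ⊗ E ⟶ bot) (c : G) (a : E) :
    R (orthCurry s) c a ↔ R s (tmk c a) pt := by
  unfold orthCurry
  rw [← R_curry]
  rw [orthIso_inv, R_comp_co]

/-- The evaluation pairing of `E` with its dual is the diagonal (`R_orthEv`), so currying after
precomposing with `s` just reads `s` backwards. -/
theorem orthMap_eq_tr (s : E ⟶ F) : orthMap s = tr s :=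
  hom_ext fun b a => by
    simp only [orthMap, R_orthCurry, R_comp, exists_tensor, R_whiskerLeft, R_orthEv,
      tfst_tmk, tsnd_tmk]
    constructor
    · rintro ⟨_, _, ⟨rfl, h⟩, rfl⟩
      exact h
    · intro h
      exact ⟨b, b, ⟨rfl, h⟩, rfl⟩

theorem toBiorth_eq_id : toBiorth E = 𝟙 E :=
  hom_ext fun a b => by
    simp only [toBiorth, R_orthCurry, R_comp, exists_tensor, braid_hom, R_co, R_orthEv,
      tfst_tmk, tsnd_tmk]
    constructor
    · rintro ⟨x, y, h, rfl⟩
      have h1 := congrArg tfst h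
      have h2 := congrArg tsnd h
      simp only [tfst_tmk, tsnd_tmk] at h1 h2
      exact h1.trans h2.symm
    · intro h
      obtain rfl : a = b := h
      exact ⟨a, a, rfl, rfl⟩

/-! ### Finite products -/

theorem top_elim {p : Prop} (x : (top : REL.{u})) : p := absurd x.2 (ZFSet.notMem_empty x.1)

theorem toTop_eq (f : El top → E) : toTop E = co f :=
  hom_ext fun _ b => top_elim b

/-- The left inclusion in a disjoint union. -/
noncomputable def inl (a : E) : (wth E F : REL.{u}) := tagged E F (Sum.inl a)

/-- The right inclusion in a disjoint union. -/
noncomputable def inr (b : F) : (wth E F : REL.{u}) := tagged E F (Sum.inr b)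

/-- Case distinction in a disjoint union. -/
noncomputable def wcase {α : Sort*} (f : E → α) (g : F → α) (x : (wth E F : REL.{u})) : α :=
  match (tagged E F).symm x with
  | Sum.inl a => f a
  | Sum.inr b => g b

@[simp] theorem wcase_inl {α : Sort*} (f : E → α) (g : F → α) (a : E) :
    wcase f g (inl a : (wth E F : REL.{u})) = f a := by
  unfold wcase inl
  rw [(tagged E F).symm_apply_apply]

@[simp] theorem wcase_inr {α : Sort*} (f : E → α) (g : F → α) (b : F) :
    wcase f g (inr b : (wth E F : REL.{u})) = g b := by
  unfold wcase inr
  rw [(tagged E F).symm_apply_apply]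

theorem inl_injective : Function.Injective (inl : E → (wth E F : REL.{u})) :=
  (tagged E F).injective.comp Sum.inl_injective

theorem inr_injective : Function.Injective (inr : F → (wth E F : REL.{u})) :=
  (tagged E F).injective.comp Sum.inr_injective

theorem inl_ne_inr (a : E) (b : F) : (inl a : (wth E F : REL.{u})) ≠ inr b := fun h => by
  cases (tagged E F).injective h

@[elab_as_elim]
theorem wth_cases {p : El (wth E F) → Prop} (hl : ∀ a, p (inl a)) (hr : ∀ b, p (inr b))
    (x : (wth E F : REL.{u})) : p x := by
  obtain ⟨a | b, rfl⟩ := (tagged E F).surjective x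
  · exact hl a
  · exact hr b

theorem pr₁_eq : pr₁ E F = co inl :=
  hom_ext fun x a => ⟨fun ⟨_, h⟩ => by
      obtain rfl := congrArg Prod.snd h
      exact congrArg Prod.fst h,
    fun h => ⟨a, Prod.ext h rfl⟩⟩

theorem pr₂_eq : pr₂ E F = co inr :=
  hom_ext fun x a => ⟨fun ⟨_, h⟩ => by
      obtain rfl := congrArg Prod.snd h
      exact congrArg Prod.fst h,
    fun h => ⟨a, Prod.ext h rfl⟩⟩

theorem R_pairing_inl (s : G ⟶ E) (t : G ⟶ F) (c : G) (a : E) :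
    R (pairing s t) c (inl a) ↔ R s c a := by
  constructor
  · rintro (⟨c', a', h, h'⟩ | ⟨c', b, h, h'⟩)
    · obtain rfl : c = c' := congrArg Prod.fst h'
      obtain rfl : a = a' := inl_injective (congrArg Prod.snd h')
      exact h
    · exact absurd (congrArg Prod.snd h') (inl_ne_inr a b)
  · exact fun h => Or.inl ⟨c, a, h, rfl⟩

theorem R_pairing_inr (s : G ⟶ E) (t : G ⟶ F) (c : G) (b : F) :
    R (pairing s t) c (inr b) ↔ R t c b := by
  constructor
  · rintro (⟨c', a, h, h'⟩ | ⟨c', b', h, h'⟩)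
    · exact absurd (congrArg Prod.snd h').symm (inl_ne_inr a b)
    · obtain rfl : c = c' := congrArg Prod.fst h'
      obtain rfl : b = b' := inr_injective (congrArg Prod.snd h')
      exact h
  · exact fun h => Or.inr ⟨c, b, h, rfl⟩

theorem pairing_co (f : E → G) (g : F → G) : pairing (co f) (co g) = co (wcase f g) :=
  hom_ext fun c => wth_cases
    (fun a => by rw [R_pairing_inl, R_co, R_co, wcase_inl])
    (fun b => by rw [R_pairing_inr, R_co, R_co, wcase_inr])

/-! ### Exponential -/

/-- The element of `!E` given by a multiset. -/
noncomputable def bang (m : Multiset E) : (excl E : REL.{u}) := multisets E m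

/-- The multiset given by an element of `!E`. -/
noncomputable def unbang (x : (excl E : REL.{u})) : Multiset E := (multisets E).symm x

@[simp] theorem unbang_bang (m : Multiset E) : unbang (bang m) = m :=
  (multisets E).symm_apply_apply m

@[simp] theorem bang_unbang (x : (excl E : REL.{u})) : bang (unbang x) = x :=
  (multisets E).apply_symm_apply x

theorem bang_injective : Function.Injective (bang : Multiset E → (excl E : REL.{u})) :=
  (multisets E).injective

theorem eq_bang {x : (excl E : REL.{u})} {m : Multiset E} : x = bang m ↔ unbang x = m := by
  constructor
  · rintro rfl
    simp
  · rintro rfl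
    simp

theorem exists_excl {p : El (excl E) → Prop} : (∃ x, p x) ↔ ∃ m, p (bang m) :=
  ⟨fun ⟨x, h⟩ => ⟨unbang x, by simpa using h⟩, fun ⟨_, h⟩ => ⟨_, h⟩⟩

/-- A multiset of related pairs is the record of a derivation of `Multiset.Rel`. This gives
inductive access to `exclMap`, which is defined through such multisets. -/
theorem multisetRel_iff_exists {α β : Type*} (r : α → β → Prop) (m : Multiset α) (m' : Multiset β) :
    Multiset.Rel r m m' ↔
      ∃ l : Multiset (α × β), (∀ q ∈ l, r q.1 q.2) ∧ l.map Prod.fst = m ∧ l.map Prod.snd = m' := by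
  constructor
  · intro h
    induction h with
    | zero => exact ⟨0, by simp⟩
    | @cons a b as bs hab _ ih =>
      obtain ⟨l, h1, rfl, rfl⟩ := ih
      refine ⟨(a, b) ::ₘ l, ?_, by simp, by simp⟩
      intro q hq
      rcases Multiset.mem_cons.mp hq with rfl | hq
      exacts [hab, h1 q hq]
  · rintro ⟨l, h, rfl, rfl⟩
    induction l using Multiset.induction_on with
    | empty => exact Multiset.Rel.zero
    | cons a l ih =>
      rw [Multiset.map_cons, Multiset.map_cons]
      exact Multiset.Rel.cons (h a (Multiset.mem_cons_self a l))
        (ih fun q hq => h q (Multiset.mem_cons_of_mem hq))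

theorem R_exclMap (s : E ⟶ F) (x : (excl E : REL.{u})) (y : (excl F : REL.{u})) :
    R (exclMap s) x y ↔ Multiset.Rel (R s) (unbang x) (unbang y) := by
  rw [multisetRel_iff_exists]
  refine exists_congr fun l => and_congr Iff.rfl ?_
  rw [eq_comm (b := unbang x), eq_comm (b := unbang y), ← eq_bang, ← eq_bang]
  exact Prod.ext_iff

theorem multisetRel_eq_map {α β : Type*} (f : β → α) (m : Multiset α) (m' : Multiset β) :
    Multiset.Rel (fun a b => a = f b) m m' ↔ m = m'.map f := by
  rw [← Multiset.rel_eq, Multiset.rel_map_right]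

theorem exclMap_co (f : F → E) : exclMap (co f) = co fun y => bang ((unbang y).map f) :=
  hom_ext fun x y => by
    rw [R_exclMap, R_co, eq_bang, ← multisetRel_eq_map]
    rfl

theorem der_eq : der E = co fun a => bang {a} :=
  hom_ext fun x a => ⟨fun ⟨_, h⟩ => by
      obtain rfl := congrArg Prod.snd h
      exact congrArg Prod.fst h,
    fun h => ⟨a, Prod.ext h rfl⟩⟩

theorem dig_eq : dig E = co fun y => bang ((unbang y).map unbang).sum :=
  hom_ext fun x y => by
    constructor
    · rintro ⟨M, h⟩
      obtain rfl : x = bang M.sum := congrArg Prod.fst h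
      obtain rfl : y = bang (M.map bang) := congrArg Prod.snd h
      simp [R_co]
    · intro h
      refine ⟨(unbang y).map unbang, Prod.ext h ?_⟩
      conv_lhs => rw [← bang_unbang y]
      rw [Multiset.map_map]
      exact congrArg bang (((unbang y).map_id).symm.trans
        (Multiset.map_congr rfl fun z _ => (bang_unbang z).symm))

theorem seely0_hom : (seely0 : 𝟙_ REL.{u} ≅ _).hom = co fun _ => pt := graphIso_hom _

theorem seely0_inv : (seely0 : 𝟙_ REL.{u} ≅ _).inv = co fun _ => bang 0 := graphIso_inv _

theorem seely2_inv : (seely2 E F).inv = co fun x =>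
    bang ((unbang (tfst x)).map inl + (unbang (tsnd x)).map inr) := by
  refine Eq.trans (graphIso_inv _) (congrArg co (funext fun x => ?_))
  have h : ∀ p : Multiset E × Multiset F,
      (multisetSum E F p).map (tagged E F) = p.1.map inl + p.2.map inr := by
    intro p
    simp only [multisetSum, Equiv.coe_fn_mk, Multiset.map_add, Multiset.map_map]
    rfl
  exact congrArg bang (h _)

/-- The elements of `!E` and `!F` given by an element of `!(E & F)`. -/
noncomputable def split (x : (excl (wth E F) : REL.{u})) : (excl E ⊗ excl F : REL.{u}) :=
  tmk (bang ((unbang x).bind (wcase (fun a => {a}) fun _ => 0)))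
    (bang ((unbang x).bind (wcase (fun _ => 0) fun b => {b})))

theorem split_bang (m : Multiset E) (m' : Multiset F) :
    split (bang (m.map inl + m'.map inr)) = tmk (bang m) (bang m') := by
  have h : ∀ (α : Type (u + 1)) (s : Multiset α), (s.bind fun a => {a}) = s :=
    fun α s => (Multiset.bind_singleton s id).trans s.map_id
  simp [split, Multiset.bind_map, h]

theorem merge_split (x : (excl (wth E F) : REL.{u})) :
    bang ((unbang (tfst (split x))).map inl + (unbang (tsnd (split x))).map inr) = x := by
  refine (congrArg bang ?_).trans (bang_unbang x)
  unfold split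
  simp only [tfst_tmk, tsnd_tmk, unbang_bang]
  induction unbang x using Multiset.induction_on with
  | empty => rfl
  | cons z m ih =>
    conv_rhs => rw [← ih]
    rw [Multiset.cons_bind, Multiset.cons_bind, Multiset.map_add, Multiset.map_add]
    induction z using wth_cases <;> simp

/-- The inverse has a direct formula, so the forward morphism is found by cancellation: splitting
after merging is the identity. -/
theorem seely2_hom : (seely2 E F).hom = co split := by
  rw [← cancel_mono (seely2 E F).inv, Iso.hom_inv_id, seely2_inv, co_comp_co]
  refine co_id.symm.trans (congrArg co (funext fun x => ?_))
  rw [split_bang]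
  simp

theorem exists_merge (x : (excl (wth E F) : REL.{u})) :
    ∃ (m : Multiset E) (m' : Multiset F), x = bang (m.map inl + m'.map inr) :=
  ⟨_, _, (merge_split x).symm⟩

end

section

open SeelyStruct

variable {E E' F F' G G' H : REL.{u}}

/-! ### `REL` is a Seely category -/

/-- Precomposition with `co f` costs an existential over preimages; for a bijection it collapses to
evaluation at the inverse. -/
theorem R_co_comp_of_inverse {f : F → E} (g : E → F) (h : ∀ a, f (g a) = a) (h' : ∀ b, g (f b) = b)
    (s : F ⟶ G) (a : E) (c : G) : R (co f ≫ s) a c ↔ R s (g a) c := by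
  rw [R_co_comp]
  constructor
  · rintro ⟨b, rfl, hb⟩
    rwa [h']
  · exact fun hb => ⟨_, (h a).symm, hb⟩

theorem tensorHom_comp (s : E ⟶ F) (t : F ⟶ G) (s' : E' ⟶ F') (t' : F' ⟶ G') :
    (s ⊗ₘ s') ≫ (t ⊗ₘ t') = (s ≫ t) ⊗ₘ (s' ≫ t') :=
  hom_ext fun x y => by
    simp only [R_comp, exists_tensor, R_tensorHom, tfst_tmk, tsnd_tmk]
    constructor
    · rintro ⟨a, b, ⟨h1, h2⟩, h3, h4⟩
      exact ⟨⟨a, h1, h3⟩, b, h2, h4⟩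
    · rintro ⟨⟨a, h1, h3⟩, b, h2, h4⟩
      exact ⟨a, b, ⟨h1, h2⟩, h3, h4⟩

theorem whiskerLeft_eq (s : E ⟶ F) : G ◁ s = 𝟙 G ⊗ₘ s :=
  hom_ext fun x y => by simp only [R_whiskerLeft, R_tensorHom, R_id]

theorem whiskerRight_eq (s : E ⟶ F) : s ▷ G = s ⊗ₘ 𝟙 G :=
  hom_ext fun x y => by simp only [R_whiskerRight, R_tensorHom, R_id]

theorem id_tensor_id : 𝟙 E ⊗ₘ 𝟙 F = 𝟙 (E ⊗ F) :=
  hom_ext fun x y => by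
    rw [R_tensorHom, R_id, R_id, R_id]
    exact ⟨fun h => tensor_ext h.1 h.2, fun h => h ▸ ⟨rfl, rfl⟩⟩

noncomputable instance : MonoidalCategory REL.{u} where
  tensorHom_def s t := by
    rw [whiskerLeft_eq, whiskerRight_eq, tensorHom_comp, Category.id_comp, Category.comp_id]
  id_tensorHom_id _ _ := id_tensor_id
  tensorHom_comp_tensorHom _ _ _ _ := tensorHom_comp _ _ _ _
  whiskerLeft_id _ _ := by rw [whiskerLeft_eq, id_tensor_id]
  id_whiskerRight _ _ := by rw [whiskerRight_eq, id_tensor_id]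
  associator_naturality s t r := hom_ext fun x y => by
    rw [associator_hom, associator_hom, R_comp_co, R_co_comp_of_inverse
      (fun x => tmk (tfst (tfst x)) (tmk (tsnd (tfst x)) (tsnd x))) (by simp) (by simp)]
    simp only [R_tensorHom, tfst_tmk, tsnd_tmk, and_assoc]
  leftUnitor_naturality s := hom_ext fun x y => by
    rw [leftUnitor_hom, leftUnitor_hom, R_comp_co, R_co_comp_of_inverse
      (fun x => tsnd x) (fun x => by rw [← eq_pt (tfst x), tmk_tfst_tsnd]) (by simp)]
    simp only [R_whiskerLeft, tfst_tmk, tsnd_tmk, eq_pt (tfst x), true_and]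
  rightUnitor_naturality s := hom_ext fun x y => by
    rw [rightUnitor_hom, rightUnitor_hom, R_comp_co, R_co_comp_of_inverse
      (fun x => tfst x) (fun x => by rw [← eq_pt (tsnd x), tmk_tfst_tsnd]) (by simp)]
    simp only [R_whiskerRight, tfst_tmk, tsnd_tmk, eq_pt (tsnd x), and_true]
  pentagon _ _ _ _ := by
    simp only [associator_hom, whiskerLeft_co, co_whiskerRight, co_comp_co, tfst_tmk, tsnd_tmk]
  triangle _ _ := by
    simp only [associator_hom, leftUnitor_hom, rightUnitor_hom, whiskerLeft_co, co_whiskerRight,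
      co_comp_co, tfst_tmk, tsnd_tmk]

/-! ### Matchings of multisets and the laws of the exponential -/

/-- Functoriality of `!`: intermediate elements are chosen pair by pair along a matching, and two
matchings with a common middle are glued. -/
theorem multisetRel_comp {α β γ : Type*} (r : α → β → Prop) (s : β → γ → Prop) (m : Multiset α)
    (m' : Multiset γ) : Multiset.Rel (fun a c => ∃ b, r a b ∧ s b c) m m' ↔
      ∃ n, Multiset.Rel r m n ∧ Multiset.Rel s n m' := by
  constructor
  · intro h
    induction h with
    | zero => exact ⟨0, Multiset.Rel.zero, Multiset.Rel.zero⟩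
    | cons hab _ ih =>
      obtain ⟨b, h1, h2⟩ := hab
      obtain ⟨n, h3, h4⟩ := ih
      exact ⟨b ::ₘ n, Multiset.Rel.cons h1 h3, Multiset.Rel.cons h2 h4⟩
  · rintro ⟨n, h1, h2⟩
    induction h1 generalizing m' with
    | zero =>
      rw [Multiset.rel_zero_left] at h2
      rw [h2]
      exact Multiset.Rel.zero
    | cons hab _ ih =>
      obtain ⟨c, m'', h3, h4, rfl⟩ := Multiset.rel_cons_left.mp h2
      exact Multiset.Rel.cons ⟨_, hab, h3⟩ (ih _ h4)

theorem exclMap_id : exclMap (𝟙 E) = 𝟙 (excl E) := by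
  rw [← co_id, exclMap_co, ← co_id]
  simp

theorem exclMap_comp (s : E ⟶ F) (t : F ⟶ G) : exclMap (s ≫ t) = exclMap s ≫ exclMap t :=
  hom_ext fun x y => by
    simp only [R_comp, exists_excl, R_exclMap, unbang_bang]
    exact multisetRel_comp (R s) (R t) _ _

/-- Naturality of digging: a matching onto a sum of blocks cuts its source into corresponding
blocks. -/
theorem multisetRel_sum_right {α β : Type*} (r : α → β → Prop) (m : Multiset α)
    (M : Multiset (Multiset β)) : Multiset.Rel r m M.sum ↔
      ∃ N : Multiset (Multiset α), m = N.sum ∧ Multiset.Rel (Multiset.Rel r) N M := by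
  induction M using Multiset.induction_on generalizing m with
  | empty => simp
  | cons m' M ih =>
    rw [Multiset.sum_cons, Multiset.rel_add_right]
    constructor
    · rintro ⟨m1, m2, h1, h2, rfl⟩
      obtain ⟨N, rfl, h⟩ := (ih m2).mp h2
      exact ⟨m1 ::ₘ N, by simp, Multiset.Rel.cons h1 h⟩
    · rintro ⟨N, rfl, h⟩
      obtain ⟨m1, N', h1, h2, rfl⟩ := Multiset.rel_cons_right.mp h
      exact ⟨m1, N'.sum, h1, (ih _).mpr ⟨N', rfl, h2⟩, by simp⟩

theorem der_natural (s : E ⟶ F) : exclMap s ≫ der F = der E ≫ s :=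
  hom_ext fun x b => by
    rw [der_eq, der_eq, R_comp_co, R_co_comp, R_exclMap, unbang_bang]
    rw [← Multiset.cons_zero, Multiset.rel_cons_right]
    simp only [Multiset.rel_zero_right, eq_bang]
    constructor
    · rintro ⟨a, m, h, rfl, h'⟩
      exact ⟨a, h', h⟩
    · rintro ⟨a, h', h⟩
      exact ⟨a, 0, h, rfl, h'⟩

theorem dig_natural (s : E ⟶ F) : exclMap s ≫ dig F = dig E ≫ exclMap (exclMap s) :=
  hom_ext fun x y => by
    rw [dig_eq, dig_eq, R_comp_co, R_co_comp, R_exclMap, unbang_bang, multisetRel_sum_right]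
    simp only [R_exclMap, exists_excl, unbang_bang, eq_bang]
    have key : ∀ M : Multiset (El (excl E)),
        Multiset.Rel (R (exclMap s)) M (unbang y) ↔
          Multiset.Rel (Multiset.Rel (R s)) (M.map unbang) ((unbang y).map unbang) := by
      intro M
      rw [Multiset.rel_map]
      have : R (exclMap s) = fun a b => Multiset.Rel (R s) (unbang a) (unbang b) :=
        funext fun a => funext fun b => propext (R_exclMap s a b)
      rw [this]
    constructor
    · rintro ⟨N, h, h'⟩
      refine ⟨N.map bang, ?_, (key _).mpr ?_⟩
      · simpa [Multiset.map_map] using h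
      · simpa [Multiset.map_map] using h'
    · rintro ⟨M, h, h'⟩
      exact ⟨M.map unbang, h, (key M).mp h'⟩

/-- Associativity of flattening, which is what coassociativity of digging amounts to. -/
theorem sum_map_sum {α : Type*} (M : Multiset (Multiset (Multiset α))) :
    (M.map Multiset.sum).sum = M.sum.sum := by
  induction M using Multiset.induction_on with
  | empty => rfl
  | cons a M ih => simp [ih]

theorem map_sum_multiset {α β : Type*} (f : α → β) (M : Multiset (Multiset α)) :
    M.sum.map f = (M.map (Multiset.map f)).sum :=
  map_multiset_sum (Multiset.mapAddMonoidHom f) M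

theorem wthMap_co (f : E' → E) (g : F' → F) :
    wthMap (co f) (co g) = co (wcase (fun a => inl (f a)) fun b => inr (g b)) := by
  rw [wthMap, pr₁_eq, pr₂_eq, co_comp_co, co_comp_co, pairing_co]

theorem wth_hom_ext {s t : G ⟶ wth E F} (h₁ : s ≫ pr₁ E F = t ≫ pr₁ E F)
    (h₂ : s ≫ pr₂ E F = t ≫ pr₂ E F) : s = t :=
  hom_ext fun c => wth_cases
    (fun a => by
      rw [← R_comp_co s inl, ← R_comp_co t inl, ← pr₁_eq, h₁])
    (fun b => by
      rw [← R_comp_co s inr, ← R_comp_co t inr, ← pr₂_eq, h₂])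

theorem pairing_pr₁ (s : G ⟶ E) (t : G ⟶ F) : pairing s t ≫ pr₁ E F = s :=
  hom_ext fun c a => by rw [pr₁_eq, R_comp_co, R_pairing_inl]

theorem pairing_pr₂ (s : G ⟶ E) (t : G ⟶ F) : pairing s t ≫ pr₂ E F = t :=
  hom_ext fun c a => by rw [pr₂_eq, R_comp_co, R_pairing_inr]

theorem R_wthMap_inl (s : E ⟶ E') (t : F ⟶ F') (x : El (wth E F)) (a : E') :
    R (wthMap s t) x (inl a) ↔ ∃ b, x = inl b ∧ R s b a := by
  rw [wthMap, R_pairing_inl, pr₁_eq, R_co_comp]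

theorem R_wthMap_inr (s : E ⟶ E') (t : F ⟶ F') (x : El (wth E F)) (a : F') :
    R (wthMap s t) x (inr a) ↔ ∃ b, x = inr b ∧ R t b a := by
  rw [wthMap, R_pairing_inr, pr₂_eq, R_co_comp]

theorem split_merge (x : El (excl E ⊗ excl F)) :
    split (bang ((unbang (tfst x)).map inl + (unbang (tsnd x)).map inr)) = x := by
  rw [split_bang]
  simp

theorem merge_inj {m n : Multiset E} {m' n' : Multiset F}
    (h : m.map inl + m'.map inr = n.map inl + n'.map inr) : m = n ∧ m' = n' := by
  have h1 := (split_bang m m').symm.trans ((congrArg (fun x => split (bang x)) h).trans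
    (split_bang n n'))
  have h2 := congrArg tfst h1
  have h3 := congrArg tsnd h1
  simp only [tfst_tmk, tsnd_tmk] at h2 h3
  exact ⟨bang_injective h2, bang_injective h3⟩

/-- A matching onto `m.map inl + m'.map inr` cuts its source in two; `wthMap s t` respects tags, so
each piece lives in a single summand. -/
theorem seely2_natural (s : E ⟶ E') (t : F ⟶ F') :
    (exclMap s ⊗ₘ exclMap t) ≫ (seely2 E' F').hom =
      (seely2 E F).hom ≫ exclMap (wthMap s t) :=
  hom_ext fun x y => by
    obtain ⟨m, m', rfl⟩ := exists_merge y
    rw [seely2_hom, seely2_hom, R_comp_co, R_co_comp_of_inverse _ split_merge merge_split, split_bang]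
    simp only [R_tensorHom, R_exclMap, tfst_tmk, tsnd_tmk, unbang_bang]
    rw [Multiset.rel_add_right]
    have h1 : ∀ n, Multiset.Rel (R (wthMap s t)) n (m.map inl) ↔
        ∃ k, n = k.map inl ∧ Multiset.Rel (R s) k m := by
      intro n
      rw [Multiset.rel_map_right]
      simp only [R_wthMap_inl, multisetRel_comp, multisetRel_eq_map]
    have h2 : ∀ n, Multiset.Rel (R (wthMap s t)) n (m'.map inr) ↔
        ∃ k, n = k.map inr ∧ Multiset.Rel (R t) k m' := by
      intro n
      rw [Multiset.rel_map_right]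
      simp only [R_wthMap_inr, multisetRel_comp, multisetRel_eq_map]
    simp only [h1, h2]
    constructor
    · rintro ⟨h3, h4⟩
      exact ⟨_, _, ⟨_, rfl, h3⟩, ⟨_, rfl, h4⟩, rfl⟩
    · rintro ⟨_, _, ⟨k, rfl, h3⟩, ⟨k', rfl, h4⟩, h⟩
      obtain ⟨h5, h6⟩ := merge_inj h
      rw [h5, h6]
      exact ⟨h3, h4⟩

theorem split_eq_of_eq {x : El (excl (wth E F))} {m : Multiset E} {m' : Multiset F}
    (h : unbang x = m.map inl + m'.map inr) : split x = tmk (bang m) (bang m') := by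
  rw [← split_bang, ← h, bang_unbang]

theorem isSeely : IsSeely REL.{u} where
  monoidal := ⟨inferInstance, rfl⟩
  braid_natural s t := hom_ext fun x y => by
    rw [braid_hom, braid_hom, R_comp_co, R_co_comp_of_inverse
      (fun x => tmk (tsnd x) (tfst x)) (by simp) (by simp)]
    simp only [R_tensorHom, tfst_tmk, tsnd_tmk, and_comm]
  braid_braid _ _ := by
    simp only [braid_hom, co_comp_co, tfst_tmk, tsnd_tmk, tmk_tfst_tsnd, co_id]
  hexagon _ _ _ := by
    simp only [associator_hom, braid_hom, whiskerLeft_co, co_whiskerRight, co_comp_co, tfst_tmk,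
      tsnd_tmk]
  curry_ev s := hom_ext fun x b => by
    simp only [R_comp, exists_tensor, R_whiskerRight, R_ev, tfst_tmk, tsnd_tmk]
    constructor
    · rintro ⟨_, a, ⟨h1, h2⟩, rfl⟩
      rw [R_curry, ← h2, tmk_tfst_tsnd] at h1
      exact h1
    · intro h
      exact ⟨_, _, ⟨(R_curry s (tfst x) (tsnd x) b).mpr (by rwa [tmk_tfst_tsnd]), rfl⟩, rfl⟩
  curry_unique {G E F} s := hom_ext fun c x => by
    obtain ⟨⟨a, b⟩, rfl⟩ := (pairs E F).surjective x
    rw [R_curry]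
    simp only [R_comp, exists_tensor, R_whiskerRight, R_ev, tfst_tmk, tsnd_tmk]
    constructor
    · rintro ⟨_, a, ⟨h1, rfl⟩, rfl⟩
      exact h1
    · exact fun h => ⟨_, _, ⟨h, rfl⟩, rfl⟩
  star_autonomous _ := by
    rw [toBiorth_eq_id]
    exact IsIso.id _
  toTop_unique _ := hom_ext fun _ x => top_elim x
  pairing_pr₁ := pairing_pr₁
  pairing_pr₂ := pairing_pr₂
  pairing_unique _ := wth_hom_ext (pairing_pr₁ _ _) (pairing_pr₂ _ _)
  excl_id _ := exclMap_id
  excl_comp := exclMap_comp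
  der_natural := der_natural
  dig_natural := dig_natural
  dig_der _ := by
    simp only [dig_eq, der_eq, co_comp_co, unbang_bang, Multiset.map_singleton,
      Multiset.sum_singleton, bang_unbang, co_id]
  dig_exclMap_der _ := by
    simp only [dig_eq, der_eq, exclMap_co, co_comp_co, unbang_bang, Multiset.map_map,
      Function.comp_def, Multiset.sum_map_singleton, bang_unbang, co_id]
  dig_dig _ := by
    simp only [dig_eq, exclMap_co, co_comp_co, unbang_bang, Multiset.map_map, Function.comp_def]
    refine congrArg co (funext fun x => congrArg bang ?_)
    have h := sum_map_sum ((unbang x).map fun y => (unbang y).map unbang)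
    rw [Multiset.map_map] at h
    refine Eq.trans ?_ h.symm
    congr 1
    rw [map_sum_multiset, Multiset.map_map]
    rfl
  seely2_natural := seely2_natural
  seely_assoc _ _ _ := by
    simp only [associator_hom, seely2_hom, pr₁_eq, pr₂_eq, co_comp_co, pairing_co, exclMap_co,
      whiskerLeft_co, co_whiskerRight]
    refine congrArg co (funext fun x => ?_)
    obtain ⟨m, y, rfl⟩ := exists_merge x
    -- The second component is again a multiset over a disjoint union; viewing it as an element of
    -- an exponential lets `exists_merge` split it further.
    obtain ⟨z, hz⟩ : ∃ z, y = unbang z := ⟨bang y, by simp⟩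
    obtain ⟨m', m'', h⟩ := exists_merge z
    subst h
    rw [unbang_bang] at hz
    subst hz
    rw [split_bang]
    simp only [tfst_tmk, tsnd_tmk, unbang_bang]
    rw [split_eq_of_eq (m := m.map inl + m'.map inr) (m' := m'') (by
      simp [Multiset.map_map, add_assoc]), split_bang]
    simp only [tfst_tmk, tsnd_tmk, split_bang]
  seely_left_unit _ := by
    simp only [leftUnitor_hom, seely0_hom, seely2_hom, pr₂_eq, co_comp_co, exclMap_co, co_whiskerRight]
    refine congrArg co (funext fun x => ?_)
    rw [split_eq_of_eq (m := 0) (m' := unbang x) (by simp)]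
    simp
  seely_right_unit _ := by
    simp only [rightUnitor_hom, seely0_hom, seely2_hom, pr₁_eq, co_comp_co, exclMap_co, whiskerLeft_co]
    refine congrArg co (funext fun x => ?_)
    rw [split_eq_of_eq (m := unbang x) (m' := 0) (by simp)]
    simp
  seely_symm _ _ := by
    simp only [braid_hom, seely2_hom, pr₁_eq, pr₂_eq, co_comp_co, exclMap_co, pairing_co]
    refine congrArg co (funext fun x => ?_)
    obtain ⟨m, m', rfl⟩ := exists_merge x
    rw [split_bang, split_eq_of_eq (m := m') (m' := m) (by
      simp [Multiset.map_map, add_comm])]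
    simp
  seely_dig _ _ := by
    simp only [dig_eq, seely2_hom, pr₁_eq, pr₂_eq, co_comp_co, exclMap_co, pairing_co, co_tensor_co]
    refine congrArg co (funext fun x => ?_)
    obtain ⟨m, m', rfl⟩ := exists_merge x
    rw [split_bang, split_eq_of_eq (m := (m.map unbang).sum) (m' := (m'.map unbang).sum) (by
      simp [Multiset.map_map, map_sum_multiset])]
    simp

end

section

open SeelyStruct

variable {E E' F F' G G' H : REL.{u}}

/-! ### Local continuity and strictness -/

theorem R_sUnion {ι : Type*} (D : Set ι) (f : ι → (E ⟶ F)) (a : E) (b : F) :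
    R (sUnion {r | ∃ s ∈ D, f s = r}) a b ↔ ∃ s ∈ D, R (f s) a b := by
  constructor
  · rintro ⟨_, ⟨s, hs, rfl⟩, h⟩
    exact ⟨s, hs, h⟩
  · rintro ⟨s, hs, h⟩
    exact ⟨_, ⟨s, hs, rfl⟩, h⟩

/-- The componentwise union of a set of tuples of morphisms. -/
def tupleSup {n : ℕ} {Y Z : Fin n → REL.{u}} (D : Set (∀ i, Y i ⟶ Z i)) (i : Fin n) : Y i ⟶ Z i :=
  sUnion {r | ∃ s ∈ D, s i = r}

/-- Monotonicity of the action of a functor on morphisms. -/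
def LocallyMonotone {n : ℕ} (F : FunctorWithStrength REL.{u} n) : Prop :=
  ∀ (Y Z : Fin n → REL.{u}) (s t : ∀ i, Y i ⟶ Z i), (∀ i, rel (s i) ⊆ rel (t i)) →
    rel (F.map s) ⊆ rel (F.map t)

section

variable {n : ℕ} {V : FunctorWithStrength REL.{u} n}

/-- When `s ≤ t`, the set `{s, t}` is directed with union `t`. -/
theorem LocallyContinuous.monotone (hV : LocallyContinuous V) : LocallyMonotone V := by
  intro Y Z s t h
  have h1 := hV Y Z {s, t} ⟨s, Or.inl rfl⟩ (by
    intro a ha b hb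
    rcases ha with rfl | rfl <;> rcases hb with rfl | rfl
    · exact ⟨_, Or.inl rfl, fun _ => subset_rfl, fun _ => subset_rfl⟩
    · exact ⟨_, Or.inr rfl, h, fun _ => subset_rfl⟩
    · exact ⟨_, Or.inr rfl, fun _ => subset_rfl, h⟩
    · exact ⟨_, Or.inr rfl, fun _ => subset_rfl, fun _ => subset_rfl⟩)
  have h2 : (fun i => sUnion {r | ∃ s' ∈ ({s, t} : Set (∀ i, Y i ⟶ Z i)), s' i = r}) = t := by
    funext i
    refine hom_ext fun a b => ?_
    rw [R_sUnion]
    constructor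
    · rintro ⟨_, rfl | rfl, h3⟩
      exacts [h i h3, h3]
    · exact fun h3 => ⟨t, Or.inr rfl, h3⟩
  rw [h2] at h1
  rw [h1]
  rintro ⟨a, b⟩ h3
  exact (R_sUnion _ (fun s => V.map s) a b).mpr ⟨s, Or.inl rfl, h3⟩

theorem LocallyContinuous.exists_of_map_tupleSup (hV : LocallyContinuous V) {Y Z : Fin n → REL.{u}}
    {D : Set (∀ i, Y i ⟶ Z i)} (hne : D.Nonempty)
    (hD : DirectedOn (fun s t => ∀ i, rel (s i) ⊆ rel (t i)) D) {a : V.obj Y} {b : V.obj Z}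
    (h : R (V.map (tupleSup D)) a b) : ∃ s ∈ D, R (V.map s) a b := by
  have h1 := hV Y Z D hne hD
  rw [show (fun i => sUnion {r | ∃ s ∈ D, s i = r}) = tupleSup D from rfl] at h1
  rw [h1] at h
  exact (R_sUnion D (fun s => V.map s) a b).mp h

/-- Monotonicity already gives one inclusion; continuity then means that each pair in the image of a
union is produced by a single member of the family. -/
theorem locallyContinuous_of_monotone (hV : LocallyMonotone V)
    (h : ∀ (Y Z : Fin n → REL.{u}) (D : Set (∀ i, Y i ⟶ Z i)), D.Nonempty →
      DirectedOn (fun s t => ∀ i, rel (s i) ⊆ rel (t i)) D →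
      ∀ (a : V.obj Y) (b : V.obj Z), R (V.map (tupleSup D)) a b → ∃ s ∈ D, R (V.map s) a b) :
    LocallyContinuous V := by
  intro Y Z D hne hD
  refine hom_ext fun a b => ?_
  rw [R_sUnion]
  constructor
  · exact h Y Z D hne hD a b
  · rintro ⟨s, hs, h1⟩
    exact hV Y Z s (tupleSup D) (fun i p hp => (R_sUnion D (fun s => s i) p.1 p.2).mpr ⟨s, hs, hp⟩) h1

theorem R_tupleSup {Y Z : Fin n → REL.{u}} (D : Set (∀ i, Y i ⟶ Z i)) (i : Fin n) (a : Y i)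
    (b : Z i) : R (tupleSup D i) a b ↔ ∃ s ∈ D, R (s i) a b :=
  R_sUnion D (fun s => s i) a b

end

/-! ### Constants, projections and composition -/

theorem weak_eq : weak E = co fun _ => bang 0 := by
  rw [weak, toTop_eq fun x => absurd x.2 (ZFSet.notMem_empty x.1), exclMap_co, seely0_inv,
    co_comp_co]
  simp only [unbang_bang, Multiset.map_zero]

theorem weak_whiskerRight (A : REL.{u}) :
    weak E ▷ A ≫ (λ_ A).hom = co fun a => tmk (bang 0) a := by
  simp only [weak_eq, leftUnitor_hom, co_whiskerRight, co_comp_co, tsnd_tmk]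

/-- There is a single empty tuple, so the functor is constant with identity action. The strength is
then forced to be the weakening of the constant functor. -/
theorem isStrong_of_zero {F : FunctorWithStrength REL.{u} 0} (hF : F.IsStrong) :
    ∃ A, F = FunctorWithStrength.const 0 A := by
  obtain ⟨obj, map, strength⟩ := F
  have hY : ∀ Y : Fin 0 → REL.{u}, Y = Fin.elim0 := fun Y => Subsingleton.elim _ _
  obtain ⟨A, rfl⟩ : ∃ A, obj = fun _ => A := ⟨obj Fin.elim0, funext fun Y => by rw [hY Y]⟩
  refine ⟨A, ?_⟩
  have hmap : ∀ (Y Z : Fin 0 → REL.{u}) (f : ∀ i, Y i ⟶ Z i), map f = 𝟙 A := by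
    intro Y Z f
    obtain rfl := hY Y
    obtain rfl := hY Z
    rw [show f = fun i => 𝟙 _ from Subsingleton.elim _ _]
    exact hF.map_id _
  obtain rfl : @map = fun {_ _} _ => 𝟙 A := by
    funext Y Z f
    exact hmap Y Z f
  have hstr : ∀ X Y, strength X Y = (FunctorWithStrength.const 0 A).strength X Y := by
    intro X Y
    -- The unit law fixes the strength at `top`; naturality along `toTop X` transports it to every
    -- `X`.
    have h0 : seely0.hom ▷ A ≫ strength top Y = (λ_ A).hom ≫ 𝟙 A := hF.strength_seely0 Y
    have h1 : (exclMap (toTop X) ⊗ₘ 𝟙 A) ≫ strength top Y = strength X Y ≫ 𝟙 A :=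
      hF.strength_natural (toTop X) (fun i : Fin 0 => 𝟙 (Y i))
    rw [Category.comp_id] at h0 h1
    rw [← h1]
    change _ = (exclMap (toTop X) ≫ seely0.inv) ▷ A ≫ (λ_ A).hom
    rw [← h0, tensorHom_id, ← comp_whiskerRight_assoc, Category.assoc, Iso.inv_hom_id,
      Category.comp_id]
  obtain rfl : strength = (FunctorWithStrength.const 0 A).strength := by
    funext X Y
    exact hstr X Y
  rfl

theorem const_mem (A : REL.{u}) : FunctorWithStrength.const 0 A ∈ VREL.{u} 0 := by
  refine ⟨⟨?_, ?_, ?_, ?_, ?_, ?_⟩, ?_, ?_⟩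
  · intros; rfl
  · intros; exact (Category.id_comp _).symm
  · intro X X' Y Y' f g
    change (exclMap f ⊗ₘ 𝟙 A) ≫ (weak X' ▷ A ≫ (λ_ A).hom) = (weak X ▷ A ≫ (λ_ A).hom) ≫ 𝟙 A
    rw [weak_whiskerRight, weak_whiskerRight, Category.comp_id]
    refine hom_ext fun x y => ?_
    rw [R_comp_co, R_tensorHom, R_exclMap, tfst_tmk, tsnd_tmk, unbang_bang, Multiset.rel_zero_right,
      R_co, R_id, eq_tmk, eq_bang]
  · intro X₁ X₂ Y
    change (seely2 X₁ X₂).hom ▷ A ≫ (weak (SeelyStruct.wth X₁ X₂) ▷ A ≫ (λ_ A).hom) =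
      (α_ (excl X₁) (excl X₂) A).hom ≫ excl X₁ ◁ (weak X₂ ▷ A ≫ (λ_ A).hom) ≫
        (weak X₁ ▷ A ≫ (λ_ A).hom) ≫ 𝟙 A
    simp only [weak_whiskerRight, Category.comp_id, seely2_hom,
      associator_hom, whiskerLeft_co, co_whiskerRight, co_comp_co, tfst_tmk, tsnd_tmk]
    refine congrArg co (funext fun x => ?_)
    rw [split_eq_of_eq (m := 0) (m' := 0) (by simp)]
  · intro Y
    change seely0.hom ▷ A ≫ (weak top ▷ A ≫ (λ_ A).hom) = (λ_ A).hom ≫ 𝟙 A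
    rw [weak_whiskerRight]
    simp only [Category.comp_id, seely0_hom, leftUnitor_hom, co_whiskerRight, co_comp_co, tsnd_tmk]
  · intro X Y
    change dig X ▷ A ≫ (weak (excl X) ▷ A ≫ (λ_ A).hom) = (weak X ▷ A ≫ (λ_ A).hom) ≫ 𝟙 A
    simp only [weak_whiskerRight, Category.comp_id, dig_eq,
      co_whiskerRight, co_comp_co, tfst_tmk, tsnd_tmk, unbang_bang, Multiset.map_zero,
      Multiset.sum_zero]
  · refine locallyContinuous_of_monotone (fun _ _ _ _ _ => subset_rfl) ?_
    rintro Y Z D ⟨s, hs⟩ - a b h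
    exact ⟨s, hs, h⟩
  · intro Y Z h
    exact ⟨subset_rfl, eqToHom_eq_incl rfl⟩

theorem zero_eq_range : VREL.{u} 0 = Set.range (FunctorWithStrength.const 0) := by
  ext F
  constructor
  · intro h
    obtain ⟨A, rfl⟩ := isStrong_of_zero h.1
    exact ⟨A, rfl⟩
  · rintro ⟨A, rfl⟩
    exact const_mem A

theorem proj_mem (k : ℕ) (i : Fin k) : FunctorWithStrength.proj k i ∈ VREL.{u} k := by
  refine ⟨⟨?_, ?_, ?_, ?_, ?_, ?_⟩, ?_, ?_⟩
  · intros; rfl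
  · intros; rfl
  · intros; exact (Category.comp_id _).trans (Category.id_comp _).symm
  · intros; simp [FunctorWithStrength.proj]
  · intros; simp [FunctorWithStrength.proj]
  · intros; simp [FunctorWithStrength.proj]
  · refine locallyContinuous_of_monotone (fun _ _ s t h => h i) ?_
    intro Y Z D _ _ a b h
    exact (R_tupleSup D i a b).mp h
  · intro Y Z h
    exact ⟨h i, rfl⟩

theorem comp_isStrong {n k : ℕ} {F : FunctorWithStrength REL.{u} n}
    {G : Fin n → FunctorWithStrength REL.{u} k} (hF : F.IsStrong) (hG : ∀ i, (G i).IsStrong) :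
    (F.comp G).IsStrong := by
  refine ⟨?_, ?_, ?_, ?_, ?_, ?_⟩
  · intro Y
    simp only [FunctorWithStrength.comp, (hG _).map_id, hF.map_id]
  · intro Y Z W f g
    simp only [FunctorWithStrength.comp, (hG _).map_comp, hF.map_comp]
  · intro X X' Y Y' f g
    simp only [FunctorWithStrength.comp]
    rw [← Category.assoc, hF.strength_natural, Category.assoc, Category.assoc, ← hF.map_comp,
      ← hF.map_comp]
    simp only [(hG _).strength_natural]
  · intro X₁ X₂ Y
    simp only [FunctorWithStrength.comp]
    rw [← Category.assoc, hF.strength_seely2]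
    simp only [Category.assoc, MonoidalCategory.whiskerLeft_comp]
    -- Naturality in the second variable moves the strengths of the `G i` past that of `F`, so that
    -- the strengths at `X₁` and at `X₂` can each be collected.
    have h := hF.strength_natural (𝟙 X₁) (fun i => (G i).strength X₂ Y)
    simp only [exclMap_id, id_tensorHom] at h
    rw [reassoc_of% h]
    simp only [← hF.map_comp, Category.assoc, (hG _).strength_seely2, Iso.inv_hom_id_assoc]
  · intro Y
    simp only [FunctorWithStrength.comp]
    rw [← Category.assoc, hF.strength_seely0]
    simp only [← hF.map_comp, Category.assoc, (hG _).strength_seely0, Iso.inv_hom_id_assoc]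
  · intro X Y
    simp only [FunctorWithStrength.comp]
    rw [← Category.assoc, hF.strength_dig]
    simp only [← hF.map_comp, Category.assoc, (hG _).strength_dig]

theorem comp_mem (n k : ℕ) (F : FunctorWithStrength REL.{u} n) (hF : F ∈ VREL n)
    (G : Fin n → FunctorWithStrength REL.{u} k) (hG : ∀ i, G i ∈ VREL k) : F.comp G ∈ VREL k := by
  refine ⟨comp_isStrong hF.1 fun i => (hG i).1, ?_, ?_⟩
  · have hm : ∀ i, LocallyMonotone (G i) := fun i => (hG i).2.1.monotone
    refine locallyContinuous_of_monotone (fun Y Z s t h =>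
      hF.2.1.monotone _ _ _ _ fun i => hm i _ _ _ _ h) ?_
    intro Y Z D hne hD a b h
    -- Continuity of each `G i` presents the tuple of images as the union of a family still indexed
    -- by `D`, so that continuity of `F` yields one `s ∈ D` valid for all coordinates.
    have h1 : (fun i => (G i).map (tupleSup D)) = tupleSup ((fun s i => (G i).map s) '' D) := by
      funext i
      refine hom_ext fun a b => ?_
      rw [R_tupleSup, Set.exists_mem_image]
      constructor
      · exact (hG i).2.1.exists_of_map_tupleSup hne hD
      · rintro ⟨s, hs, h1⟩
        exact hm i _ _ s _ (fun j p hp => (R_tupleSup D j p.1 p.2).mpr ⟨s, hs, hp⟩) h1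
    have h2 : R (F.map (tupleSup ((fun s i => (G i).map s) '' D))) a b := by
      rw [← h1]
      exact h
    obtain ⟨_, ⟨s, hs, rfl⟩, h3⟩ := hF.2.1.exists_of_map_tupleSup (hne.image _) (by
      rintro _ ⟨s, hs, rfl⟩ _ ⟨t, ht, rfl⟩
      obtain ⟨r, hr, h1, h2⟩ := hD s hs t ht
      exact ⟨_, ⟨r, hr, rfl⟩, fun i => hm i _ _ _ _ h1, fun i => hm i _ _ _ _ h2⟩) h2
    exact ⟨s, hs, h3⟩
  · intro Y Z h
    refine ⟨(hF.2.2 _ _ fun i => ((hG i).2.2 Y Z h).1).1, ?_⟩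
    refine Eq.trans ?_ (hF.2.2 _ _ fun i => ((hG i).2.2 Y Z h).1).2
    exact congrArg F.map (funext fun i => ((hG i).2.2 Y Z h).2)

end

section

open SeelyStruct

variable {E E' F F' G G' H : REL.{u}}

/-! ### Tensor product, binary product and exponential as variable sets -/

theorem tensor_val (x : El (E ⊗ F)) : x.1 = ZFSet.pair (tfst x).1 (tsnd x).1 := by
  conv_lhs => rw [← tmk_tfst_tsnd x]
  rfl

theorem contr_eq : contr E = co fun x => bang (unbang (tfst x) + unbang (tsnd x)) := by
  rw [contr, ← co_id, pairing_co, exclMap_co, seely2_inv, co_comp_co]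
  refine congrArg co (funext fun x => ?_)
  simp

theorem exch_eq : exch E F G H = co fun x =>
    tmk (tmk (tfst (tfst x)) (tfst (tsnd x))) (tmk (tsnd (tfst x)) (tsnd (tsnd x))) := by
  simp only [exch, associator_hom, associator_inv, braid_hom, whiskerLeft_co, co_whiskerRight,
    co_comp_co, tfst_tmk, tsnd_tmk]

theorem tensor_strength : contr E ▷ (F ⊗ G) ≫ exch (excl E) (excl E) F G = co fun x =>
    tmk (bang (unbang (tfst (tfst x)) + unbang (tfst (tsnd x))))
      (tmk (tsnd (tfst x)) (tsnd (tsnd x))) := by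
  simp only [contr_eq, exch_eq, co_whiskerRight, co_comp_co, tfst_tmk, tsnd_tmk]

/-- Contraction is multiset addition read backwards, and a matching onto a sum splits into matchings
onto the two terms. -/
theorem tensor_strength_natural (f : E ⟶ E') (g : F ⟶ F') (h : G ⟶ G') :
    (exclMap f ⊗ₘ (g ⊗ₘ h)) ≫ contr E' ▷ (F' ⊗ G') ≫ exch (excl E') (excl E') F' G' =
      (contr E ▷ (F ⊗ G) ≫ exch (excl E) (excl E) F G) ≫ ((exclMap f ⊗ₘ g) ⊗ₘ (exclMap f ⊗ₘ h)) :=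
  hom_ext fun x y => by
    rw [tensor_strength, tensor_strength, R_comp_co, R_co_comp]
    simp only [R_tensorHom, R_exclMap, tfst_tmk, tsnd_tmk, unbang_bang, exists_tensor, exists_excl,
      eq_tmk, eq_bang, Multiset.rel_add_right]
    constructor
    · rintro ⟨⟨m, m', h1, h2, h3⟩, h4, h5⟩
      exact ⟨m, _, m', _, ⟨h3, rfl, rfl⟩, ⟨h1, h4⟩, h2, h5⟩
    · rintro ⟨m, _, m', _, ⟨h3, rfl, rfl⟩, ⟨h1, h4⟩, h2, h5⟩
      exact ⟨⟨m, m', h1, h2, h3⟩, h4, h5⟩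

theorem tensor_isStrong : (FunctorWithStrength.tensor REL.{u}).IsStrong where
  map_id _ := id_tensor_id
  map_comp _ _ := (tensorHom_comp _ _ _ _).symm
  strength_natural f g := tensor_strength_natural f (g 0) (g 1)
  strength_seely2 X₁ X₂ Y := by
    change (seely2 X₁ X₂).hom ▷ (Y 0 ⊗ Y 1) ≫ (contr _ ▷ (Y 0 ⊗ Y 1) ≫ exch _ _ (Y 0) (Y 1)) =
      (α_ (excl X₁) (excl X₂) (Y 0 ⊗ Y 1)).hom ≫
        excl X₁ ◁ (contr _ ▷ (Y 0 ⊗ Y 1) ≫ exch _ _ (Y 0) (Y 1)) ≫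
        (contr _ ▷ ((excl X₂ ⊗ Y 0) ⊗ (excl X₂ ⊗ Y 1)) ≫ exch _ _ (excl X₂ ⊗ Y 0) (excl X₂ ⊗ Y 1)) ≫
        (((α_ (excl X₁) (excl X₂) (Y 0)).inv ≫ (seely2 X₁ X₂).hom ▷ Y 0) ⊗ₘ
          ((α_ (excl X₁) (excl X₂) (Y 1)).inv ≫ (seely2 X₁ X₂).hom ▷ Y 1))
    simp only [tensor_strength, seely2_hom, associator_hom, associator_inv, whiskerLeft_co,
      co_whiskerRight, co_comp_co, co_tensor_co, tfst_tmk, tsnd_tmk]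
    refine congrArg co (funext fun x => ?_)
    obtain ⟨m₁, m₂, h⟩ := exists_merge (tfst (tfst x))
    obtain ⟨n₁, n₂, h'⟩ := exists_merge (tfst (tsnd x))
    rw [h, h', split_eq_of_eq (m := m₁ + n₁) (m' := m₂ + n₂) (by simp; abel)]
    simp [split_bang]
  strength_seely0 Y := by
    change seely0.hom ▷ (Y 0 ⊗ Y 1) ≫ (contr _ ▷ (Y 0 ⊗ Y 1) ≫ exch _ _ (Y 0) (Y 1)) =
      (λ_ (Y 0 ⊗ Y 1)).hom ≫ (((λ_ (Y 0)).inv ≫ seely0.hom ▷ Y 0) ⊗ₘ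
        ((λ_ (Y 1)).inv ≫ seely0.hom ▷ Y 1))
    simp only [tensor_strength, seely0_hom, leftUnitor_hom, leftUnitor_inv, co_whiskerRight,
      co_comp_co, co_tensor_co, tsnd_tmk]
  strength_dig X Y := by
    change dig X ▷ (Y 0 ⊗ Y 1) ≫ (contr _ ▷ (Y 0 ⊗ Y 1) ≫ exch _ _ (Y 0) (Y 1)) =
      (contr _ ▷ (Y 0 ⊗ Y 1) ≫ exch _ _ (Y 0) (Y 1)) ≫ ((dig X ▷ Y 0) ⊗ₘ (dig X ▷ Y 1))
    simp only [tensor_strength, dig_eq, co_whiskerRight,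
      co_comp_co, co_tensor_co, tfst_tmk, tsnd_tmk, unbang_bang, Multiset.map_add, Multiset.sum_add]

theorem tensor_mem : FunctorWithStrength.tensor REL.{u} ∈ VREL 2 := by
  refine ⟨tensor_isStrong, locallyContinuous_of_monotone ?_ ?_, ?_⟩
  · rintro Y Z s t h ⟨a, b⟩ h1
    have h2 := (R_tensorHom (s 0) (s 1) a b).mp h1
    exact (R_tensorHom (t 0) (t 1) a b).mpr ⟨h 0 h2.1, h 1 h2.2⟩
  · intro Y Z D hne hD a b h
    obtain ⟨h0, h1⟩ := (R_tensorHom (tupleSup D 0) (tupleSup D 1) a b).mp h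
    rw [R_tupleSup] at h0 h1
    obtain ⟨s, hs, h0⟩ := h0
    obtain ⟨t, ht, h1⟩ := h1
    obtain ⟨r, hr, h2, h3⟩ := hD s hs t ht
    exact ⟨r, hr, (R_tensorHom (r 0) (r 1) a b).mpr ⟨h2 0 h0, h3 1 h1⟩⟩
  · intro Y Z h
    refine ⟨fun x hx => ?_, hom_ext fun x y => ?_⟩
    · obtain ⟨a, ha, b, hb, rfl⟩ := ZFSet.mem_prod.mp hx
      exact ZFSet.mem_prod.mpr ⟨a, h 0 ha, b, h 1 hb, rfl⟩
    · refine (R_tensorHom (incl (Y 0) (Z 0)) (incl (Y 1) (Z 1)) x y).trans ?_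
      rw [R_incl, R_incl, R_incl]
      refine Iff.trans ?_ (Iff.of_eq (congrArg₂ _ (tensor_val x).symm (tensor_val y).symm))
      exact ZFSet.pair_inj.symm

/-! ### The binary product as a variable set -/

theorem wth_strength : pairing (excl E ◁ pr₁ F G) (excl E ◁ pr₂ F G) =
    co (wcase (fun x => tmk (tfst x) (inl (tsnd x))) fun x => tmk (tfst x) (inr (tsnd x))) := by
  rw [pr₁_eq, pr₂_eq, whiskerLeft_co, whiskerLeft_co, pairing_co]

theorem wthMap_id : wthMap (𝟙 E) (𝟙 F) = 𝟙 (wth E F) :=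
  wth_hom_ext (by rw [wthMap, pairing_pr₁, Category.comp_id, Category.id_comp])
    (by rw [wthMap, pairing_pr₂, Category.comp_id, Category.id_comp])

theorem wthMap_pr₁ (s : E ⟶ E') (t : F ⟶ F') : wthMap s t ≫ pr₁ E' F' = pr₁ E F ≫ s :=
  pairing_pr₁ _ _

theorem wthMap_pr₂ (s : E ⟶ E') (t : F ⟶ F') : wthMap s t ≫ pr₂ E' F' = pr₂ E F ≫ t :=
  pairing_pr₂ _ _

theorem wthMap_comp (s : E ⟶ F) (t : F ⟶ G) (s' : E' ⟶ F') (t' : F' ⟶ G') :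
    wthMap (s ≫ t) (s' ≫ t') = wthMap s s' ≫ wthMap t t' := by
  refine wth_hom_ext ?_ ?_
  · rw [Category.assoc, wthMap_pr₁, wthMap_pr₁, ← Category.assoc, ← Category.assoc, wthMap_pr₁]
  · rw [Category.assoc, wthMap_pr₂, wthMap_pr₂, ← Category.assoc, ← Category.assoc, wthMap_pr₂]

theorem wth_isStrong : (FunctorWithStrength.wth REL.{u}).IsStrong where
  map_id _ := wthMap_id
  map_comp _ _ := wthMap_comp _ _ _ _
  strength_natural {X X' Y Y'} f g := by
    change (exclMap f ⊗ₘ wthMap (g 0) (g 1)) ≫ pairing (excl X' ◁ pr₁ (Y' 0) (Y' 1)) (excl X' ◁ pr₂ (Y' 0) (Y' 1)) =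
      pairing (excl X ◁ pr₁ (Y 0) (Y 1)) (excl X ◁ pr₂ (Y 0) (Y 1)) ≫
        wthMap (exclMap f ⊗ₘ g 0) (exclMap f ⊗ₘ g 1)
    refine wth_hom_ext ?_ ?_
    · rw [Category.assoc, pairing_pr₁, Category.assoc, wthMap_pr₁, ← Category.assoc, pairing_pr₁,
        ← id_tensorHom, ← id_tensorHom, tensorHom_comp, tensorHom_comp, wthMap_pr₁,
        Category.comp_id, Category.id_comp]
    · rw [Category.assoc, pairing_pr₂, Category.assoc, wthMap_pr₂, ← Category.assoc, pairing_pr₂,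
        ← id_tensorHom, ← id_tensorHom, tensorHom_comp, tensorHom_comp, wthMap_pr₂,
        Category.comp_id, Category.id_comp]
  strength_seely2 X₁ X₂ Y := by
    change (seely2 X₁ X₂).hom ▷ (wth (Y 0) (Y 1)) ≫ pairing (_ ◁ pr₁ (Y 0) (Y 1)) (_ ◁ pr₂ (Y 0) (Y 1)) =
      (α_ (excl X₁) (excl X₂) (wth (Y 0) (Y 1))).hom ≫
        excl X₁ ◁ pairing (excl X₂ ◁ pr₁ (Y 0) (Y 1)) (excl X₂ ◁ pr₂ (Y 0) (Y 1)) ≫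
        pairing (excl X₁ ◁ pr₁ (excl X₂ ⊗ Y 0) (excl X₂ ⊗ Y 1))
          (excl X₁ ◁ pr₂ (excl X₂ ⊗ Y 0) (excl X₂ ⊗ Y 1)) ≫
        wthMap ((α_ (excl X₁) (excl X₂) (Y 0)).inv ≫ (seely2 X₁ X₂).hom ▷ Y 0)
          ((α_ (excl X₁) (excl X₂) (Y 1)).inv ≫ (seely2 X₁ X₂).hom ▷ Y 1)
    simp only [wth_strength, seely2_hom, associator_hom, associator_inv, whiskerLeft_co,
      co_whiskerRight, co_comp_co, wthMap_co, tfst_tmk, tsnd_tmk]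
    refine congrArg co (funext fun x => ?_)
    induction x using wth_cases <;> simp
  strength_seely0 Y := by
    change seely0.hom ▷ (wth (Y 0) (Y 1)) ≫ pairing (_ ◁ pr₁ (Y 0) (Y 1)) (_ ◁ pr₂ (Y 0) (Y 1)) =
      (λ_ (wth (Y 0) (Y 1))).hom ≫ wthMap ((λ_ (Y 0)).inv ≫ seely0.hom ▷ Y 0)
        ((λ_ (Y 1)).inv ≫ seely0.hom ▷ Y 1)
    simp only [wth_strength, seely0_hom, leftUnitor_hom, leftUnitor_inv, co_whiskerRight,
      co_comp_co, wthMap_co, tsnd_tmk]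
    refine congrArg co (funext fun x => ?_)
    induction x using wth_cases <;> simp
  strength_dig X Y := by
    change dig X ▷ (wth (Y 0) (Y 1)) ≫ pairing (_ ◁ pr₁ (Y 0) (Y 1)) (_ ◁ pr₂ (Y 0) (Y 1)) =
      pairing (_ ◁ pr₁ (Y 0) (Y 1)) (_ ◁ pr₂ (Y 0) (Y 1)) ≫ wthMap (dig X ▷ Y 0) (dig X ▷ Y 1)
    simp only [wth_strength, dig_eq, co_whiskerRight,
      co_comp_co, wthMap_co]
    refine congrArg co (funext fun x => ?_)
    induction x using wth_cases <;> simp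

theorem inl_val (a : E) : (inl a : El (wth E F)).1 = ZFSet.pair (numeral 1) a.1 := rfl

theorem inr_val (b : F) : (inr b : El (wth E F)).1 = ZFSet.pair (numeral 2) b.1 := rfl

theorem wthMap_incl : wthMap (incl E E') (incl F F') = incl (wth E F) (wth E' F') := by
  refine hom_ext fun x y => ?_
  rw [R_incl]
  -- Inclusions compare the encoded pairs; distinct tags rule out equalities across the two
  -- summands.
  have h12 : numeral.{u} 1 ≠ numeral 2 := fun h => by
    have := numeral_injective h
    omega
  induction y using wth_cases with
  | hl b =>
    rw [R_wthMap_inl, inl_val]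
    induction x using wth_cases with
    | hl a =>
      rw [inl_val]
      constructor
      · rintro ⟨c, hc, h2⟩
        rw [inl_injective hc, (R_incl _ _).mp h2]
      · exact fun h2 => ⟨a, rfl, (ZFSet.pair_inj.mp h2).2⟩
    | hr a =>
      rw [inr_val]
      constructor
      · rintro ⟨c, hc, -⟩
        exact absurd hc.symm (inl_ne_inr _ _)
      · exact fun h2 => absurd (ZFSet.pair_inj.mp h2).1.symm h12
  | hr b =>
    rw [R_wthMap_inr, inr_val]
    induction x using wth_cases with
    | hr a =>
      rw [inr_val]
      constructor
      · rintro ⟨c, hc, h2⟩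
        rw [inr_injective hc, (R_incl _ _).mp h2]
      · exact fun h2 => ⟨a, rfl, (ZFSet.pair_inj.mp h2).2⟩
    | hl a =>
      rw [inl_val]
      constructor
      · rintro ⟨c, hc, -⟩
        exact absurd hc (inl_ne_inr _ _)
      · exact fun h2 => absurd (ZFSet.pair_inj.mp h2).1 h12

theorem wth_mem : FunctorWithStrength.wth REL.{u} ∈ VREL 2 := by
  refine ⟨wth_isStrong, locallyContinuous_of_monotone ?_ ?_, ?_⟩
  · rintro Y Z s t h ⟨a, b⟩ h1
    change R (wthMap (s 0) (s 1)) a b at h1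
    change R (wthMap (t 0) (t 1)) a b
    induction b using wth_cases with
    | hl b =>
      obtain ⟨c, hc, h2⟩ := (R_wthMap_inl _ _ _ _).mp h1
      exact (R_wthMap_inl _ _ _ _).mpr ⟨c, hc, h 0 h2⟩
    | hr b =>
      obtain ⟨c, hc, h2⟩ := (R_wthMap_inr _ _ _ _).mp h1
      exact (R_wthMap_inr _ _ _ _).mpr ⟨c, hc, h 1 h2⟩
  · intro Y Z D hne hD a b h1
    change R (wthMap (tupleSup D 0) (tupleSup D 1)) a b at h1
    change ∃ s ∈ D, R (wthMap (s 0) (s 1)) a b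
    induction b using wth_cases with
    | hl b =>
      obtain ⟨c, hc, h2⟩ := (R_wthMap_inl _ _ _ _).mp h1
      obtain ⟨s, hs, h3⟩ := (R_tupleSup _ _ _ _).mp h2
      exact ⟨s, hs, (R_wthMap_inl _ _ _ _).mpr ⟨c, hc, h3⟩⟩
    | hr b =>
      obtain ⟨c, hc, h2⟩ := (R_wthMap_inr _ _ _ _).mp h1
      obtain ⟨s, hs, h3⟩ := (R_tupleSup _ _ _ _).mp h2
      exact ⟨s, hs, (R_wthMap_inr _ _ _ _).mpr ⟨c, hc, h3⟩⟩
  · intro Y Z h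
    constructor
    · intro x hx
      rcases ZFSet.mem_union.mp hx with hx | hx <;>
        obtain ⟨i, hi, a, ha, rfl⟩ := ZFSet.mem_prod.mp hx
      · exact ZFSet.mem_union.mpr (Or.inl (ZFSet.mem_prod.mpr ⟨i, hi, a, h 0 ha, rfl⟩))
      · exact ZFSet.mem_union.mpr (Or.inr (ZFSet.mem_prod.mpr ⟨i, hi, a, h 1 ha, rfl⟩))
    · exact wthMap_incl

/-! ### The exponential as a variable set -/

/-- Read backwards, this morphism unzips a multiset of pairs. -/
theorem lax2_eq : lax2 E F = co fun x =>
    tmk (bang ((unbang x).map tfst)) (bang ((unbang x).map tsnd)) := by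
  simp only [lax2, seely2_hom, seely2_inv, dig_eq, der_eq, exclMap_co, co_tensor_co, co_comp_co,
    unbang_bang, tfst_tmk, tsnd_tmk, Multiset.map_map, Function.comp_def, Multiset.map_singleton]
  refine congrArg co (funext fun x => split_eq_of_eq ?_)
  rw [unbang_bang]
  induction unbang x using Multiset.induction_on with
  | empty => rfl
  | cons a m ih =>
    simp only [Multiset.map_cons, Multiset.sum_cons, ih]
    simp only [← Multiset.singleton_add]
    abel

theorem excl_strength : dig E ▷ excl F ≫ lax2 (excl E) F = co fun x =>
    tmk (bang ((unbang x).map fun y => unbang (tfst y)).sum) (bang ((unbang x).map tsnd)) := by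
  simp only [lax2_eq, dig_eq, co_whiskerRight, co_comp_co, tfst_tmk, tsnd_tmk, unbang_bang,
    Multiset.map_map, Function.comp_def]

/-- The combinatorial core of the naturality of the strength of `!`. The list of pairs `L`
prescribes how to cut `m` into blocks and how to attach to each block an element of `n`, giving a
matching between multisets of pairs. -/
theorem multisetRel_lift {α α' β β' : Type*} (r : α → α' → Prop) (s : β → β' → Prop)
    (m : Multiset α) (n : Multiset β) (L : Multiset (Multiset α' × β')) :
    (Multiset.Rel r m (L.map Prod.fst).sum ∧ Multiset.Rel s n (L.map Prod.snd)) ↔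
      ∃ K : Multiset (Multiset α × β), (m = (K.map Prod.fst).sum ∧ n = K.map Prod.snd) ∧
        Multiset.Rel (fun p q => Multiset.Rel r p.1 q.1 ∧ s p.2 q.2) K L := by
  induction L using Multiset.induction_on generalizing m n with
  | empty =>
    simp only [Multiset.map_zero, Multiset.sum_zero, Multiset.rel_zero_right]
    constructor
    · rintro ⟨rfl, rfl⟩
      exact ⟨0, by simp⟩
    · rintro ⟨_, h, rfl⟩
      simpa using h
  | cons q L ih =>
    rw [Multiset.map_cons, Multiset.map_cons, Multiset.sum_cons, Multiset.rel_add_right,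
      Multiset.rel_cons_right]
    constructor
    · rintro ⟨⟨m₁, m₂, h1, h2, rfl⟩, b, n', h3, h4, rfl⟩
      obtain ⟨K, ⟨rfl, rfl⟩, h⟩ := (ih m₂ n').mp ⟨h2, h4⟩
      exact ⟨(m₁, b) ::ₘ K, by simp, Multiset.Rel.cons ⟨h1, h3⟩ h⟩
    · rintro ⟨K, ⟨rfl, rfl⟩, h⟩
      obtain ⟨p, K', h1, h2, rfl⟩ := Multiset.rel_cons_right.mp h
      obtain ⟨h3, h4⟩ := (ih _ _).mpr ⟨K', ⟨rfl, rfl⟩, h2⟩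
      exact ⟨⟨p.1, _, h1.1, h3, by simp⟩, p.2, _, h1.2, h4, by simp⟩

theorem excl_strength_natural (f : E ⟶ E') (g : F ⟶ F') :
    (exclMap f ⊗ₘ exclMap g) ≫ dig E' ▷ excl F' ≫ lax2 (excl E') F' =
      (dig E ▷ excl F ≫ lax2 (excl E) F) ≫ exclMap (exclMap f ⊗ₘ g) :=
  hom_ext fun x y => by
    rw [excl_strength, excl_strength, R_comp_co, R_co_comp]
    simp only [R_tensorHom, R_exclMap, tfst_tmk, tsnd_tmk, unbang_bang, exists_excl, eq_tmk, eq_bang]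
    have hR : R (exclMap f ⊗ₘ g) = fun p q =>
        Multiset.Rel (R f) (unbang (tfst p)) (unbang (tfst q)) ∧ R g (tsnd p) (tsnd q) :=
      funext fun p => funext fun q => propext (by rw [R_tensorHom, R_exclMap])
    have key := multisetRel_lift (R f) (R g) (unbang (tfst x)) (unbang (tsnd x))
      ((unbang y).map fun q => (unbang (tfst q), tsnd q))
    simp only [Multiset.map_map, Function.comp_def] at key
    rw [hR]
    refine key.trans ?_
    constructor
    · rintro ⟨K, h, h'⟩
      refine ⟨K.map fun p => tmk (bang p.1) p.2, ?_, ?_⟩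
      · simpa [Multiset.map_map] using h
      · rw [Multiset.rel_map_left]
        rw [Multiset.rel_map_right] at h'
        simpa using h'
    · rintro ⟨K, h, h'⟩
      refine ⟨K.map fun p => (unbang (tfst p), tsnd p), ?_, ?_⟩
      · simpa [Multiset.map_map] using h
      · rw [Multiset.rel_map]
        exact h'

theorem excl_isStrong : (FunctorWithStrength.excl REL.{u}).IsStrong where
  map_id _ := exclMap_id
  map_comp _ _ := exclMap_comp _ _
  strength_natural f g := excl_strength_natural f (g 0)
  strength_seely2 X₁ X₂ Y := by
    change (seely2 X₁ X₂).hom ▷ excl (Y 0) ≫ (dig (wth X₁ X₂) ▷ excl (Y 0) ≫ lax2 _ (Y 0)) =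
      (α_ (excl X₁) (excl X₂) (excl (Y 0))).hom ≫
        excl X₁ ◁ (dig X₂ ▷ excl (Y 0) ≫ lax2 _ (Y 0)) ≫
        (dig X₁ ▷ excl (excl X₂ ⊗ Y 0) ≫ lax2 _ (excl X₂ ⊗ Y 0)) ≫
        exclMap ((α_ (excl X₁) (excl X₂) (Y 0)).inv ≫ (seely2 X₁ X₂).hom ▷ Y 0)
    simp only [excl_strength, seely2_hom, associator_hom, associator_inv, whiskerLeft_co,
      co_whiskerRight, co_comp_co, exclMap_co, tfst_tmk, tsnd_tmk, unbang_bang, Multiset.map_map,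
      Function.comp_def]
    refine congrArg co (funext fun x => ?_)
    -- Splitting by tags commutes with sums: the split of the total is obtained by adding the splits
    -- of the entries.
    rw [split_eq_of_eq
      (m := ((unbang x).map fun y => unbang (tfst (split (tfst y)))).sum)
      (m' := ((unbang x).map fun y => unbang (tsnd (split (tfst y)))).sum)]
    rw [unbang_bang]
    induction unbang x using Multiset.induction_on with
    | empty => rfl
    | cons y m ih =>
      have h := congrArg unbang (merge_split (tfst y))
      rw [unbang_bang] at h
      simp only [Multiset.map_cons, Multiset.sum_cons, Multiset.map_add, ih]
      conv_lhs => rw [← h]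
      abel
  strength_seely0 Y := by
    change seely0.hom ▷ excl (Y 0) ≫ (dig top ▷ excl (Y 0) ≫ lax2 _ (Y 0)) =
      (λ_ (excl (Y 0))).hom ≫ exclMap ((λ_ (Y 0)).inv ≫ seely0.hom ▷ Y 0)
    simp only [excl_strength, seely0_hom, leftUnitor_hom, leftUnitor_inv, co_whiskerRight,
      co_comp_co, exclMap_co, tsnd_tmk]
  strength_dig X Y := by
    change dig X ▷ excl (Y 0) ≫ (dig (excl X) ▷ excl (Y 0) ≫ lax2 _ (Y 0)) =
      (dig X ▷ excl (Y 0) ≫ lax2 _ (Y 0)) ≫ exclMap (dig X ▷ Y 0)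
    rw [excl_strength, excl_strength]
    simp only [dig_eq, co_whiskerRight, co_comp_co, exclMap_co, tfst_tmk, tsnd_tmk, unbang_bang, Multiset.map_map, Function.comp_def]
    refine congrArg co (funext fun x => congrArg₂ tmk (congrArg bang ?_) rfl)
    induction unbang x using Multiset.induction_on with
    | empty => rfl
    | cons y m ih => simp [ih]

theorem mfin_val (m : Multiset E) : (bang m).1 = multisetCode (m.map Subtype.val) := rfl

theorem excl_mem : FunctorWithStrength.excl REL.{u} ∈ VREL 1 := by
  refine ⟨excl_isStrong, locallyContinuous_of_monotone ?_ ?_, ?_⟩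
  · rintro Y Z s t h ⟨a, b⟩ h1
    exact (R_exclMap (t 0) a b).mpr
      (((R_exclMap (s 0) a b).mp h1).mono fun _ _ _ _ h2 => h 0 h2)
  · intro Y Z D hne hD a b h
    have h1 := (R_exclMap (tupleSup D 0) a b).mp h
    suffices ∃ s ∈ D, Multiset.Rel (R (s 0)) (unbang a) (unbang b) by
      obtain ⟨s, hs, h2⟩ := this
      exact ⟨s, hs, (R_exclMap (s 0) a b).mpr h2⟩
    generalize unbang a = m at h1 ⊢
    generalize unbang b = m' at h1 ⊢
    -- A matching involves finitely many pairs, so directedness gives one member of `D` containing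
    -- them all; the empty matching uses that `D` is nonempty.
    induction h1 with
    | zero =>
      obtain ⟨s, hs⟩ := hne
      exact ⟨s, hs, Multiset.Rel.zero⟩
    | cons h1 _ ih =>
      obtain ⟨s, hs, h2⟩ := ih
      obtain ⟨t, ht, h3⟩ := (R_tupleSup _ _ _ _).mp h1
      obtain ⟨r, hr, h4, h5⟩ := hD s hs t ht
      exact ⟨r, hr, Multiset.Rel.cons (h5 0 h3) (h2.mono fun _ _ _ _ h6 => h4 0 h6)⟩
  · intro Y Z h
    constructor
    · intro x hx
      obtain ⟨m, rfl⟩ := ZFSet.mem_range.mp hx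
      -- The code of a multiset depends only on the underlying sets of its elements, so it does not
      -- change when the multiset is seen in the larger set.
      refine ZFSet.mem_range.mpr ⟨m.map fun a => ⟨a.1, h 0 a.2⟩, ?_⟩
      simp only [Multiset.map_map]
      rfl
    · refine hom_ext fun x y => (R_exclMap (incl (Y 0) (Z 0)) x y).trans ?_
      -- Injectivity of the coding turns equality of codes into equality of multisets of underlying
      -- elements, that is, into a matching by equality.
      have h1 : x.1 = y.1 ↔ (unbang x).map Subtype.val = (unbang y).map Subtype.val := by
        rw [← multisetCode_injective.eq_iff, ← mfin_val, ← mfin_val]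
        exact Iff.of_eq (congrArg₂ _ (congrArg Subtype.val (bang_unbang x).symm)
          (congrArg Subtype.val (bang_unbang y).symm))
      rw [R_incl, h1, ← Multiset.rel_eq, Multiset.rel_map]
      rfl

end

section

open SeelyStruct

variable {E E' F F' G G' H P P' Q A A' B B' : REL.{u}}

/-! ### De Morgan duals -/

/-- Exchange of the output of a relation with the second component of its input. -/
noncomputable def twist (s : P ⊗ B ⟶ A) : P ⊗ A ⟶ B := ofSet {p | R s (tmk (tfst p.1) p.2) (tsnd p.1)}

theorem R_twist (s : P ⊗ B ⟶ A) (x : El (P ⊗ A)) (b : B) :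
    R (twist s) x b ↔ R s (tmk (tfst x) b) (tsnd x) := Iff.rfl

theorem twist_whiskerRight_comp (f : P ⟶ P') (s : P' ⊗ B ⟶ A) :
    twist (f ▷ B ≫ s) = f ▷ A ≫ twist s :=
  hom_ext fun x b => by
    simp only [R_twist, R_comp, R_whiskerRight, exists_tensor, tfst_tmk, tsnd_tmk]
    constructor
    · rintro ⟨p, _, ⟨h, rfl⟩, h'⟩
      exact ⟨p, _, ⟨h, rfl⟩, h'⟩
    · rintro ⟨p, _, ⟨h, rfl⟩, h'⟩
      exact ⟨p, _, ⟨h, rfl⟩, h'⟩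

theorem twist_whiskerLeft_comp (g : B ⟶ B') (s : P ⊗ B' ⟶ A) :
    twist (P ◁ g ≫ s) = twist s ≫ tr g :=
  hom_ext fun x b => by
    simp only [R_twist, R_tr, R_comp, R_whiskerLeft, exists_tensor, tfst_tmk, tsnd_tmk]
    constructor
    · rintro ⟨_, b', ⟨rfl, h⟩, h'⟩
      exact ⟨b', h', h⟩
    · rintro ⟨b', h', h⟩
      exact ⟨_, b', ⟨rfl, h⟩, h'⟩

/-- `twist` exchanges the ports `A` and `B`, so a relation acting on one of them crosses `twist`
transposed and on the other side, while one acting on `P` is left alone. -/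
theorem twist_comp (s : P ⊗ B ⟶ A) (h : A ⟶ A') : twist (s ≫ h) = P ◁ tr h ≫ twist s :=
  hom_ext fun x b => by
    simp only [R_twist, R_tr, R_comp, R_whiskerLeft, exists_tensor, tfst_tmk, tsnd_tmk]
    constructor
    · rintro ⟨a, h1, h2⟩
      exact ⟨_, a, ⟨rfl, h2⟩, h1⟩
    · rintro ⟨_, a, ⟨rfl, h2⟩, h1⟩
      exact ⟨a, h1, h2⟩

theorem twist_leftUnitor : twist (λ_ A).hom = (λ_ A).hom :=
  hom_ext fun x b => by
    rw [R_twist, leftUnitor_hom, R_co, R_co, eq_tmk, eq_tmk]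
    simp only [tfst_tmk, tsnd_tmk, eq_comm]

/-- Twisting reverses the direction of travel: the composite of two twists is the twist of the
composite in the opposite order, hence the exchange of `P` and `Q`. -/
theorem associator_whiskerLeft_twist (s : Q ⊗ A' ⟶ A) (t : P ⊗ B ⟶ A') :
    (α_ P Q A).hom ≫ P ◁ twist s ≫ twist t =
      twist ((braid P Q).hom ▷ B ≫ (α_ Q P B).hom ≫ Q ◁ t ≫ s) :=
  hom_ext fun x b => by
    rw [associator_hom, associator_hom, braid_hom, co_whiskerRight, R_twist,
      R_co_comp_of_inverse (fun x => tmk (tfst (tfst x)) (tmk (tsnd (tfst x)) (tsnd x)))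
        (by simp) (by simp),
      R_co_comp_of_inverse (fun x => tmk (tmk (tsnd (tfst x)) (tfst (tfst x))) (tsnd x))
        (by simp) (by simp),
      R_co_comp_of_inverse (fun x => tmk (tfst (tfst x)) (tmk (tsnd (tfst x)) (tsnd x)))
        (by simp) (by simp)]
    simp only [R_comp, R_whiskerLeft, R_twist, exists_tensor, tfst_tmk, tsnd_tmk]
    constructor
    · rintro ⟨_, a, ⟨rfl, h1⟩, h2⟩
      exact ⟨_, a, ⟨rfl, h2⟩, h1⟩
    · rintro ⟨_, a, ⟨rfl, h1⟩, h2⟩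
      exact ⟨_, a, ⟨rfl, h2⟩, h1⟩

/-- The contraction `P ⊗ (P ⊗ A) ⟶ A` of `P` with itself. -/
noncomputable def cap (P A : REL.{u}) : P ⊗ (P ⊗ A) ⟶ A :=
  ofSet {p | tfst p.1 = tfst (tsnd p.1) ∧ tsnd (tsnd p.1) = p.2}

theorem R_cap (x : El (P ⊗ (P ⊗ A))) (a : A) :
    R (cap P A) x a ↔ tfst x = tfst (tsnd x) ∧ tsnd (tsnd x) = a := Iff.rfl

theorem orthApply_eq_cap : orthApply P A = cap P A :=
  hom_ext fun x a => by
    unfold orthApply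
    rw [R_orthCurry, associator_hom, braid_hom, co_whiskerRight, ← Category.assoc, co_comp_co,
      R_co_comp_of_inverse (fun x => tmk (tsnd (tfst x)) (tmk (tfst (tfst x)) (tsnd x)))
        (by simp) (by simp), R_orthEv, tfst_tmk, tsnd_tmk, tfst_tmk, tsnd_tmk]
    refine (eq_tmk (E := P) (F := A)).trans ?_
    rw [eq_comm]
    rfl

/-- Dinaturality: a relation on one copy of the contracted object slides to the other copy as its
transpose. -/
theorem whiskerRight_cap (f : P ⟶ P') : f ▷ (P' ⊗ A) ≫ cap P' A = P ◁ (tr f ▷ A) ≫ cap P A :=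
  hom_ext fun x a => by
    simp only [R_comp, R_whiskerLeft, R_whiskerRight, R_tr, R_cap, exists_tensor, tfst_tmk, tsnd_tmk]
    constructor
    · rintro ⟨p, _, _, ⟨h, h'⟩, rfl, rfl⟩
      obtain ⟨rfl, rfl⟩ := eq_tmk.mp h'
      exact ⟨_, _, _, ⟨rfl, h, rfl⟩, rfl, rfl⟩
    · rintro ⟨_, p, a, ⟨rfl, h, rfl⟩, rfl, rfl⟩
      exact ⟨_, _, _, ⟨h, (tmk_tfst_tsnd _).symm⟩, rfl, rfl⟩

theorem whiskerLeft_cap (g : A ⟶ A') : P ◁ (P ◁ g) ≫ cap P A' = cap P A ≫ g :=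
  hom_ext fun x a => by
    simp only [R_comp, R_whiskerLeft, R_cap, exists_tensor, tfst_tmk, tsnd_tmk]
    constructor
    · rintro ⟨_, _, _, ⟨rfl, rfl, h⟩, h', rfl⟩
      exact ⟨_, ⟨h', rfl⟩, h⟩
    · rintro ⟨_, ⟨h', rfl⟩, h⟩
      exact ⟨_, _, _, ⟨rfl, rfl, h⟩, h', rfl⟩

/-- Equality of pairs is equality of both components, so contraction proceeds first along `P`, then
along `Q`. The braiding nests the outer copies so that `P` meets its partner first. -/
theorem cap_tensor : cap (P ⊗ Q) A = (P ⊗ Q) ◁ (α_ P Q A).hom ≫ (braid P Q).hom ▷ (P ⊗ (Q ⊗ A)) ≫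
    (α_ Q P (P ⊗ (Q ⊗ A))).hom ≫ Q ◁ cap P (Q ⊗ A) ≫ cap Q A :=
  hom_ext fun x a => by
    rw [associator_hom, associator_hom, braid_hom, whiskerLeft_co, co_whiskerRight, ← Category.assoc,
      ← Category.assoc, co_comp_co, co_comp_co, R_co_comp_of_inverse (fun x =>
        tmk (tsnd (tfst x)) (tmk (tfst (tfst x)) (tmk (tfst (tfst (tsnd x)))
          (tmk (tsnd (tfst (tsnd x))) (tsnd (tsnd x)))))) (by simp) (by simp)]
    simp only [R_comp, R_whiskerLeft, R_cap, exists_tensor, tfst_tmk, tsnd_tmk]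
    constructor
    · rintro ⟨h, rfl⟩
      rw [h]
      exact ⟨_, _, _, ⟨rfl, rfl, rfl⟩, rfl, rfl⟩
    · rintro ⟨_, _, _, ⟨rfl, h, h'⟩, h'', rfl⟩
      obtain ⟨h1, h2⟩ := eq_tmk.mp h'
      rw [tfst_tmk] at h1
      rw [tsnd_tmk] at h2
      exact ⟨tensor_ext h (h''.trans h1.symm), h2⟩

theorem tr_tensorHom (s : E ⟶ E') (t : F ⟶ F') : tr (s ⊗ₘ t) = tr s ⊗ₘ tr t :=
  hom_ext fun x y => by simp only [R_tr, R_tensorHom]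

theorem tr_whiskerRight (s : E ⟶ E') : tr (s ▷ F) = tr s ▷ F := by
  rw [whiskerRight_eq, tr_tensorHom, tr_id, whiskerRight_eq]

/-! ### The dual of a strong functor -/

section

variable {n : ℕ} {V : FunctorWithStrength REL.{u} n}

theorem strength_natural_left (hV : V.IsStrong) {X X' : REL.{u}} (f : X ⟶ X') (Y : Fin n → REL.{u}) :
    exclMap f ▷ V.obj Y ≫ V.strength X' Y = V.strength X Y ≫ V.map fun i => exclMap f ▷ Y i := by
  have h := hV.strength_natural f fun i => 𝟙 (Y i)
  simpa only [hV.map_id, tensorHom_id] using h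

theorem strength_natural_right (hV : V.IsStrong) (X : REL.{u}) {Y Y' : Fin n → REL.{u}}
    (g : ∀ i, Y i ⟶ Y' i) :
    excl X ◁ V.map g ≫ V.strength X Y' = V.strength X Y ≫ V.map fun i => excl X ◁ g i := by
  have h := hV.strength_natural (𝟙 X) g
  simpa only [exclMap_id, id_tensorHom] using h

/-- The De Morgan dual of a strong functor, with the object `Xᗮ` written `X`. -/
noncomputable def dual (V : FunctorWithStrength REL.{u} n) : FunctorWithStrength REL.{u} n where
  obj := V.obj
  map s := tr (V.map fun i => tr (s i))
  strength X Y := twist (V.strength X (fun i => excl X ⊗ Y i) ≫ V.map fun i => cap (excl X) (Y i))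

/-- Both pairings being diagonals, the long transpose only reroutes elements; its net effect is to
exchange `B` with the output `A`. -/
theorem orthCurry_eq_twist (s : P ⊗ B ⟶ A) :
    orthCurry ((α_ P (orth A) B).hom ≫ P ◁ (braid (orth A) B).hom ≫ (α_ P B (orth A)).inv ≫
      s ▷ orth A ≫ (braid A (orth A)).hom ≫ orthEv A) = twist s :=
  hom_ext fun x b => by
    rw [R_orthCurry, associator_hom, associator_inv, braid_hom, braid_hom, whiskerLeft_co,
      ← Category.assoc, ← Category.assoc, co_comp_co, co_comp_co,
      R_co_comp_of_inverse (fun x => tmk (tmk (tfst (tfst x)) (tsnd x)) (tsnd (tfst x)))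
        (by simp) (by simp)]
    simp only [tfst_tmk, tsnd_tmk, R_twist, R_comp, R_whiskerRight, R_co, R_orthEv, exists_tensor]
    constructor
    · rintro ⟨a, _, ⟨h1, rfl⟩, a', a'', h2, rfl⟩
      obtain ⟨h3, h4⟩ := eq_tmk.mp h2
      rw [tfst_tmk] at h3
      rw [tsnd_tmk] at h4
      have h5 : a = tsnd x := h3.trans h4.symm
      rwa [← h5]
    · intro h
      exact ⟨tsnd x, _, ⟨h, rfl⟩, tsnd x, tsnd x, rfl, rfl⟩

theorem dual_eq (V : FunctorWithStrength REL.{u} n) : V.dual = dual V := by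
  have h1 : ∀ (Y Z : Fin n → REL.{u}) (f : ∀ i, Y i ⟶ Z i),
      orthMap (V.map fun i => orthMap (f i)) = tr (V.map fun i => tr (f i)) := by
    intro Y Z f
    simp only [orthMap_eq_tr]
  have h2 : ∀ X Y, V.dual.strength X Y = (dual V).strength X Y := by
    intro X Y
    refine (orthCurry_eq_twist _).trans ?_
    simp only [orthApply_eq_cap]
    rfl
  have h3 : V.dual = ⟨V.obj, fun f => orthMap (V.map fun i => orthMap (f i)), V.dual.strength⟩ := rfl
  rw [h3]
  have h4 : V.dual.strength = (dual V).strength := funext fun X => funext fun Y => h2 X Y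
  simp only [h1, h4]
  rfl

/-- For the strength laws, all factors are pulled inside a single `twist`, where the corresponding
law of `V` and the naturality of its strength apply. What remains is an identity about `cap` in each
coordinate. -/
theorem dual_isStrong (hV : V.IsStrong) : (dual V).IsStrong where
  map_id Y := by
    change tr (V.map fun i => tr (𝟙 (Y i))) = 𝟙 (V.obj Y)
    simp only [tr_id, hV.map_id]
  map_comp f g := by
    change tr (V.map fun i => tr (f i ≫ g i)) = tr (V.map _) ≫ tr (V.map _)
    simp only [tr_comp, hV.map_comp]
  strength_natural {X X' Y Y'} f g := by
    change (exclMap f ⊗ₘ tr (V.map fun i => tr (g i))) ≫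
      twist (V.strength X' (fun i => excl X' ⊗ Y' i) ≫ V.map fun i => cap (excl X') (Y' i)) =
      twist (V.strength X (fun i => excl X ⊗ Y i) ≫ V.map fun i => cap (excl X) (Y i)) ≫
        tr (V.map fun i => tr (exclMap f ⊗ₘ g i))
    rw [MonoidalCategory.tensorHom_def, Category.assoc, ← twist_comp, ← twist_whiskerRight_comp,
      ← twist_whiskerLeft_comp, Category.assoc,
      reassoc_of% strength_natural_left hV f fun i => excl X' ⊗ Y' i,
      reassoc_of% strength_natural_right hV X fun i => tr (exclMap f ⊗ₘ g i)]
    simp only [← hV.map_comp, tr_tensorHom]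
    refine congrArg (fun s => twist (V.strength X _ ≫ V.map s)) (funext fun i => ?_)
    rw [reassoc_of% whiskerRight_cap (A := Y' i) (exclMap f), MonoidalCategory.tensorHom_def,
      MonoidalCategory.whiskerLeft_comp, Category.assoc, whiskerLeft_cap]
  strength_seely2 X₁ X₂ Y := by
    change (seely2 X₁ X₂).hom ▷ V.obj Y ≫ twist (V.strength (wth X₁ X₂) _ ≫ V.map fun i => cap _ (Y i)) =
      (α_ (excl X₁) (excl X₂) (V.obj Y)).hom ≫
        excl X₁ ◁ twist (V.strength X₂ _ ≫ V.map fun i => cap _ (Y i)) ≫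
        twist (V.strength X₁ _ ≫ V.map fun i => cap _ (excl X₂ ⊗ Y i)) ≫
          tr (V.map fun i => tr ((α_ (excl X₁) (excl X₂) (Y i)).inv ≫ (seely2 X₁ X₂).hom ▷ Y i))
    rw [← twist_whiskerRight_comp, ← Category.assoc (excl X₁ ◁ _), ← Category.assoc (α_ _ _ _).hom,
      associator_whiskerLeft_twist, ← twist_whiskerLeft_comp]
    congr 1
    -- Twisting has reversed the order of the two strengths, so the law of `V` is used at `(X₂,
    -- X₁)`; the symmetry of the Seely isomorphism restores the order.
    have h1 : (braid (excl X₁) (excl X₂)).hom ≫ (seely2 X₂ X₁).hom =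
        (seely2 X₁ X₂).hom ≫ exclMap (pairing (pr₂ X₁ X₂) (pr₁ X₁ X₂)) :=
      (isSeely.seely_symm X₁ X₂).symm
    have h2 := hV.strength_seely2 X₂ X₁ fun i => excl X₁ ⊗ (excl X₂ ⊗ Y i)
    have h3 : (α_ (excl X₂) (excl X₁) _).hom ≫ excl X₂ ◁ V.strength X₁ _ ≫ V.strength X₂ _ =
        (seely2 X₂ X₁).hom ▷ V.obj _ ≫ V.strength (wth X₂ X₁) _ ≫ V.map fun i =>
          (seely2 X₂ X₁).inv ▷ (excl X₁ ⊗ (excl X₂ ⊗ Y i)) ≫ (α_ _ _ _).hom := by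
      rw [reassoc_of% h2]
      simp only [Category.assoc, ← hV.map_comp, hom_inv_whiskerRight_assoc, Iso.inv_hom_id, hV.map_id,
        Category.comp_id]
    rw [MonoidalCategory.whiskerLeft_comp, Category.assoc,
      reassoc_of% strength_natural_right hV X₂ fun i => cap (excl X₁) (excl X₂ ⊗ Y i),
      reassoc_of% h3, ← comp_whiskerRight_assoc, h1, comp_whiskerRight_assoc,
      reassoc_of% strength_natural_left hV (pairing (pr₂ X₁ X₂) (pr₁ X₁ X₂)),
      whisker_exchange_assoc, reassoc_of% strength_natural_right hV (wth X₁ X₂)]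
    simp only [Category.assoc, ← hV.map_comp]
    refine congrArg (fun s => _ ≫ V.strength _ _ ≫ V.map s) (funext fun i => ?_)
    have h4 : exclMap (pairing (pr₂ X₁ X₂) (pr₁ X₁ X₂)) ≫ (seely2 X₂ X₁).inv =
        (seely2 X₁ X₂).inv ≫ (braid (excl X₁) (excl X₂)).hom := by
      rw [Iso.comp_inv_eq, Category.assoc, h1, Iso.inv_hom_id_assoc]
    -- Structural isomorphisms are graphs of bijections: transposing them is inverting them.
    have h5 : tr ((α_ (excl X₁) (excl X₂) (Y i)).inv ≫ (seely2 X₁ X₂).hom ▷ Y i) =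
        (seely2 X₁ X₂).inv ▷ Y i ≫ (α_ (excl X₁) (excl X₂) (Y i)).hom := by
      rw [tr_comp, tr_whiskerRight]
      rfl
    rw [← comp_whiskerRight_assoc, h4, comp_whiskerRight_assoc, h5, MonoidalCategory.whiskerLeft_comp,
      Category.assoc, whisker_exchange_assoc, ← cap_tensor, whiskerRight_cap,
      ← MonoidalCategory.whiskerLeft_comp_assoc, ← comp_whiskerRight,
      show tr (seely2 X₁ X₂).inv = (seely2 X₁ X₂).hom from rfl, Iso.inv_hom_id, id_whiskerRight,
      MonoidalCategory.whiskerLeft_id, Category.id_comp]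
  strength_seely0 Y := by
    change seely0.hom ▷ V.obj Y ≫ twist (V.strength top _ ≫ V.map fun i => cap _ (Y i)) =
      (λ_ (V.obj Y)).hom ≫ tr (V.map fun i => tr ((λ_ (Y i)).inv ≫ seely0.hom ▷ Y i))
    -- The left unitor is its own twist, which allows it to enter the `twist` on the right-hand
    -- side.
    conv_rhs => rw [← twist_leftUnitor]
    rw [← twist_whiskerRight_comp, ← twist_whiskerLeft_comp, leftUnitor_naturality,
      ← Category.assoc, hV.strength_seely0, Category.assoc, ← hV.map_comp]
    refine congrArg (fun s => twist ((λ_ _).hom ≫ V.map s)) (funext fun i => ?_)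
    have h0 : (λ_ (Y i)).inv ≫ seely0.hom ▷ Y i = co fun x => tsnd x := by
      simp only [seely0_hom, leftUnitor_inv, co_whiskerRight, co_comp_co, tsnd_tmk]
    have h1 : (λ_ (excl top ⊗ Y i)).inv ≫ seely0.hom ▷ (excl top ⊗ Y i) = co fun x => tsnd x := by
      simp only [seely0_hom, leftUnitor_inv, co_whiskerRight, co_comp_co, tsnd_tmk]
    rw [h0, h1]
    refine hom_ext fun x y => ?_
    rw [R_tr, R_co, R_co_comp]
    constructor
    · rintro ⟨z, rfl, -, h⟩
      exact Eq.symm h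
    · rintro rfl
      -- The contraction requires equal first components, which dictates the added one.
      exact ⟨tmk (tfst x) x, by simp, by simp [R_cap]⟩
  strength_dig X Y := by
    change dig X ▷ V.obj Y ≫ twist (V.strength (excl X) _ ≫ V.map fun i => cap _ (Y i)) =
      twist (V.strength X _ ≫ V.map fun i => cap _ (Y i)) ≫ tr (V.map fun i => tr (dig X ▷ Y i))
    rw [← twist_whiskerRight_comp, ← twist_whiskerLeft_comp, ← Category.assoc, hV.strength_dig,
      ← Category.assoc, strength_natural_right hV, Category.assoc, Category.assoc, ← hV.map_comp,
      ← hV.map_comp]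
    refine congrArg (fun s => twist (V.strength X _ ≫ V.map s)) (funext fun i => ?_)
    rw [whiskerRight_cap, tr_whiskerRight]

/-- For an inclusion `i`, `i ≫ tr i = 𝟙` and `tr i ≫ i ⊆ 𝟙`. Functoriality and monotonicity carry
both facts to `V.map`. As `V.map` of `i` is again an inclusion, its right adjoint is forced to be
its transpose. -/
theorem map_tr_incl (hV : V ∈ VREL n) {Y Z : Fin n → REL.{u}} (h : ∀ i, (Y i).set ⊆ (Z i).set) :
    tr (V.map fun i => tr (incl (Y i) (Z i))) = incl (V.obj Y) (V.obj Z) := by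
  obtain ⟨h1, h2⟩ := hV.2.2 Y Z h
  have h3 : V.map (fun i => incl (Y i) (Z i)) ≫ V.map (fun i => tr (incl (Y i) (Z i))) = 𝟙 _ := by
    rw [← hV.1.map_comp, ← hV.1.map_id]
    refine congrArg V.map (funext fun i => hom_ext fun a b => ?_)
    simp only [R_comp, R_tr, R_incl, R_id]
    exact ⟨fun ⟨c, hc, hc'⟩ => Subtype.ext (hc.trans hc'.symm),
      fun hab => ⟨⟨a.1, h i a.2⟩, rfl, by rw [hab]⟩⟩
  have h4 : rel (V.map (fun i => tr (incl (Y i) (Z i))) ≫ V.map (fun i => incl (Y i) (Z i))) ⊆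
      rel (𝟙 (V.obj Z)) := by
    rw [← hV.1.map_comp, ← hV.1.map_id]
    refine hV.2.1.monotone _ _ _ _ fun i => ?_
    rintro ⟨a, b⟩ ⟨c, hc, hc'⟩
    exact Subtype.ext (Eq.trans (Eq.symm hc) hc')
  rw [h2] at h3 h4
  refine hom_ext fun y z => ?_
  rw [R_incl, R_tr]
  constructor
  · intro h5
    have h6 : z = ⟨y.1, h1 y.2⟩ := h4 (a := (z, ⟨y.1, h1 y.2⟩)) ⟨y, h5, rfl⟩
    rw [h6]
  · intro h5
    obtain ⟨z', h6, h7⟩ : R (incl (V.obj Y) (V.obj Z) ≫ V.map fun i => tr (incl (Y i) (Z i))) y y := by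
      rw [h3]
      rfl
    have h8 : z = z' := Subtype.ext (h5.symm.trans h6)
    rwa [h8]

theorem dual_mem (hV : V ∈ VREL n) : V.dual ∈ VREL n := by
  rw [dual_eq]
  refine ⟨dual_isStrong hV.1, locallyContinuous_of_monotone ?_ ?_, ?_⟩
  · rintro Y Z s t h ⟨a, b⟩ h1
    exact hV.2.1.monotone Z Y (fun i => tr (s i)) (fun i => tr (t i)) (fun i p hp => h i hp) h1
  · intro Y Z D hne hD a b h
    -- Transposition is an order isomorphism, so it preserves directed families and their unions.
    have h1 : (fun i => tr (tupleSup D i)) = tupleSup ((fun s i => tr (s i)) '' D) := by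
      funext i
      refine hom_ext fun a b => ?_
      rw [R_tr, R_tupleSup, R_tupleSup, Set.exists_mem_image]
      rfl
    have h2 : R (V.map (tupleSup ((fun s i => tr (s i)) '' D))) b a := by
      rw [← h1]
      exact h
    obtain ⟨_, ⟨s, hs, rfl⟩, h3⟩ := hV.2.1.exists_of_map_tupleSup (hne.image _) (by
      rintro _ ⟨s, hs, rfl⟩ _ ⟨t, ht, rfl⟩
      obtain ⟨r, hr, h1, h2⟩ := hD s hs t ht
      exact ⟨_, ⟨r, hr, rfl⟩, fun i p hp => h1 i hp, fun i p hp => h2 i hp⟩) h2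
    exact ⟨s, hs, h3⟩
  · intro Y Z h
    exact ⟨(hV.2.2 Y Z h).1, map_tr_incl hV h⟩

end

end

section

open SeelyStruct FunctorWithStrength

/-! ### Fixed points of variable sets -/

section

variable {k : ℕ}

/-- `Fin.cons` reduces only at zero and at successors, so identities between tuples are checked
index by index. -/
theorem consHom_id {A : REL.{u}} {Y : Fin k → REL.{u}} :
    (consHom (𝟙 A) fun i => 𝟙 (Y i)) = fun i => 𝟙 ((Fin.cons A Y : Fin (k + 1) → REL.{u}) i) :=
  funext fun i => by refine Fin.cases ?_ (fun j => ?_) i <;> rfl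

theorem consHom_comp {A B D : REL.{u}} {Y Z W : Fin k → REL.{u}} (e : A ⟶ B) (e' : B ⟶ D)
    (g : ∀ i, Y i ⟶ Z i) (g' : ∀ i, Z i ⟶ W i) :
    (consHom (e ≫ e') fun i => g i ≫ g' i) = fun i => consHom e g i ≫ consHom e' g' i :=
  funext fun i => by refine Fin.cases ?_ (fun j => ?_) i <;> rfl

theorem consHom_incl (A B : REL.{u}) (Y Z : Fin k → REL.{u}) :
    (consHom (incl A B) fun i => incl (Y i) (Z i)) =
      fun i => incl ((Fin.cons A Y : Fin (k + 1) → REL.{u}) i) ((Fin.cons B Z : Fin (k + 1) → REL.{u}) i) :=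
  funext fun i => by refine Fin.cases ?_ (fun j => ?_) i <;> rfl

theorem tr_consHom {A B : REL.{u}} {Y Z : Fin k → REL.{u}} (e : A ⟶ B) (g : ∀ i, Y i ⟶ Z i) :
    (fun i => tr (consHom e g i)) = consHom (tr e) fun i => tr (g i) :=
  funext fun i => by refine Fin.cases ?_ (fun j => ?_) i <;> rfl

theorem consHom_mono {A B : REL.{u}} {Y Z : Fin k → REL.{u}} {e e' : A ⟶ B} {g g' : ∀ i, Y i ⟶ Z i}
    (he : rel e ⊆ rel e') (hg : ∀ i, rel (g i) ⊆ rel (g' i)) (i : Fin (k + 1)) :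
    rel (consHom e g i) ⊆ rel (consHom e' g' i) := by
  refine Fin.cases ?_ (fun j => ?_) i
  exacts [he, hg j]

theorem incl_self (A : REL.{u}) : incl A A = 𝟙 A := (eqToHom_eq_incl rfl).symm

theorem comp_mono {A B D : REL.{u}} {s s' : A ⟶ B} {t t' : B ⟶ D} (h : rel s ⊆ rel s')
    (h' : rel t ⊆ rel t') : rel (s ≫ t) ⊆ rel (s' ≫ t') := by
  rintro ⟨a, c⟩ ⟨b, h1, h2⟩
  exact ⟨b, h h1, h' h2⟩

/-- The restriction of the identity of `B` to `A`. -/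
def restr (A B : REL.{u}) : B ⟶ B := tr (incl A B) ≫ incl A B

theorem R_restr (A B : REL.{u}) (a b : B) : R (restr A B) a b ↔ a = b ∧ a.1 ∈ A.set := by
  constructor
  · rintro ⟨c, h1, h2⟩
    have h3 : c.1 = a.1 := h1
    have h4 : c.1 = b.1 := h2
    exact ⟨Subtype.ext (h3.symm.trans h4), h3 ▸ c.2⟩
  · rintro ⟨rfl, h⟩
    exact ⟨⟨a.1, h⟩, rfl, rfl⟩

variable {V : FunctorWithStrength REL.{u} (k + 1)}

theorem map_consHom_comp (hV : V.IsStrong) {A B D : REL.{u}} {Y Z W : Fin k → REL.{u}} (e : A ⟶ B)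
    (e' : B ⟶ D) (g : ∀ i, Y i ⟶ Z i) (g' : ∀ i, Z i ⟶ W i) :
    V.map (consHom e g) ≫ V.map (consHom e' g') = V.map (consHom (e ≫ e') fun i => g i ≫ g' i) := by
  rw [consHom_comp, hV.map_comp]

theorem map_consHom_id (hV : V.IsStrong) (A : REL.{u}) (Y : Fin k → REL.{u}) :
    V.map (consHom (𝟙 A) fun i => 𝟙 (Y i)) = 𝟙 (V.obj (Fin.cons A Y)) := by
  rw [consHom_id, hV.map_id]

theorem cons_set_subset {A B : REL.{u}} {Y Z : Fin k → REL.{u}} (h : A.set ⊆ B.set)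
    (h' : ∀ i, (Y i).set ⊆ (Z i).set) (i : Fin (k + 1)) :
    ((Fin.cons A Y : Fin (k + 1) → REL.{u}) i).set ⊆ ((Fin.cons B Z : Fin (k + 1) → REL.{u}) i).set := by
  refine Fin.cases ?_ (fun j => ?_) i
  exacts [h, h' j]

theorem obj_cons_subset (hV : V ∈ VREL (k + 1)) {A B : REL.{u}} {Y Z : Fin k → REL.{u}}
    (h : A.set ⊆ B.set) (h' : ∀ i, (Y i).set ⊆ (Z i).set) :
    (V.obj (Fin.cons A Y)).set ⊆ (V.obj (Fin.cons B Z)).set :=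
  (hV.2.2 _ _ (cons_set_subset h h')).1

theorem map_consHom_incl (hV : V ∈ VREL (k + 1)) {A B : REL.{u}} {Y Z : Fin k → REL.{u}}
    (h : A.set ⊆ B.set) (h' : ∀ i, (Y i).set ⊆ (Z i).set) :
    V.map (consHom (incl A B) fun i => incl (Y i) (Z i)) =
      incl (V.obj (Fin.cons A Y)) (V.obj (Fin.cons B Z)) := by
  rw [consHom_incl]
  exact (hV.2.2 _ _ (cons_set_subset h h')).2

/-- A restriction is a transposed inclusion followed by an inclusion, and `V.map` respects both, by
`map_tr_incl` and by strictness. -/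
theorem map_consHom_restr (hV : V ∈ VREL (k + 1)) {A B : REL.{u}} (Y : Fin k → REL.{u})
    (h : A.set ⊆ B.set) : V.map (consHom (restr A B) fun i => 𝟙 (Y i)) =
      restr (V.obj (Fin.cons A Y)) (V.obj (Fin.cons B Y)) := by
  -- The identities on the parameters are written as restrictions too, so that every coordinate has
  -- the same shape.
  have h1 : (consHom (restr A B) fun i => 𝟙 (Y i)) =
      consHom (tr (incl A B) ≫ incl A B) fun i => tr (incl (Y i) (Y i)) ≫ incl (Y i) (Y i) := by
    congr 1
    funext i
    rw [incl_self, tr_id, Category.id_comp]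
  rw [h1, ← map_consHom_comp hV.1, map_consHom_incl hV h fun _ => subset_rfl, ← tr_consHom, consHom_incl]
  have h2 := map_tr_incl hV (cons_set_subset (Y := Y) h fun _ => subset_rfl)
  rw [restr, ← h2, tr_tr]

/-- Local continuity when the recursive argument and the parameters vary together along an index set
directed for both at once; `e'` and `g'` need only be covered by the families. -/
theorem exists_of_map_consHom (hV : V ∈ VREL (k + 1)) {A B : REL.{u}} {Y Z : Fin k → REL.{u}}
    {ι : Type*} {D : Set ι} (hne : D.Nonempty) (e : ι → (A ⟶ B)) (g : ι → ∀ i, Y i ⟶ Z i)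
    (hD : ∀ s ∈ D, ∀ t ∈ D, ∃ r ∈ D, (rel (e s) ⊆ rel (e r) ∧ ∀ i, rel (g s i) ⊆ rel (g r i)) ∧
      (rel (e t) ⊆ rel (e r) ∧ ∀ i, rel (g t i) ⊆ rel (g r i))) (e' : A ⟶ B) (g' : ∀ i, Y i ⟶ Z i)
    (he : ∀ a b, R e' a b → ∃ s ∈ D, R (e s) a b) (hg : ∀ i a b, R (g' i) a b → ∃ s ∈ D, R (g s i) a b)
    {a : V.obj (Fin.cons A Y)} {b : V.obj (Fin.cons B Z)} (h : R (V.map (consHom e' g')) a b) :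
    ∃ s ∈ D, R (V.map (consHom (e s) (g s))) a b := by
  have h1 : R (V.map (tupleSup ((fun s => consHom (e s) (g s)) '' D))) a b := by
    refine hV.2.1.monotone _ _ _ _ (fun i => ?_) h
    rintro ⟨x, y⟩ hxy
    refine (R_tupleSup _ i x y).mpr ?_
    rw [Set.exists_mem_image]
    revert x y
    refine Fin.cases ?_ (fun j => ?_) i
    · exact fun x y hxy => he x y hxy
    · exact fun x y hxy => hg j x y hxy
  obtain ⟨_, ⟨s, hs, rfl⟩, h3⟩ := hV.2.1.exists_of_map_tupleSup (hne.image _) (by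
    rintro _ ⟨s, hs, rfl⟩ _ ⟨t, ht, rfl⟩
    obtain ⟨r, hr, h1, h2⟩ := hD s hs t ht
    exact ⟨_, ⟨r, hr, rfl⟩, consHom_mono h1.1 h1.2, consHom_mono h2.1 h2.2⟩) h1
  exact ⟨s, hs, h3⟩

theorem exists_of_map_consHom_chain (hV : V ∈ VREL (k + 1)) {A B : REL.{u}} {Y Z : Fin k → REL.{u}}
    (e : ℕ → (A ⟶ B)) (he : ∀ n, rel (e n) ⊆ rel (e (n + 1))) (g : ∀ i, Y i ⟶ Z i) (e' : A ⟶ B)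
    (h' : ∀ a b, R e' a b → ∃ n, R (e n) a b)
    {a : V.obj (Fin.cons A Y)} {b : V.obj (Fin.cons B Z)} (h : R (V.map (consHom e' g)) a b) :
    ∃ n, R (V.map (consHom (e n) g)) a b := by
  have hm : Monotone fun n => rel (e n) := monotone_nat_of_le_succ he
  obtain ⟨n, -, hn⟩ := exists_of_map_consHom hV (D := Set.univ) Set.univ_nonempty e (fun _ => g)
    (fun s _ t _ => ⟨max s t, trivial, ⟨hm (le_max_left s t), fun _ => subset_rfl⟩,
      hm (le_max_right s t), fun _ => subset_rfl⟩) e' g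
    (fun a b hab => (h' a b hab).imp fun n hn => ⟨trivial, hn⟩)
    (fun i a b hab => ⟨0, trivial, hab⟩) h
  exact ⟨n, hn⟩

/-! ### The union of the iterates and its corecursion principle -/

variable (V) in
/-- The union of the iterates of `V (-, Y)` at the empty set. -/
noncomputable def fixObj (Y : Fin k → REL.{u}) : REL.{u} := ⟨ZFSet.iUnion fun n => (iterate V Y n).set⟩

theorem mem_fixObj {Y : Fin k → REL.{u}} {a : ZFSet.{u}} :
    a ∈ (fixObj V Y).set ↔ ∃ n, a ∈ (iterate V Y n).set := ZFSet.mem_iUnion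

theorem iterate_subset_succ (hV : V ∈ VREL (k + 1)) (Y : Fin k → REL.{u}) (n : ℕ) :
    (iterate V Y n).set ⊆ (iterate V Y (n + 1)).set := by
  induction n with
  | zero => exact fun x hx => absurd hx (ZFSet.notMem_empty x)
  | succ n ih => exact obj_cons_subset hV ih fun _ => subset_rfl

theorem iterate_subset_fixObj (Y : Fin k → REL.{u}) (n : ℕ) :
    (iterate V Y n).set ⊆ (fixObj V Y).set := fun _ hx => mem_fixObj.mpr ⟨n, hx⟩

theorem restr_mono {A A' B : REL.{u}} (h : A.set ⊆ A'.set) : rel (restr A B) ⊆ rel (restr A' B) := by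
  rintro ⟨a, b⟩ h1
  obtain ⟨h2, h3⟩ := (R_restr A B a b).mp h1
  exact (R_restr A' B a b).mpr ⟨h2, h h3⟩

/-- An element of `V (fixObj V Y, Y)` is related to itself by `V.map` of the identity, the
increasing union of the restrictions to the iterates. By continuity one restriction, to the `n`-th
iterate, suffices; its image is the restriction to the next iterate, so the element lies there. -/
theorem obj_fixObj (hV : V ∈ VREL (k + 1)) (Y : Fin k → REL.{u}) :
    V.obj (Fin.cons (fixObj V Y) Y) = fixObj V Y := by
  refine REL.ext (ZFSet.ext fun x => ⟨fun hx => ?_, fun hx => ?_⟩)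
  · have h : R (V.map (consHom (𝟙 (fixObj V Y)) fun i => 𝟙 (Y i))) ⟨x, hx⟩ ⟨x, hx⟩ := by
      rw [map_consHom_id hV.1]
      rfl
    obtain ⟨n, hn⟩ := exists_of_map_consHom_chain hV (fun n => restr (iterate V Y n) (fixObj V Y))
      (fun n => restr_mono (iterate_subset_succ hV Y n)) _ _ (by
        intro a b hab
        obtain ⟨n, hn⟩ := mem_fixObj.mp a.2
        exact ⟨n, (R_restr _ _ _ _).mpr ⟨hab, hn⟩⟩) h
    rw [map_consHom_restr hV Y (iterate_subset_fixObj Y n), R_restr] at hn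
    exact mem_fixObj.mpr ⟨n + 1, hn.2⟩
  · obtain ⟨n, hn⟩ := mem_fixObj.mp hx
    exact obj_cons_subset hV (iterate_subset_fixObj Y n) (fun _ => subset_rfl)
      (iterate_subset_succ hV Y n hn)

variable (V) in
/-- The identity from `fixObj V Y` to `V (fixObj V Y, Y)`. -/
noncomputable def out (Y : Fin k → REL.{u}) : fixObj V Y ⟶ V.obj (Fin.cons (fixObj V Y) Y) := incl _ _

variable (V) in
/-- The identity from `V (fixObj V Y, Y)` to `fixObj V Y`. -/
noncomputable def fold (Y : Fin k → REL.{u}) : V.obj (Fin.cons (fixObj V Y) Y) ⟶ fixObj V Y := incl _ _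

theorem out_fold (hV : V ∈ VREL (k + 1)) (Y : Fin k → REL.{u}) : out V Y ≫ fold V Y = 𝟙 _ := by
  rw [out, fold, ← eqToHom_eq_incl (obj_fixObj hV Y), ← eqToHom_eq_incl (obj_fixObj hV Y).symm,
    eqToHom_trans, eqToHom_refl]

theorem fold_out (hV : V ∈ VREL (k + 1)) (Y : Fin k → REL.{u}) : fold V Y ≫ out V Y = 𝟙 _ := by
  rw [out, fold, ← eqToHom_eq_incl (obj_fixObj hV Y), ← eqToHom_eq_incl (obj_fixObj hV Y).symm,
    eqToHom_trans, eqToHom_refl]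

/-- The finite approximations of the solution `e` of `e = c ≫ V (e, h)`. -/
noncomputable def corecApprox {A : REL.{u}} {B Y : Fin k → REL.{u}} (c : A ⟶ V.obj (Fin.cons A B))
    (h : ∀ i, B i ⟶ Y i) : ℕ → (A ⟶ fixObj V Y)
  | 0 => ofSet ∅
  | n + 1 => c ≫ V.map (consHom (corecApprox c h n) h) ≫ fold V Y

/-- The solution `e` of `e = c ≫ V (e, h)`. -/
noncomputable def corec {A : REL.{u}} {B Y : Fin k → REL.{u}} (c : A ⟶ V.obj (Fin.cons A B))
    (h : ∀ i, B i ⟶ Y i) : A ⟶ fixObj V Y := ofSet {p | ∃ n, R (corecApprox c h n) p.1 p.2}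

section

variable {A : REL.{u}} {B Y : Fin k → REL.{u}}

theorem map_consHom_mono (hV : V ∈ VREL (k + 1)) {A B : REL.{u}} {Y Z : Fin k → REL.{u}}
    {e e' : A ⟶ B} {g g' : ∀ i, Y i ⟶ Z i} (he : rel e ⊆ rel e') (hg : ∀ i, rel (g i) ⊆ rel (g' i)) :
    rel (V.map (consHom e g)) ⊆ rel (V.map (consHom e' g')) :=
  hV.2.1.monotone _ _ _ _ (consHom_mono he hg)

theorem corecApprox_subset_succ (hV : V ∈ VREL (k + 1)) (c : A ⟶ V.obj (Fin.cons A B))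
    (h : ∀ i, B i ⟶ Y i) (n : ℕ) :
    rel (corecApprox c h n) ⊆ rel (corecApprox c h (n + 1)) := by
  induction n with
  | zero => exact fun _ hp => absurd hp (Set.notMem_empty _)
  | succ n ih =>
    exact comp_mono subset_rfl (comp_mono (map_consHom_mono hV ih fun _ => subset_rfl) subset_rfl)

/-- Kleene's argument: continuity lets one step of the operator on the union be computed at a finite
approximation, whose image is the next one. -/
theorem corec_fold (hV : V ∈ VREL (k + 1)) (c : A ⟶ V.obj (Fin.cons A B)) (h : ∀ i, B i ⟶ Y i) :
    c ≫ V.map (consHom (corec c h) h) ≫ fold V Y = corec c h :=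
  hom_ext fun a b => by
    constructor
    · rintro ⟨x, h1, y, h2, h3⟩
      obtain ⟨n, hn⟩ := exists_of_map_consHom_chain hV _ (corecApprox_subset_succ hV c h) h (corec c h)
        (fun a b hab => hab) h2
      exact ⟨n + 1, x, h1, y, hn, h3⟩
    · rintro ⟨n, hn⟩
      have h0 : rel (corecApprox c h n) ⊆ rel (corec c h) := fun p hp => Exists.intro n hp
      exact comp_mono subset_rfl (comp_mono (map_consHom_mono hV h0 fun _ => subset_rfl) subset_rfl)
        (corecApprox_subset_succ hV c h n hn)

theorem corec_out (hV : V ∈ VREL (k + 1)) (c : A ⟶ V.obj (Fin.cons A B)) (h : ∀ i, B i ⟶ Y i) :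
    corec c h ≫ out V Y = c ≫ V.map (consHom (corec c h) h) := by
  conv_lhs => rw [← corec_fold hV c h, Category.assoc, Category.assoc, fold_out hV, Category.comp_id]

/-- `corec c h` is the least prefixed point of its operator; this yields monotonicity and continuity
of the fixed point functor. -/
theorem corec_subset (hV : V ∈ VREL (k + 1)) (c : A ⟶ V.obj (Fin.cons A B)) (h : ∀ i, B i ⟶ Y i)
    (e : A ⟶ fixObj V Y) (he : rel (c ≫ V.map (consHom e h) ≫ fold V Y) ⊆ rel e) :
    rel (corec c h) ⊆ rel e := by
  have h1 : ∀ n, rel (corecApprox c h n) ⊆ rel e := by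
    intro n
    induction n with
    | zero => exact fun _ hp => absurd hp (Set.notMem_empty _)
    | succ n ih =>
      exact (comp_mono subset_rfl (comp_mono (map_consHom_mono hV ih fun _ => subset_rfl)
        subset_rfl)).trans he
  rintro p ⟨n, hn⟩
  exact h1 n hn

/-- Unfolding lowers the truncation level by one under `V`, which is what makes the induction in
`fixObj_hom_ext` progress. -/
theorem restr_out (hV : V ∈ VREL (k + 1)) (Y : Fin k → REL.{u}) (n : ℕ) :
    restr (iterate V Y (n + 1)) (fixObj V Y) ≫ out V Y =
      out V Y ≫ V.map (consHom (restr (iterate V Y n) (fixObj V Y)) fun i => 𝟙 (Y i)) := by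
  rw [map_consHom_restr hV Y (iterate_subset_fixObj Y n)]
  have key : ∀ (D E E' : REL.{u}) (h : E = E'), restr D E ≫ incl E E' = incl E E' ≫ restr D E' := by
    intro D E E' h
    subst h
    rw [incl_self, Category.id_comp, Category.comp_id]
  exact key _ _ _ (obj_fixObj hV Y).symm

/-- The equation expresses the truncation of a solution at level `n + 1` through its truncation at
level `n`, and at level `0` nothing is left. Solutions therefore agree at all levels. -/
theorem fixObj_hom_ext (hV : V ∈ VREL (k + 1)) (c : A ⟶ V.obj (Fin.cons A B)) (h : ∀ i, B i ⟶ Y i)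
    {e e' : A ⟶ fixObj V Y} (he : e ≫ out V Y = c ≫ V.map (consHom e h))
    (he' : e' ≫ out V Y = c ≫ V.map (consHom e' h)) : e = e' := by
  have h1 : ∀ n, e ≫ restr (iterate V Y n) (fixObj V Y) = e' ≫ restr (iterate V Y n) (fixObj V Y) := by
    intro n
    induction n with
    | zero =>
      refine hom_ext fun a b => ⟨?_, ?_⟩ <;>
      · rintro ⟨x, -, hx⟩
        exact absurd ((R_restr _ _ _ _).mp hx).2 (ZFSet.notMem_empty _)
    | succ n ih =>
      have h2 : ∀ e : A ⟶ fixObj V Y, e ≫ out V Y = c ≫ V.map (consHom e h) →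
          (e ≫ restr (iterate V Y (n + 1)) (fixObj V Y)) ≫ out V Y =
            c ≫ V.map (consHom (e ≫ restr (iterate V Y n) (fixObj V Y)) h) := by
        intro e he
        rw [Category.assoc, restr_out hV, ← Category.assoc, he, Category.assoc, map_consHom_comp hV.1]
        simp only [Category.comp_id]
      have h3 := (h2 e he).trans ((congrArg (fun s => c ≫ V.map (consHom s h)) ih).trans (h2 e' he').symm)
      have h4 := congrArg (fun s => s ≫ fold V Y) h3
      simpa only [Category.assoc, out_fold hV, Category.comp_id] using h4
  -- Every element of `fixObj V Y` lies in some iterate, so a relation into it is the union of its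
  -- truncations.
  have h2 : ∀ e : A ⟶ fixObj V Y, ∀ a b, R e a b ↔ ∃ n, R (e ≫ restr (iterate V Y n) (fixObj V Y)) a b := by
    intro e a b
    constructor
    · intro hab
      obtain ⟨n, hn⟩ := mem_fixObj.mp b.2
      exact ⟨n, b, hab, (R_restr _ _ _ _).mpr ⟨rfl, hn⟩⟩
    · rintro ⟨n, b', hab, hb⟩
      obtain ⟨rfl, -⟩ := (R_restr _ _ _ _).mp hb
      exact hab
  refine hom_ext fun a b => ?_
  rw [h2 e, h2 e']
  simp only [h1]

theorem eq_corec (hV : V ∈ VREL (k + 1)) (c : A ⟶ V.obj (Fin.cons A B)) (h : ∀ i, B i ⟶ Y i)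
    {e : A ⟶ fixObj V Y} (he : e ≫ out V Y = c ≫ V.map (consHom e h)) : e = corec c h :=
  fixObj_hom_ext hV c h he (corec_out hV c h)

end

/-! ### The strength of a variable set, on tuples `(A, Y)` -/

/-- The canonical identification of `!X ⊗ (A, Y)` with `(!X ⊗ A, !X ⊗ Y)`. -/
noncomputable def tensorCons (P A : REL.{u}) (Y : Fin k → REL.{u}) (i : Fin (k + 1)) :
    P ⊗ (Fin.cons A Y : Fin (k + 1) → REL.{u}) i ⟶
      (Fin.cons (P ⊗ A) fun i => P ⊗ Y i : Fin (k + 1) → REL.{u}) i :=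
  Fin.cases (motive := fun i => P ⊗ (Fin.cons A Y : Fin (k + 1) → REL.{u}) i ⟶
      (Fin.cons (P ⊗ A) fun i => P ⊗ Y i : Fin (k + 1) → REL.{u}) i) (𝟙 (P ⊗ A)) (fun i => 𝟙 (P ⊗ Y i)) i

variable (V) in
/-- The strength `!X ⊗ V (A, Y) ⟶ V (!X ⊗ A, !X ⊗ Y)`. -/
noncomputable def strengthCons (X A : REL.{u}) (Y : Fin k → REL.{u}) :
    excl X ⊗ V.obj (Fin.cons A Y) ⟶ V.obj (Fin.cons (excl X ⊗ A) fun i => excl X ⊗ Y i) :=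
  V.strength X (Fin.cons A Y) ≫ V.map (tensorCons (excl X) A Y)

/-- The laws of the strength pass to `strengthCons` because every component of `tensorCons` is an
identity; only unit laws are left in each coordinate. -/
theorem strengthCons_natural (hV : V.IsStrong) {X X' A A' : REL.{u}} {Y Y' : Fin k → REL.{u}}
    (f : X ⟶ X') (a : A ⟶ A') (g : ∀ i, Y i ⟶ Y' i) :
    (exclMap f ⊗ₘ V.map (consHom a g)) ≫ strengthCons V X' A' Y' =
      strengthCons V X A Y ≫ V.map (consHom (exclMap f ⊗ₘ a) fun i => exclMap f ⊗ₘ g i) := by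
  rw [strengthCons, strengthCons, ← Category.assoc, hV.strength_natural, Category.assoc,
    Category.assoc, ← hV.map_comp, ← hV.map_comp]
  refine congrArg (fun s => _ ≫ V.map s) (funext fun i => ?_)
  refine Fin.cases ?_ (fun j => ?_) i
  · exact (Category.comp_id _).trans (Category.id_comp _).symm
  · exact (Category.comp_id _).trans (Category.id_comp _).symm

theorem strengthCons_natural_right (hV : V.IsStrong) (X : REL.{u}) {A A' : REL.{u}}
    {Y Y' : Fin k → REL.{u}} (a : A ⟶ A') (g : ∀ i, Y i ⟶ Y' i) :
    excl X ◁ V.map (consHom a g) ≫ strengthCons V X A' Y' =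
      strengthCons V X A Y ≫ V.map (consHom (excl X ◁ a) fun i => excl X ◁ g i) := by
  have h := strengthCons_natural hV (𝟙 X) a g
  simpa only [exclMap_id, id_tensorHom] using h

theorem strengthCons_seely2 (hV : V.IsStrong) (X₁ X₂ A : REL.{u}) (Y : Fin k → REL.{u}) :
    (seely2 X₁ X₂).hom ▷ V.obj (Fin.cons A Y) ≫ strengthCons V (SeelyStruct.wth X₁ X₂) A Y =
      (α_ (excl X₁) (excl X₂) (V.obj (Fin.cons A Y))).hom ≫ excl X₁ ◁ strengthCons V X₂ A Y ≫
        strengthCons V X₁ (excl X₂ ⊗ A) (fun i => excl X₂ ⊗ Y i) ≫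
          V.map (consHom ((α_ (excl X₁) (excl X₂) A).inv ≫ (seely2 X₁ X₂).hom ▷ A)
            fun i => (α_ (excl X₁) (excl X₂) (Y i)).inv ≫ (seely2 X₁ X₂).hom ▷ Y i) := by
  rw [strengthCons, strengthCons, strengthCons, ← Category.assoc, hV.strength_seely2,
    MonoidalCategory.whiskerLeft_comp]
  simp only [Category.assoc]
  rw [reassoc_of% strength_natural_right hV X₁ (tensorCons (excl X₂) A Y)]
  simp only [← hV.map_comp]
  refine congrArg (fun s => _ ≫ _ ≫ _ ≫ V.map s) (funext fun i => ?_)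
  refine Fin.cases ?_ (fun j => ?_) i
  · change ((α_ _ _ A).inv ≫ _ ▷ A) ≫ 𝟙 _ = excl X₁ ◁ 𝟙 (excl X₂ ⊗ A) ≫ 𝟙 _ ≫ ((α_ _ _ A).inv ≫ _ ▷ A)
    rw [MonoidalCategory.whiskerLeft_id, Category.id_comp, Category.id_comp, Category.comp_id]
  · change ((α_ _ _ (Y j)).inv ≫ _ ▷ Y j) ≫ 𝟙 _ =
      excl X₁ ◁ 𝟙 (excl X₂ ⊗ Y j) ≫ 𝟙 _ ≫ ((α_ _ _ (Y j)).inv ≫ _ ▷ Y j)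
    rw [MonoidalCategory.whiskerLeft_id, Category.id_comp, Category.id_comp, Category.comp_id]

theorem strengthCons_seely0 (hV : V.IsStrong) (A : REL.{u}) (Y : Fin k → REL.{u}) :
    seely0.hom ▷ V.obj (Fin.cons A Y) ≫ strengthCons V top A Y =
      (λ_ (V.obj (Fin.cons A Y))).hom ≫ V.map (consHom ((λ_ A).inv ≫ seely0.hom ▷ A)
        fun i => (λ_ (Y i)).inv ≫ seely0.hom ▷ Y i) := by
  rw [strengthCons, ← Category.assoc, hV.strength_seely0, Category.assoc, ← hV.map_comp]
  refine congrArg (fun s => _ ≫ V.map s) (funext fun i => ?_)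
  refine Fin.cases ?_ (fun j => ?_) i
  · exact Category.comp_id _
  · exact Category.comp_id _

theorem strengthCons_dig (hV : V.IsStrong) (X A : REL.{u}) (Y : Fin k → REL.{u}) :
    dig X ▷ V.obj (Fin.cons A Y) ≫ strengthCons V (excl X) A Y =
      strengthCons V X A Y ≫ V.map (consHom (dig X ▷ A) fun i => dig X ▷ Y i) := by
  rw [strengthCons, strengthCons, ← Category.assoc, hV.strength_dig, Category.assoc, Category.assoc,
    ← hV.map_comp, ← hV.map_comp]
  refine congrArg (fun s => _ ≫ V.map s) (funext fun i => ?_)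
  refine Fin.cases ?_ (fun j => ?_) i
  · exact (Category.comp_id _).trans (Category.id_comp _).symm
  · exact (Category.comp_id _).trans (Category.id_comp _).symm

theorem strength_map_cases (hV : V.IsStrong) (X A B : REL.{u}) (Y : Fin k → REL.{u})
    (s : excl X ⊗ A ⟶ B) :
    V.strength X (Fin.cons A Y) ≫
        V.map (Z := Fin.cons B fun i => excl X ⊗ Y i) (Fin.cases s fun i => 𝟙 (excl X ⊗ Y i)) =
      strengthCons V X A Y ≫ V.map (consHom s fun i => 𝟙 (excl X ⊗ Y i)) := by
  rw [strengthCons, Category.assoc, ← hV.map_comp]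
  refine congrArg (fun s => _ ≫ V.map s) (funext fun i => ?_)
  refine Fin.cases ?_ (fun j => ?_) i
  · exact (Category.id_comp _).symm
  · exact (Category.id_comp _).symm

end

end

section

open SeelyStruct FunctorWithStrength

/-! ### The fixed point of a variable set -/

variable {k : ℕ} {V : FunctorWithStrength REL.{u} (k + 1)}

variable (V) in
/-- The action on morphisms of the fixed point of `V`. -/
noncomputable def fixMap {Y Z : Fin k → REL.{u}} (f : ∀ i, Y i ⟶ Z i) : fixObj V Y ⟶ fixObj V Z :=
  corec (out V Y) f

variable (V) in
/-- The strength of the fixed point of `V`. -/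
noncomputable def fixStrength (X : REL.{u}) (Y : Fin k → REL.{u}) :
    excl X ⊗ fixObj V Y ⟶ fixObj V fun i => excl X ⊗ Y i :=
  corec (excl X ◁ out V Y ≫ strengthCons V X (fixObj V Y) Y) fun i => 𝟙 (excl X ⊗ Y i)

variable (V) in
/-- The fixed point of `V` with respect to its first argument. -/
noncomputable def fix : FunctorWithStrength REL.{u} k where
  obj := fixObj V
  map := fixMap V
  strength := fixStrength V

theorem fixMap_out (hV : V ∈ VREL (k + 1)) {Y Z : Fin k → REL.{u}} (f : ∀ i, Y i ⟶ Z i) :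
    fixMap V f ≫ out V Z = out V Y ≫ V.map (consHom (fixMap V f) f) :=
  corec_out hV _ _

theorem fixStrength_out (hV : V ∈ VREL (k + 1)) (X : REL.{u}) (Y : Fin k → REL.{u}) :
    fixStrength V X Y ≫ out V (fun i => excl X ⊗ Y i) =
      excl X ◁ out V Y ≫ strengthCons V X (fixObj V Y) Y ≫
        V.map (consHom (fixStrength V X Y) fun i => 𝟙 (excl X ⊗ Y i)) :=
  (corec_out hV _ _).trans (Category.assoc _ _ _)

theorem fixMap_id (hV : V ∈ VREL (k + 1)) (Y : Fin k → REL.{u}) :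
    fixMap V (fun i => 𝟙 (Y i)) = 𝟙 (fixObj V Y) := by
  refine (eq_corec hV _ _ ?_).symm
  rw [Category.id_comp, map_consHom_id hV.1, Category.comp_id]

theorem fixMap_comp (hV : V ∈ VREL (k + 1)) {Y Z W : Fin k → REL.{u}} (f : ∀ i, Y i ⟶ Z i)
    (g : ∀ i, Z i ⟶ W i) : fixMap V (fun i => f i ≫ g i) = fixMap V f ≫ fixMap V g := by
  refine (eq_corec hV _ _ ?_).symm
  rw [Category.assoc, fixMap_out hV, reassoc_of% fixMap_out hV f, map_consHom_comp hV.1]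

theorem fixStrength_natural (hV : V ∈ VREL (k + 1)) {X X' : REL.{u}} {Y Y' : Fin k → REL.{u}}
    (f : X ⟶ X') (g : ∀ i, Y i ⟶ Y' i) :
    (exclMap f ⊗ₘ fixMap V g) ≫ fixStrength V X' Y' =
      fixStrength V X Y ≫ fixMap V fun i => exclMap f ⊗ₘ g i := by
  -- Both sides unfold one layer of the fixed point, apply the strength of `V` at `X`, and continue
  -- recursively with parameters acted on by `f` and `g`.
  refine fixObj_hom_ext hV (excl X ◁ out V Y ≫ strengthCons V X (fixObj V Y) Y)
    (fun i => exclMap f ⊗ₘ g i) ?_ ?_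
  · rw [Category.assoc, fixStrength_out hV, ← id_tensorHom,
      ← Category.assoc, tensorHom_comp, fixMap_out hV, Category.comp_id,
      ← Category.id_comp (exclMap f), ← tensorHom_comp, Category.assoc,
      reassoc_of% strengthCons_natural hV.1 f (fixMap V g) g, map_consHom_comp hV.1, id_tensorHom,
      Category.assoc]
    simp only [Category.comp_id, Category.id_comp]
  · rw [Category.assoc, fixMap_out hV, reassoc_of% fixStrength_out hV X Y, map_consHom_comp hV.1,
      Category.assoc]
    simp only [Category.id_comp]

theorem fixStrength_seely2 (hV : V ∈ VREL (k + 1)) (X₁ X₂ : REL.{u}) (Y : Fin k → REL.{u}) :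
    (seely2 X₁ X₂).hom ▷ fixObj V Y ≫ fixStrength V (SeelyStruct.wth X₁ X₂) Y =
      (α_ (excl X₁) (excl X₂) (fixObj V Y)).hom ≫ excl X₁ ◁ fixStrength V X₂ Y ≫
        fixStrength V X₁ (fun i => excl X₂ ⊗ Y i) ≫
          fixMap V fun i => (α_ (excl X₁) (excl X₂) (Y i)).inv ≫ (seely2 X₁ X₂).hom ▷ Y i := by
  -- The common coalgebra unfolds once, applies the strengths at `X₂` and then `X₁`, and
  -- reassociates under `V` so that its own carrier reappears in the recursive argument.
  refine fixObj_hom_ext hV ((excl X₁ ⊗ excl X₂) ◁ out V Y ≫ (α_ _ _ _).hom ≫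
    excl X₁ ◁ strengthCons V X₂ (fixObj V Y) Y ≫ strengthCons V X₁ _ _ ≫
      V.map (consHom (α_ (excl X₁) (excl X₂) (fixObj V Y)).inv fun i => 𝟙 _))
    (fun i => (α_ (excl X₁) (excl X₂) (Y i)).inv ≫ (seely2 X₁ X₂).hom ▷ Y i) ?_ ?_
  · rw [Category.assoc, fixStrength_out hV, ← whisker_exchange_assoc,
      reassoc_of% strengthCons_seely2 hV.1 X₁ X₂ (fixObj V Y) Y]
    simp only [Category.assoc, map_consHom_comp hV.1, Category.comp_id, Category.id_comp]
  · rw [Category.assoc, Category.assoc, Category.assoc, fixMap_out hV,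
      reassoc_of% fixStrength_out hV X₁ (fun i => excl X₂ ⊗ Y i),
      ← MonoidalCategory.whiskerLeft_comp_assoc, fixStrength_out hV X₂ Y]
    simp only [MonoidalCategory.whiskerLeft_comp, Category.assoc]
    rw [reassoc_of% strengthCons_natural_right hV.1 X₁ (fixStrength V X₂ Y) fun i => 𝟙 (excl X₂ ⊗ Y i)]
    simp only [map_consHom_comp hV.1, MonoidalCategory.whiskerLeft_id, Category.id_comp,
      Iso.inv_hom_id_assoc, tensor_whiskerLeft, Category.assoc]

theorem fixStrength_seely0 (hV : V ∈ VREL (k + 1)) (Y : Fin k → REL.{u}) :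
    seely0.hom ▷ fixObj V Y ≫ fixStrength V top Y =
      (λ_ (fixObj V Y)).hom ≫ fixMap V fun i => (λ_ (Y i)).inv ≫ seely0.hom ▷ Y i := by
  -- The final inverse unitor restores the carrier `𝟙_ ⊗ fixObj V Y` in the recursive argument.
  refine fixObj_hom_ext hV (𝟙_ REL.{u} ◁ out V Y ≫ (λ_ _).hom ≫
      V.map (consHom (λ_ (fixObj V Y)).inv fun i => 𝟙 _))
    (fun i => (λ_ (Y i)).inv ≫ seely0.hom ▷ Y i) ?_ ?_
  · rw [Category.assoc, fixStrength_out hV, ← whisker_exchange_assoc,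
      reassoc_of% strengthCons_seely0 hV.1 (fixObj V Y) Y]
    simp only [Category.assoc, map_consHom_comp hV.1, Category.comp_id, Category.id_comp]
  · rw [Category.assoc, fixMap_out hV, Category.assoc, Category.assoc, map_consHom_comp hV.1,
      leftUnitor_naturality_assoc]
    simp only [Category.id_comp, Iso.inv_hom_id_assoc]

theorem fixStrength_dig (hV : V ∈ VREL (k + 1)) (X : REL.{u}) (Y : Fin k → REL.{u}) :
    dig X ▷ fixObj V Y ≫ fixStrength V (excl X) Y =
      fixStrength V X Y ≫ fixMap V fun i => dig X ▷ Y i := by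
  refine fixObj_hom_ext hV (excl X ◁ out V Y ≫ strengthCons V X (fixObj V Y) Y)
    (fun i => dig X ▷ Y i) ?_ ?_
  · rw [Category.assoc, fixStrength_out hV, ← whisker_exchange_assoc,
      reassoc_of% strengthCons_dig hV.1 X (fixObj V Y) Y, map_consHom_comp hV.1, Category.assoc]
    simp only [Category.comp_id]
  · rw [Category.assoc, fixMap_out hV, reassoc_of% fixStrength_out hV X Y, map_consHom_comp hV.1,
      Category.assoc]
    simp only [Category.id_comp]

theorem fix_isStrong (hV : V ∈ VREL (k + 1)) : (fix V).IsStrong where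
  map_id := fixMap_id hV
  map_comp := fixMap_comp hV
  strength_natural := fixStrength_natural hV
  strength_seely2 := fixStrength_seely2 hV
  strength_seely0 := fixStrength_seely0 hV
  strength_dig := fixStrength_dig hV

theorem iterate_mono (hV : V ∈ VREL (k + 1)) {Y Z : Fin k → REL.{u}}
    (h : ∀ i, (Y i).set ⊆ (Z i).set) (n : ℕ) : (iterate V Y n).set ⊆ (iterate V Z n).set := by
  induction n with
  | zero => exact subset_rfl
  | succ n ih => exact obj_cons_subset hV ih h

theorem incl_comp_incl {A B D : REL.{u}} (h : A.set ⊆ B.set) : incl A B ≫ incl B D = incl A D :=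
  hom_ext fun a _ => ⟨fun ⟨_, h1, h2⟩ => Eq.trans h1 h2,
    fun h1 => ⟨⟨a.1, h a.2⟩, rfl, h1⟩⟩

/-- When `s ≤ t`, the solution for `t` is a prefixed point of the operator defining the solution for
`s`. -/
theorem fix_monotone (hV : V ∈ VREL (k + 1)) : LocallyMonotone (fix V) := by
  intro Y Z s t h
  refine corec_subset hV _ _ _ ?_
  have h1 : out V Y ≫ V.map (consHom (fixMap V t) t) ≫ fold V Z = fixMap V t :=
    corec_fold hV (out V Y) t
  change _ ⊆ rel (fixMap V t)
  conv_rhs => rw [← h1]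
  exact comp_mono subset_rfl (comp_mono (map_consHom_mono hV subset_rfl h) subset_rfl)

theorem fix_mem (hV : V ∈ VREL (k + 1)) : fix V ∈ VREL k := by
  refine ⟨fix_isStrong hV, locallyContinuous_of_monotone (fix_monotone hV) ?_, ?_⟩
  · intro Y Z D hne hD a b h
    refine (R_sUnion D (fun s => fixMap V s) a b).mp ?_
    -- By minimality, it is enough that the union of the `fixMap V s` be a prefixed point of the
    -- operator at the union of `D`; one step of that operator already occurs at some `s ∈ D`.
    refine corec_subset hV _ _ (sUnion {r | ∃ s ∈ D, fixMap V s = r}) ?_ h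
    rintro ⟨a, b⟩ ⟨x, h1, y, h2, h3⟩
    obtain ⟨s, hs, h4⟩ := exists_of_map_consHom hV hne (fun s => fixMap V s) (fun s => s) (by
        intro s hs t ht
        obtain ⟨r, hr, h5, h6⟩ := hD s hs t ht
        exact ⟨r, hr, ⟨fix_monotone hV _ _ _ _ h5, h5⟩, fix_monotone hV _ _ _ _ h6, h6⟩)
      _ _ (fun a b => (R_sUnion D (fun s => fixMap V s) a b).mp)
      (fun i a b => (R_tupleSup D i a b).mp) h2
    refine (R_sUnion D (fun s => fixMap V s) a b).mpr ⟨s, hs, ?_⟩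
    have h5 : out V Y ≫ V.map (consHom (fixMap V s) s) ≫ fold V Z = fixMap V s :=
      corec_fold hV (out V Y) s
    rw [← h5]
    exact ⟨x, h1, y, h4, h3⟩
  · intro Y Z h
    have h1 : (fixObj V Y).set ⊆ (fixObj V Z).set := by
      intro x hx
      obtain ⟨n, hn⟩ := mem_fixObj.mp hx
      exact mem_fixObj.mpr ⟨n, iterate_mono hV h n hn⟩
    -- The inclusion solves the equation defining `fixMap` at inclusions, since `V` sends inclusions
    -- to inclusions.
    refine ⟨h1, (eq_corec (e := incl (fixObj V Y) (fixObj V Z)) hV _ _ ?_).symm⟩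
    rw [map_consHom_incl hV h1 h, out, out, incl_comp_incl h1, incl_comp_incl (by rw [obj_fixObj hV])]

theorem fix_isFixpoint (hV : V ∈ VREL (k + 1)) : V.IsFixpoint (fix V) := by
  refine ⟨fix_isStrong hV, obj_fixObj hV, ?_, ?_⟩
  · intro Y Z f
    change V.map (consHom (fixMap V f) f) ≫ eqToHom (obj_fixObj hV Z) =
      eqToHom (obj_fixObj hV Y) ≫ fixMap V f
    rw [eqToHom_eq_incl, eqToHom_eq_incl]
    change V.map (consHom (fixMap V f) f) ≫ fold V Z = fold V Y ≫ fixMap V f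
    -- Conjugation by the mutually inverse `fold` and `out` turns the corecursive equation into the
    -- required fixed point equation.
    have h1 := congrArg (fun s => fold V Y ≫ s ≫ fold V Z) (fixMap_out hV f)
    simp only [Category.assoc, out_fold hV, reassoc_of% fold_out hV Y] at h1
    exact h1.symm.trans (congrArg (fun s => fold V Y ≫ s) (Category.comp_id _))
  · intro X Y
    refine Eq.trans ?_ ((congrArg (fun s => s ≫ eqToHom (obj_fixObj hV _))
      (strength_map_cases hV.1 X (fixObj V Y) _ Y (fixStrength V X Y)).symm).trans
        (Category.assoc _ _ _))
    change excl X ◁ eqToHom (obj_fixObj hV Y) ≫ fixStrength V X Y = _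
    rw [eqToHom_eq_incl, eqToHom_eq_incl]
    change excl X ◁ fold V Y ≫ fixStrength V X Y = _ ≫ fold V _
    have h1 := congrArg (fun s => excl X ◁ fold V Y ≫ s ≫ fold V _) (fixStrength_out hV X Y)
    simp only [Category.assoc, out_fold hV, ← MonoidalCategory.whiskerLeft_comp_assoc, fold_out hV,
      MonoidalCategory.whiskerLeft_id, Category.id_comp] at h1
    rw [Category.assoc]
    exact (congrArg (fun s => excl X ◁ fold V Y ≫ s) (Category.comp_id _).symm).trans h1

theorem fixObj_isFinalCoalgebra (hV : V ∈ VREL (k + 1)) (Y : Fin k → REL.{u}) :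
    V.IsFinalCoalgebra Y (fixObj V Y) := by
  refine ⟨(obj_fixObj hV Y).symm, fun A t => ⟨corec t fun i => 𝟙 (Y i), ?_, ?_⟩⟩
  · change corec t (fun i => 𝟙 (Y i)) ≫ eqToHom _ = _
    rw [eqToHom_eq_incl]
    exact corec_out hV t _
  · intro e he
    rw [eqToHom_eq_incl] at he
    exact eq_corec hV t _ he

/-! ### Uniqueness of the fixed points -/

theorem iterate_subset_of_eq (hV : V ∈ VREL (k + 1)) {Y : Fin k → REL.{u}} {M : REL.{u}}
    (h : M = V.obj (Fin.cons M Y)) (n : ℕ) : (iterate V Y n).set ⊆ M.set := by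
  induction n with
  | zero => exact fun x hx => absurd hx (ZFSet.notMem_empty x)
  | succ n ih =>
    rw [h]
    exact obj_cons_subset hV ih fun _ => subset_rfl

/-- Any set fixed by `V (-, Y)` contains the iterates, so `fixObj V Y` is a subcoalgebra of `M`.
Corecursion from `M` into it, followed by the inclusion, is an endomorphism of a final coalgebra,
hence the identity, so nothing of `M` lies outside. -/
theorem eq_fixObj_of_isFinalCoalgebra (hV : V ∈ VREL (k + 1)) {Y : Fin k → REL.{u}} {M : REL.{u}}
    (hM : V.IsFinalCoalgebra Y M) : M = fixObj V Y := by
  obtain ⟨h, hM⟩ := hM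
  have h1 : (fixObj V Y).set ⊆ M.set := by
    intro x hx
    obtain ⟨n, hn⟩ := mem_fixObj.mp hx
    exact iterate_subset_of_eq hV h n hn
  have h2 : incl (fixObj V Y) M ≫ eqToHom h =
      out V Y ≫ V.map (consHom (incl (fixObj V Y) M) fun i => 𝟙 (Y i)) := by
    simp only [← incl_self]
    rw [map_consHom_incl hV h1 fun _ => subset_rfl, out, eqToHom_eq_incl, incl_comp_incl h1,
      incl_comp_incl (by rw [obj_fixObj hV])]
  have h3 := corec_out hV (eqToHom h) fun i => 𝟙 (Y i)
  set j := corec (eqToHom h) fun i => 𝟙 (Y i)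
  have h4 : j ≫ incl (fixObj V Y) M = 𝟙 M := by
    refine (hM M (eqToHom h)).unique ?_ ?_
    · rw [Category.assoc, h2, reassoc_of% h3, map_consHom_comp hV.1]
      simp only [Category.comp_id]
    · rw [map_consHom_id hV.1, Category.id_comp, Category.comp_id]
  refine REL.ext (ZFSet.ext fun x => ⟨fun hx => ?_, fun hx => h1 hx⟩)
  -- The identity of `M` factors through `fixObj V Y`: the intermediate element `b` has underlying
  -- set `x`.
  obtain ⟨b, -, hb⟩ : R (j ≫ incl (fixObj V Y) M) ⟨x, hx⟩ ⟨x, hx⟩ := by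
    rw [h4]
    rfl
  have h5 : b.1 = x := hb
  rw [← h5]
  exact b.2

theorem tr_eqToHom {A B : REL.{u}} (h : A = B) : tr (eqToHom h) = eqToHom h.symm := by
  subst h
  exact tr_id

/-- Transposition reverses arrows and is involutive, so it carries the universal property of an
algebra of `V` to that of a coalgebra of its dual, with the same carrier. -/
theorem isFinalCoalgebra_dual_iff (Y : Fin k → REL.{u}) (M : REL.{u}) :
    (dual V).IsFinalCoalgebra Y M ↔ V.IsInitialAlgebra Y M := by
  have key : ∀ (A : REL.{u}) (h : M = V.obj (Fin.cons M Y)) (t : V.obj (Fin.cons A Y) ⟶ A) (e : M ⟶ A),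
      tr e ≫ eqToHom h = tr t ≫ (dual V).map (consHom (tr e) fun i => 𝟙 (Y i)) ↔
        eqToHom h.symm ≫ e = V.map (consHom e fun i => 𝟙 (Y i)) ≫ t := by
    intro A h t e
    have h1 : (dual V).map (consHom (tr e) fun i => 𝟙 (Y i)) =
        tr (V.map (consHom e fun i => 𝟙 (Y i))) := by
      change tr (V.map fun i => tr (consHom (tr e) (fun i => 𝟙 (Y i)) i)) = _
      rw [tr_consHom]
      simp only [tr_id, tr_tr]
    rw [h1]
    change tr e ≫ eqToHom h = tr t ≫ tr (V.map (consHom e fun i => 𝟙 (Y i))) ↔ _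
    rw [← tr_comp, ← tr_eqToHom h.symm, ← tr_comp]
    exact ⟨fun h => congrArg tr h, fun h => congrArg tr h⟩
  constructor
  · rintro ⟨h, hM⟩
    refine ⟨Eq.symm h, fun A t => ?_⟩
    obtain ⟨e, he, hu⟩ := hM A (tr t)
    exact ⟨tr e, (key A h t (tr e)).mp he,
      fun e' he' => congrArg tr (hu (tr e') ((key A h t e').mpr he'))⟩
  · rintro ⟨h, hM⟩
    refine ⟨Eq.symm h, fun A t => ?_⟩
    obtain ⟨e, he, hu⟩ := hM A (tr t)
    exact ⟨tr e, (key A h.symm (tr t) e).mpr he,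
      fun e' he' => congrArg tr (hu (tr e') ((key A h.symm (tr t) (tr e')).mp he'))⟩

theorem fixObj_dual (Y : Fin k → REL.{u}) : fixObj (dual V) Y = fixObj V Y := by
  have h : ∀ n, iterate (dual V) Y n = iterate V Y n := by
    intro n
    induction n with
    | zero => rfl
    | succ n ih =>
      change V.obj (Fin.cons (iterate (dual V) Y n) Y) = _
      rw [ih]
      rfl
  simp only [fixObj, h]

theorem dual_mem_VREL (hV : V ∈ VREL (k + 1)) : dual V ∈ VREL (k + 1) := dual_eq V ▸ dual_mem hV

/-- Once the objects are known, the two fixed point equations, conjugated by `out` and `fold`, are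
exactly the corecursive equations defining `fixMap` and `fixStrength`, whose solutions are unique.
-/
theorem eq_fix_of_isFixpoint (hV : V ∈ VREL (k + 1)) {M : FunctorWithStrength REL.{u} k}
    (hM : V.IsFixpoint M) (hobj : ∀ Y, M.obj Y = fixObj V Y) : M = fix V := by
  obtain ⟨obj, map, strength⟩ := M
  obtain rfl : obj = fixObj V := funext hobj
  obtain ⟨-, h, hmap, hstr⟩ := hM
  have h1 : ∀ (Y Z : Fin k → REL.{u}) (f : ∀ i, Y i ⟶ Z i), map f = fixMap V f := by
    intro Y Z f
    refine eq_corec hV _ _ ?_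
    have h2 : V.map (consHom (map f) f) ≫ eqToHom (h Z) = eqToHom (h Y) ≫ map f := hmap Y Z f
    rw [eqToHom_eq_incl, eqToHom_eq_incl] at h2
    have h3 := congrArg (fun s => out V Y ≫ s ≫ out V Z) h2
    change out V Y ≫ (V.map (consHom (map f) f) ≫ fold V Z) ≫ out V Z =
      out V Y ≫ (fold V Y ≫ map f) ≫ out V Z at h3
    rw [Category.assoc, fold_out hV, Category.comp_id, Category.assoc, reassoc_of% out_fold hV Y] at h3
    exact h3.symm
  have h2 : ∀ X Y, strength X Y = fixStrength V X Y := by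
    intro X Y
    refine eq_corec hV _ _ ?_
    have h3 := (hstr X Y).trans (Category.assoc _ _ _).symm
    have h4 := strength_map_cases hV.1 X (fixObj V Y) _ Y (strength X Y)
    have h5 := h3.trans (congrArg (fun s => s ≫ eqToHom (h _)) h4)
    rw [eqToHom_eq_incl, eqToHom_eq_incl] at h5
    have h6 := congrArg (fun s => excl X ◁ out V Y ≫ s ≫ out V _) h5
    change excl X ◁ out V Y ≫ (excl X ◁ fold V Y ≫ strength X Y) ≫ out V _ =
      excl X ◁ out V Y ≫ ((strengthCons V X (fixObj V Y) Y ≫ _) ≫ fold V _) ≫ out V _ at h6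
    rw [Category.assoc, Category.assoc (_ ≫ _) (fold V _), fold_out hV, Category.comp_id,
      ← MonoidalCategory.whiskerLeft_comp_assoc, out_fold hV, MonoidalCategory.whiskerLeft_id,
      Category.id_comp] at h6
    rw [Category.assoc]
    exact h6
  obtain rfl : @map = @(fix V).map := by
    funext Y Z f
    exact h1 Y Z f
  obtain rfl : strength = (fix V).strength := by
    funext X Y
    exact h2 X Y
  rfl

theorem isGfp_iff (hV : V ∈ VREL (k + 1)) (M : FunctorWithStrength REL.{u} k) :
    V.IsGfp M ↔ M = fix V := by
  constructor
  · rintro ⟨h1, h2⟩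
    exact eq_fix_of_isFixpoint hV h1 fun Y => eq_fixObj_of_isFinalCoalgebra hV (h2 Y)
  · rintro rfl
    exact ⟨fix_isFixpoint hV, fixObj_isFinalCoalgebra hV⟩

/-- The result on final coalgebras is applied to the dual of `V`. As dualization leaves the objects
and thus the iterates unchanged, the carrier is that of the greatest fixed point. -/
theorem isLfp_iff (hV : V ∈ VREL (k + 1)) (M : FunctorWithStrength REL.{u} k) :
    V.IsLfp M ↔ M = fix V := by
  constructor
  · rintro ⟨h1, h2⟩
    exact eq_fix_of_isFixpoint hV h1 fun Y => (eq_fixObj_of_isFinalCoalgebra (dual_mem_VREL hV)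
      ((isFinalCoalgebra_dual_iff Y _).mpr (h2 Y))).trans (fixObj_dual Y)
  · rintro rfl
    refine ⟨fix_isFixpoint hV, fun Y => (isFinalCoalgebra_dual_iff Y _).mp ?_⟩
    change (dual V).IsFinalCoalgebra Y (fixObj V Y)
    rw [← fixObj_dual]
    exact fixObj_isFinalCoalgebra (dual_mem_VREL hV) Y

theorem isMuLLModel : IsMuLLModel REL.{u} VREL where
  seely := isSeely
  strong _ _ hF := hF.1
  zero := zero_eq_range
  comp_mem := comp_mem
  proj_mem := proj_mem
  tensor_mem := tensor_mem
  wth_mem := wth_mem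
  excl_mem := excl_mem
  dual_mem _ _ hF := dual_mem hF
  -- A unary functor has no parameters, so its final coalgebra is the fixed point at the empty
  -- tuple.
  final _ hF := ⟨_, fixObj_isFinalCoalgebra hF Fin.elim0⟩
  gfp_mem _ F hF := ⟨fix F, fix_mem hF, (isGfp_iff hF _).mpr rfl⟩

end

end REL

end MuLL


theorem mainTheorem2 :
    MuLL.IsMuLLModel MuLL.REL.{u} MuLL.VREL ∧
    ∀ (k : ℕ) (V : MuLL.FunctorWithStrength MuLL.REL.{u} (k + 1)), V ∈ MuLL.VREL (k + 1) →
      ∃ N ∈ MuLL.VREL k,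
        (∀ E : Fin k → MuLL.REL.{u},
          (N.obj E).set = ZFSet.iUnion fun n => (MuLL.iterate V E n).set) ∧
        (∀ M : MuLL.FunctorWithStrength MuLL.REL.{u} k, V.IsGfp M ↔ M = N) ∧
        (∀ M : MuLL.FunctorWithStrength MuLL.REL.{u} k, V.IsLfp M ↔ M = N) :=
  ⟨MuLL.REL.isMuLLModel, fun _ V hV => ⟨MuLL.REL.fix V, MuLL.REL.fix_mem hV, fun _ => rfl,
    MuLL.REL.isGfp_iff hV, MuLL.REL.isLfp_iff hV⟩⟩
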